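/- Let $r,\lambda,c_1,c_2>0$ and $\delta_1,\delta_2>0$ with $\delta_1+\delta_2=1$ and $c_1/\delta_1>c_2/\delta_2$. Claims arrive at the times $\theta_1<\theta_2<\cdots$ of a Poisson process $N$ of intensity $\lambda$, i.e. $\theta_k=T_1+\dots+T_k$ with $T_1,T_2,\dots$ i.i.d. exponential with parameter $\lambda$; the claim sizes $\sigma_1,\sigma_2,\dots$ are i.i.d. positive random variables with probability density $f$ on $(0,\infty)$, independent of $N$. For $u_1,u_2\in\mathbb R$, $i=1,2$ and $t\ge 0$ let $$U_i(t)=e^{rt}u_i+c_i\int_0^t e^{r(t-v)}\,dv-\delta_i\sum_{k=1}^{N(t)}e^{r(t-\theta_k)}\sigma_k ,$$ $T_{\min}(u_1,u_2)=\inf\{t\ge 0:\min\{U_1(t),U_2(t)\}<0\}$ and $\tau_2(u_2)=\inf\{t\ge0: U_2(t)<0\}$, with $\inf\emptyset=\infty$. Fix $s>0$ and put $\Psi_{\min}(u_1,u_2)=E[e^{-sT_{\min}(u_1,u_2)}]$, with $e^{-s\infty}=0$. (a) At every $(u_1,u_2)$ with $u_1,u_2\ge0$ and $u_1/\delta_1\le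 u_2/\delta_2$ the function $\Psi_{\min}$ is differentiable (within the quadrant $[0,\infty)^2$, so in the ordinary sense if $u_1>0$), and $$\Big(u_1+\frac{c_1}{r}\Big)\frac{\partial\Psi_{\min}}{\partial u_1}+\Big(u_2+\frac{c_2}{r}\Big)\frac{\partial\Psi_{\min}}{\partial u_2}-\frac{\lambda+s}{r}\Psi_{\min}+\frac{\lambda}{r}\int_0^\infty\Psi_{\min}(u_1-\delta_1z,u_2-\delta_2z)f(z)\,dz=0 .\qquad(1)$$ (b) For every $u_1\ge0$, $$\Psi_{\min}\Big(u_1,\frac{\delta_2}{\delta_1}u_1\Big)=E\Big[e^{-s\tau_2\left(\frac{\delta_2}{\delta_1}u_1\right)}\Big].\qquad(2)$$ (c) On the region $\{u_1/\delta_1\le u_2/\delta_2\}$, $\Psi_{\min}$ is the unique bounded solution of (1)–(2) with the value $1$ at ruined states. That is, $\Psi_{\min}$ is bounded there, equals $1$ at the points with $\min\{u_1,u_2\}<0$, and solves (1)–(2); and if a function $g$ is bounded on this region, equals $1$ at its points with $\min\{u_1,u_2\}<0$, is differentiable at every point of $D=\{u_1,u_2\ge 0,\ u_1/\delta_1\le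 u_2/\delta_2\}$ (within $D$) and satisfies (1) there, and satisfies (2) for $u_1\ge0$, then $g=\Psi_{\min}$ on the region. -/

import Mathlib

open MeasureTheory ProbabilityTheory

noncomputable section

namespace InterestRisk

/-- The random input of the model: `T k` is the time between the `k`-th and the `(k+1)`-th claim
(the first claim having index `0`) and `σ k` is the size of the claim with index `k`.  The waiting
times are exponential with parameter `lam`, the claim sizes are positive with probability density
`f` on `(0, ∞)`, and all these variables are mutually independent.  So the claims arrive according
to a Poisson process of intensity `lam` which is independent of the i.i.d. claim sizes. -/
structure IsClaimModel {Ω : Type*} [MeasurableSpace Ω] (P : Measure Ω) (lam : ℝ) (f : ℝ → ℝ)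
    (T σ : ℕ → Ω → ℝ) : Prop where
  measurable_T : ∀ k, Measurable (T k)
  measurable_σ : ∀ k, Measurable (σ k)
  law_T : ∀ k, P.map (T k) = expMeasure lam
  law_σ : ∀ k, P.map (σ k) =
    (volume.restrict (Set.Ioi (0 : ℝ))).withDensity (fun z => ENNReal.ofReal (f z))
  indep : iIndepFun (Sum.elim T σ) P

/-- Arrival time of the claim with index `k`. -/
def arrival {Ω : Type*} (T : ℕ → Ω → ℝ) (k : ℕ) (ω : Ω) : ℝ :=
  ∑ i ∈ Finset.range (k + 1), T i ω

/-- The Poisson process: number of claims that have arrived up to time `t`. -/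
def claimCount {Ω : Type*} (T : ℕ → Ω → ℝ) (t : ℝ) (ω : Ω) : ℕ :=
  {k : ℕ | arrival T k ω ≤ t}.ncard

/-- One line of business with interest rate `r`, initial reserve `u`, premium rate `c` and share
`δ` of each claim: its reserve at time `t`,
`e^{rt} u + c ∫₀ᵗ e^{r(t-v)} dv - δ ∫₀ᵗ e^{r(t-v)} dS_v`, where `S` is the compound Poisson
process of claims (so the last integral is a sum over the claims up to time `t`). -/
def reserve {Ω : Type*} (r c δ : ℝ) (T σ : ℕ → Ω → ℝ) (u t : ℝ) (ω : Ω) : ℝ :=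
  Real.exp (r * t) * u + c * (∫ v in (0 : ℝ)..t, Real.exp (r * (t - v)))
    - δ * ∑ k ∈ Finset.range (claimCount T t ω), Real.exp (r * (t - arrival T k ω)) * σ k ω

/-- Infimum of a set of (nonnegative) times, in `[0, ∞]`; it is `∞` for the empty set. -/
def infTime (A : Set ℝ) : ENNReal := sInf (ENNReal.ofReal '' A)

/-- The ruin time `inf {t ≥ 0 | U(t) < 0}` of one line of business. -/
def ruinTime {Ω : Type*} (r c δ : ℝ) (T σ : ℕ → Ω → ℝ) (u : ℝ) (ω : Ω) : ENNReal :=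
  infTime {t : ℝ | 0 ≤ t ∧ reserve r c δ T σ u t ω < 0}

/-- The joint ruin time `T_min(u) = inf {t ≥ 0 | min (U₁(t)) (U₂(t)) < 0}`. -/
def ruinTimeMin {Ω : Type*} (r c₁ c₂ δ₁ δ₂ : ℝ) (T σ : ℕ → Ω → ℝ) (u : ℝ × ℝ) (ω : Ω) : ENNReal :=
  infTime {t : ℝ | 0 ≤ t ∧
    min (reserve r c₁ δ₁ T σ u.1 t ω) (reserve r c₂ δ₂ T σ u.2 t ω) < 0}

/-- `e^{-sτ}` for `τ ∈ [0, ∞]`, with `e^{-s∞} = 0`. -/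
def expNeg (s : ℝ) (τ : ENNReal) : ℝ :=
  if τ = ⊤ then 0 else Real.exp (-s * τ.toReal)

/-- Laplace transform `E[e^{-sτ(u)}]` of the ruin time of one line of business. -/
def laplaceRuin {Ω : Type*} [MeasurableSpace Ω] (P : Measure Ω) (r c δ : ℝ) (T σ : ℕ → Ω → ℝ)
    (s u : ℝ) : ℝ :=
  ∫ ω, expNeg s (ruinTime r c δ T σ u ω) ∂P

/-- `Ψ_min(u₁, u₂, s) = E[e^{-s T_min(u₁, u₂)}]`. -/
def laplaceMin {Ω : Type*} [MeasurableSpace Ω] (P : Measure Ω) (r c₁ c₂ δ₁ δ₂ : ℝ)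
    (T σ : ℕ → Ω → ℝ) (s : ℝ) (u : ℝ × ℝ) : ℝ :=
  ∫ ω, expNeg s (ruinTimeMin r c₁ c₂ δ₁ δ₂ T σ u ω) ∂P

/-- The region `u₁/δ₁ ≤ u₂/δ₂`. -/
def region (δ₁ δ₂ : ℝ) : Set (ℝ × ℝ) := {u | u.1 / δ₁ ≤ u.2 / δ₂}

/-- The quadrant of nonnegative reserves. -/
def quadrant : Set (ℝ × ℝ) := {u | 0 ≤ u.1 ∧ 0 ≤ u.2}

/-- `g` is differentiable at `u` within `D` (in the ordinary sense if `u` is interior to `D`) and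
its partial derivatives there satisfy the integro-differential equation
`(u₁ + c₁/r) ∂₁g + (u₂ + c₂/r) ∂₂g - ((lam + s)/r) g + (lam/r) ∫₀^∞ g(u - δz) f(z) dz = 0`. -/
def SatisfiesIDEAt (r lam c₁ c₂ δ₁ δ₂ : ℝ) (f : ℝ → ℝ) (s : ℝ) (D : Set (ℝ × ℝ))
    (g : ℝ × ℝ → ℝ) (u : ℝ × ℝ) : Prop :=
  ∃ g' : ℝ × ℝ →L[ℝ] ℝ, HasFDerivWithinAt g g' D u ∧
    (u.1 + c₁ / r) * g' (1, 0) + (u.2 + c₂ / r) * g' (0, 1) - (lam + s) / r * g u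
      + lam / r * (∫ z in Set.Ioi (0 : ℝ), g (u.1 - δ₁ * z, u.2 - δ₂ * z) * f z) = 0

/-- Bounded solutions, on the region `u₁/δ₁ ≤ u₂/δ₂`, of the boundary value problem: the equation
holds at nonnegative reserves, the value is `1` where one of the reserves is already negative
(these are the values of `g` which the integral in the equation also uses), and `b u₂` is the
prescribed value at `(u₁, u₂)` on the line `u₂ = (δ₂/δ₁) u₁`. -/
structure IsBoundedSolution (r lam c₁ c₂ δ₁ δ₂ : ℝ) (f : ℝ → ℝ) (s : ℝ) (b : ℝ → ℝ)
    (g : ℝ × ℝ → ℝ) : Prop where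
  bounded : ∃ C : ℝ, ∀ u ∈ region δ₁ δ₂, |g u| ≤ C
  ruined : ∀ u ∈ region δ₁ δ₂, min u.1 u.2 < 0 → g u = 1
  equation : ∀ u ∈ quadrant ∩ region δ₁ δ₂,
    SatisfiesIDEAt r lam c₁ c₂ δ₁ δ₂ f s (quadrant ∩ region δ₁ δ₂) g u
  boundary : ∀ u₁ : ℝ, 0 ≤ u₁ → g (u₁, δ₂ / δ₁ * u₁) = b (δ₂ / δ₁ * u₁)

end InterestRisk

end

/-! Put x = u₁/δ₁ + e₁ and y = u₂/δ₂ + e₂ with eᵢ = cᵢ/(rδᵢ), so that e₂ < e₁; write D = e₁ - e₂.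
Between claims (x, y) is multiplied by e^{rt}, a claim subtracts the same amount from both
coordinates, and ruin means x < e₁ or y < e₂. Claims do not affect q = x - y, which equals e^{rt}q
after time t. If q ≥ D the second line is always ruined no later than the first, if q ≤ 0 the first
no later than the second, and if 0 < q < D the path reaches q = D at the deterministic time τ =
log(D/q)/r. The region of the theorem is q ≤ D, and (2) lives on q = D.

Conditioning on the first claim gives a renewal equation for the transform Φ. Pathwise
approximations by the lapses at the first n claims yield both this equation and measurability
(`IsClaimModel.isRuinTransform`). Where one line decides, Φ depends on one variable and the renewal
equation makes it differentiable (`hasDerivAt_smoothExt`).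

For 0 < q < D use the coordinates (x, τ). Differentiating the renewal equation formally in τ gives a
linear equation whose source term is the slope of the second line's transform at the crossing. A
contraction with factor lam/(lam + s) solves it by a continuous V, and uniqueness for the
undifferentiated equation shows that the integral of V in τ recovers Φ
(`exists_crossing_derivative`). So Φ is continuous there; claim sizes have no atoms, hence the mean
after a claim is continuous and Φ is differentiable along the flow. The flow derivative and the
continuous τ-derivative together give differentiability.

Two seams remain. At q = D the value V(x, 0) matches the slope of the second line. At q = 0, where τ
is infinite, `abs_sub_first_le` bounds the difference from the first line's transform by a constant
times q · (q/D)^{s/(2r)}: that difference is integrated along a whole flow line with an exponential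
weight, and only a short, late time interval, on which just the second line is ruined, contributes.

The differential operator in (1) is 1/r times the derivative along the flow, so the renewal equation
gives (1). For uniqueness, follow a claim-free curve to the line q = D, or forever if q ≤ 0: the sup
norm of the difference of two solutions shrinks by the factor lam/(lam + s), hence is 0
(`IsBoundedSolution.eqOn_region`). -/

noncomputable section

namespace InterestRisk

open Set Filter Topology

/-! ### The exponential distribution -/

theorem expMeasure_eq_withDensity (lam : ℝ) :
    expMeasure lam = (volume.restrict (Ioi (0 : ℝ))).withDensity
      (fun t => ENNReal.ofReal (lam * Real.exp (-lam * t))) := by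
  have h : (gammaPDF 1 lam) =ᵐ[volume]
      (Ioi (0 : ℝ)).indicator (fun t => ENNReal.ofReal (lam * Real.exp (-lam * t))) := by
    have h0 : ∀ᵐ t : ℝ, t ≠ 0 := by simp [ae_iff]
    filter_upwards [h0] with t ht
    change exponentialPDF lam t = _
    rcases lt_or_gt_of_ne ht with h | h
    · rw [exponentialPDF_of_neg h, indicator_of_notMem (by simpa using h.le)]
    · rw [exponentialPDF_of_nonneg h.le, indicator_of_mem (by simpa using h)]
      simp
  rw [expMeasure, gammaMeasure, withDensity_congr_ae h, withDensity_indicator measurableSet_Ioi]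

theorem integral_expMeasure {lam : ℝ} (hlam : 0 < lam) (g : ℝ → ℝ) :
    ∫ t, g t ∂expMeasure lam = ∫ t in Ioi (0 : ℝ), lam * Real.exp (-lam * t) * g t := by
  rw [expMeasure_eq_withDensity, integral_withDensity_eq_integral_toReal_smul (by fun_prop)
    (by simp)]
  refine integral_congr_ae (Eventually.of_forall fun t => ?_)
  have : 0 ≤ lam * Real.exp (-lam * t) := by positivity
  simp only [ENNReal.toReal_ofReal this, smul_eq_mul]

theorem lintegral_expMeasure (lam : ℝ) {g : ℝ → ENNReal} (hg : Measurable g) :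
    ∫⁻ t, g t ∂expMeasure lam
      = ∫⁻ t in Ioi (0 : ℝ), ENNReal.ofReal (lam * Real.exp (-lam * t)) * g t := by
  rw [expMeasure_eq_withDensity, lintegral_withDensity_eq_lintegral_mul _ (by fun_prop) hg]
  rfl

theorem ae_expMeasure_pos (lam : ℝ) : ∀ᵐ t ∂expMeasure lam, 0 < t := by
  rw [expMeasure_eq_withDensity]
  exact (withDensity_absolutelyContinuous _ _).ae_le (ae_restrict_mem measurableSet_Ioi)

theorem expMeasure_absolutelyContinuous (lam : ℝ) : expMeasure lam ≪ volume :=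
  withDensity_absolutelyContinuous _ _

instance (lam : ℝ) : NullSingletonClass (expMeasure lam) :=
  ⟨fun t => expMeasure_absolutelyContinuous lam (by simp)⟩

theorem integrableOn_exp_neg_mul {k : ℝ} (hk : 0 < k) (a : ℝ) :
    IntegrableOn (fun t => Real.exp (-k * t)) (Ioi a) :=
  integrableOn_exp_mul_Ioi (by linarith) a

theorem integral_exp_neg_mul {k : ℝ} (hk : 0 < k) (a : ℝ) :
    ∫ t in Ioi a, Real.exp (-k * t) = Real.exp (-k * a) / k := by
  rw [integral_exp_mul_Ioi (by linarith)]
  field_simp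

theorem integral_exp_expMeasure {lam s : ℝ} (hlam : 0 < lam) (hs : 0 < lam + s) :
    ∫ t, Real.exp (-s * t) ∂expMeasure lam = lam / (lam + s) := by
  rw [integral_expMeasure hlam]
  have : ∀ t : ℝ, lam * Real.exp (-lam * t) * Real.exp (-s * t)
      = lam * Real.exp (-(lam + s) * t) := by
    intro t; rw [mul_assoc, ← Real.exp_add]; ring_nf
  simp_rw [this]
  rw [integral_const_mul, integral_exp_neg_mul hs]
  simp; ring

theorem integrable_exp_expMeasure {lam s : ℝ} (hlam : 0 < lam) (hs : 0 < s) :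
    Integrable (fun t => Real.exp (-s * t)) (expMeasure lam) := by
  have : IsProbabilityMeasure (expMeasure lam) := isProbabilityMeasure_expMeasure hlam
  refine Integrable.of_bound (C := 1) (by fun_prop) ?_
  filter_upwards [ae_expMeasure_pos lam] with t ht
  rw [Real.norm_eq_abs, Real.abs_exp, Real.exp_le_one_iff]
  nlinarith

/-! ### Discounted integrals along a half line -/

/-- The discounted integral `∫₀^∞ lam e^{-kt} B(a + t) dt`. -/
def discounted (lam k : ℝ) (B : ℝ → ℝ) (a : ℝ) : ℝ :=
  ∫ t in Ioi (0 : ℝ), lam * Real.exp (-k * t) * B (a + t)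

theorem integrableOn_exp_mul_bounded {k C : ℝ} (hk : 0 < k) {B : ℝ → ℝ} (hB : Measurable B)
    (hC : ∀ t, |B t| ≤ C) (a : ℝ) :
    IntegrableOn (fun t => Real.exp (-k * t) * B t) (Ioi a) := by
  refine Integrable.mul_bdd (c := C) (integrableOn_exp_neg_mul hk a) (by fun_prop) ?_
  exact Eventually.of_forall fun t => by simpa using hC t

theorem setIntegral_Ioi_comp_add (g : ℝ → ℝ) (a : ℝ) :
    ∫ t in Ioi (0 : ℝ), g (a + t) = ∫ t in Ioi a, g t := by
  rw [← integral_indicator measurableSet_Ioi, ← integral_indicator measurableSet_Ioi,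
    ← integral_add_left_eq_self ((Ioi a).indicator g) a]
  congr 1
  ext t
  by_cases h : 0 < t
  · rw [indicator_of_mem (by simpa using h), indicator_of_mem (by simpa using h)]
  · rw [indicator_of_notMem (by simpa using h), indicator_of_notMem (by simpa using h)]

theorem discounted_eq (lam k : ℝ) (B : ℝ → ℝ) (a : ℝ) :
    discounted lam k B a
      = lam * Real.exp (k * a) * ∫ t in Ioi a, Real.exp (-k * t) * B t := by
  rw [← setIntegral_Ioi_comp_add, ← integral_const_mul, discounted]
  congr 1
  ext t
  have : Real.exp (-k * t) = Real.exp (k * a) * Real.exp (-k * (a + t)) := by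
    rw [← Real.exp_add]; ring_nf
  rw [this]; ring

/-- The parameter `a` is moved out of the integrand into an exponential factor and an endpoint.
Continuity in `a` then needs no regularity of `B`, and differentiability only its continuity at the
point. -/
theorem discounted_eq_sub {lam k C : ℝ} (hk : 0 < k) {B : ℝ → ℝ} (hB : Measurable B)
    (hC : ∀ t, |B t| ≤ C) (a : ℝ) :
    discounted lam k B a = lam * Real.exp (k * a) *
      ((∫ t in Ioi (0 : ℝ), Real.exp (-k * t) * B t)
        - ∫ t in (0 : ℝ)..a, Real.exp (-k * t) * B t) := by
  rw [discounted_eq, ← intervalIntegral.integral_interval_add_Ioi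
    (integrableOn_exp_mul_bounded hk hB hC 0) (integrableOn_exp_mul_bounded hk hB hC a)]
  ring

theorem intervalIntegrable_exp_mul_bounded {k C : ℝ} {B : ℝ → ℝ} (hB : Measurable B)
    (hC : ∀ t, |B t| ≤ C) (a b : ℝ) :
    IntervalIntegrable (fun t => Real.exp (-k * t) * B t) volume a b := by
  have h : IntervalIntegrable (fun t => Real.exp (-k * t)) volume a b :=
    Continuous.intervalIntegrable (by fun_prop) _ _
  rw [intervalIntegrable_iff] at h ⊢
  refine Integrable.mul_bdd (c := C) h (by fun_prop) ?_
  exact Eventually.of_forall fun t => by simpa using hC t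

theorem continuous_discounted {lam k C : ℝ} (hk : 0 < k) {B : ℝ → ℝ} (hB : Measurable B)
    (hC : ∀ t, |B t| ≤ C) : Continuous (discounted lam k B) := by
  have : discounted lam k B = _ := funext (discounted_eq_sub hk hB hC)
  rw [this]
  have := intervalIntegral.continuous_primitive
    (intervalIntegrable_exp_mul_bounded (k := k) hB hC) 0
  fun_prop

theorem hasDerivAt_discounted {lam k C : ℝ} (hk : 0 < k) {B : ℝ → ℝ} (hB : Measurable B)
    (hC : ∀ t, |B t| ≤ C) {a : ℝ} (ha : ContinuousAt B a) :
    HasDerivAt (discounted lam k B) (k * discounted lam k B a - lam * B a) a := by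
  have h : discounted lam k B = _ := funext (discounted_eq_sub hk hB hC)
  have h1 : HasDerivAt (fun u => ∫ t in (0 : ℝ)..u, Real.exp (-k * t) * B t)
      (Real.exp (-k * a) * B a) a := by
    refine intervalIntegral.integral_hasDerivAt_right
      (intervalIntegrable_exp_mul_bounded hB hC _ _) ?_ ?_
    · exact (Measurable.stronglyMeasurable (by fun_prop)).stronglyMeasurableAtFilter
    · fun_prop
  have h2 : HasDerivAt (fun u => lam * Real.exp (k * u)) (lam * (Real.exp (k * a) * k)) a := by
    have := ((hasDerivAt_id a).const_mul k).exp.const_mul lam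
    simpa using this
  have h3 := h2.mul (h1.const_sub (∫ t in Ioi (0 : ℝ), Real.exp (-k * t) * B t))
  rw [h]
  refine h3.congr_deriv ?_
  have : Real.exp (k * a) * Real.exp (-k * a) = 1 := by rw [← Real.exp_add]; simp
  simp only
  linear_combination (-lam * B a) * this

/-! ### Convolution with the claim size distribution -/

/-- Expected value of `g` after a claim at the state `p`. -/
def afterClaim (m : Measure ℝ) (g : ℝ × ℝ → ℝ) (p : ℝ × ℝ) : ℝ :=
  ∫ z, g (p.1 - z, p.2 - z) ∂m

theorem measurable_afterClaim (m : Measure ℝ) [SFinite m] {g : ℝ × ℝ → ℝ} (hg : Measurable g) :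
    Measurable (afterClaim m g) := by
  have : StronglyMeasurable (fun a : (ℝ × ℝ) × ℝ => g (a.1.1 - a.2, a.1.2 - a.2)) :=
    Measurable.stronglyMeasurable (by fun_prop)
  exact this.integral_prod_right.measurable

theorem abs_afterClaim_le (m : Measure ℝ) [IsProbabilityMeasure m] {g : ℝ × ℝ → ℝ} {C : ℝ}
    (hC : ∀ p, |g p| ≤ C) (p : ℝ × ℝ) : |afterClaim m g p| ≤ C := by
  have := norm_integral_le_of_norm_le_const (μ := m) (f := fun z => g (p.1 - z, p.2 - z))
    (C := C) (Eventually.of_forall fun z => hC _)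
  simpa [afterClaim] using this

/-- The expected value after a claim depends continuously on the state, if the discontinuities are
on curves which the claims hit with probability `0`. -/
theorem continuousAt_afterClaim (m : Measure ℝ) [IsProbabilityMeasure m] {g : ℝ × ℝ → ℝ} {C : ℝ}
    (hg : Measurable g) (hC : ∀ p, |g p| ≤ C) {p : ℝ × ℝ}
    (hp : ∀ᵐ z ∂m, ContinuousAt g (p.1 - z, p.2 - z)) : ContinuousAt (afterClaim m g) p := by
  refine continuousAt_of_dominated (bound := fun _ => C) ?_ ?_ (integrable_const C) ?_
  · exact Eventually.of_forall fun q => Measurable.aestronglyMeasurable (by fun_prop)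
  · exact Eventually.of_forall fun q => Eventually.of_forall fun z => hC _
  · filter_upwards [hp] with z hz
    have h : ContinuousAt (fun q : ℝ × ℝ => (q.1 - z, q.2 - z)) p := by fun_prop
    exact ContinuousAt.comp (f := fun q : ℝ × ℝ => (q.1 - z, q.2 - z)) (x := p) hz h

/-- Expectations over the first claim as iterated integrals. -/
theorem integral_firstClaim {r s lam : ℝ} (hlam : 0 < lam) (hs : 0 < s) (m : Measure ℝ)
    [IsProbabilityMeasure m] {g : ℝ × ℝ → ℝ} {C : ℝ} (hg : Measurable g) (hC : ∀ p, |g p| ≤ C)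
    (p : ℝ × ℝ) :
    ∫ a, Real.exp (-s * a.1) * g (Real.exp (r * a.1) * p.1 - a.2, Real.exp (r * a.1) * p.2 - a.2)
        ∂((expMeasure lam).prod m)
      = discounted lam (lam + s)
          (fun t => afterClaim m g (Real.exp (r * t) * p.1, Real.exp (r * t) * p.2)) 0 := by
  have : IsProbabilityMeasure (expMeasure lam) := isProbabilityMeasure_expMeasure hlam
  rw [integral_prod]
  · simp_rw [integral_const_mul]
    rw [integral_expMeasure hlam, discounted]
    congr 1
    ext t
    have : Real.exp (-(lam + s) * t) = Real.exp (-lam * t) * Real.exp (-s * t) := by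
      rw [← Real.exp_add]; ring_nf
    simp only [zero_add, afterClaim, this]
    ring
  · refine Integrable.of_bound (C := C) (by fun_prop) ?_
    have : ∀ᵐ a ∂((expMeasure lam).prod m), 0 < a.1 :=
      Measure.quasiMeasurePreserving_fst.ae (ae_expMeasure_pos lam)
    filter_upwards [this] with a ha
    rw [norm_mul, Real.norm_eq_abs, Real.abs_exp]
    have h1 : Real.exp (-s * a.1) ≤ 1 := by rw [Real.exp_le_one_iff]; nlinarith
    exact (mul_le_of_le_one_left (norm_nonneg _) h1).trans (hC _)

/-- The renewal equation, shifted along the flow. -/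
theorem discounted_comp_flow {r lam k : ℝ} (B : ℝ × ℝ → ℝ) (p : ℝ × ℝ) (a : ℝ) :
    discounted lam k
        (fun t => B (Real.exp (r * t) * (Real.exp (r * a) * p.1),
          Real.exp (r * t) * (Real.exp (r * a) * p.2))) 0
      = discounted lam k (fun t => B (Real.exp (r * t) * p.1, Real.exp (r * t) * p.2)) a := by
  have : ∀ t x, Real.exp (r * (a + t)) * x = Real.exp (r * t) * (Real.exp (r * a) * x) := by
    intro t x; rw [mul_add, Real.exp_add]; ring
  simp only [discounted, zero_add, this]

/-! ### The transform of a single line of business -/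

/-- Expected value of `ψ` after a claim at the state `y`. -/
def claimMean (m : Measure ℝ) (ψ : ℝ → ℝ) (y : ℝ) : ℝ := ∫ z, ψ (y - z) ∂m

theorem ae_sub_ne (m : Measure ℝ) [NullSingletonClass m] (y e : ℝ) : ∀ᵐ z ∂m, y - z ≠ e := by
  have : ∀ᵐ z ∂m, z ≠ y - e := by simp [ae_iff]
  filter_upwards [this] with z hz h
  exact hz (by linarith)

theorem measurable_claimMean (m : Measure ℝ) [SFinite m] {ψ : ℝ → ℝ} (hψ : Measurable ψ) :
    Measurable (claimMean m ψ) := by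
  have h : Measurable (afterClaim m (fun p => ψ p.1)) := measurable_afterClaim m (by fun_prop)
  exact h.comp (f := fun y : ℝ => (y, y)) (by fun_prop)

theorem abs_claimMean_le (m : Measure ℝ) [IsProbabilityMeasure m] {ψ : ℝ → ℝ} {C : ℝ}
    (hC : ∀ y, |ψ y| ≤ C) (y : ℝ) : |claimMean m ψ y| ≤ C :=
  abs_afterClaim_le m (g := fun p => ψ p.1) (fun p => hC p.1) (y, y)

theorem continuous_claimMean (m : Measure ℝ) [IsProbabilityMeasure m] [NullSingletonClass m]
    {ψ : ℝ → ℝ} {C e : ℝ} (hψ : Measurable ψ) (hC : ∀ y, |ψ y| ≤ C)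
    (hcont : ∀ y, y ≠ e → ContinuousAt ψ y) : Continuous (claimMean m ψ) := by
  refine continuous_iff_continuousAt.2 fun y => ?_
  have h : ContinuousAt (afterClaim m (fun p => ψ p.1)) (y, y) := by
    refine continuousAt_afterClaim m (C := C) (by fun_prop) (fun p => hC p.1) ?_
    filter_upwards [ae_sub_ne m y e] with z hz
    exact ContinuousAt.comp (f := Prod.fst) (g := ψ) (x := ((y - z, y - z) : ℝ × ℝ))
      (hcont _ hz) continuousAt_fst
  exact ContinuousAt.comp (f := fun y : ℝ => (y, y)) (x := y) h (by fun_prop)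

/-- A bounded solution of the renewal equation of one line of business, the reserve being shifted
so that the deterministic flow is `y ↦ e^{rt} y` and ruin means `y < e`. -/
structure IsRenewalSolution (r s lam e : ℝ) (m : Measure ℝ) (ψ : ℝ → ℝ) : Prop where
  measurable : Measurable ψ
  nonneg : ∀ y, 0 ≤ ψ y
  le_one : ∀ y, ψ y ≤ 1
  ruined : ∀ y, y < e → ψ y = 1
  renewal : ∀ y, e ≤ y →
    ψ y = discounted lam (lam + s) (fun t => claimMean m ψ (Real.exp (r * t) * y)) 0

/-- The function of `y > 0` given by the right hand side of the renewal equation. -/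
def smoothExt (r s lam : ℝ) (m : Measure ℝ) (ψ : ℝ → ℝ) (y : ℝ) : ℝ :=
  discounted lam (lam + s) (fun t => claimMean m ψ (Real.exp (r * t))) (Real.log y / r)

namespace IsRenewalSolution

variable {r s lam e : ℝ} {m : Measure ℝ} {ψ : ℝ → ℝ}

theorem abs_le_one (h : IsRenewalSolution r s lam e m ψ) (y : ℝ) : |ψ y| ≤ 1 := by
  rw [abs_of_nonneg (h.nonneg y)]; exact h.le_one y

/-- The flow started at 1 is at `y` at time `log y / r`, so one flow line covers all `y > 0`. The
extension is smooth across `e`, where `ψ` itself may jump; this gives one-sided regularity at the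
threshold. -/
theorem eq_smoothExt (h : IsRenewalSolution r s lam e m ψ) (hr : 0 < r) (he : 0 < e) {y : ℝ}
    (hy : e ≤ y) : ψ y = smoothExt r s lam m ψ y := by
  have hy0 : 0 < y := he.trans_le hy
  have key : ∀ t, Real.exp (r * (Real.log y / r + t)) = Real.exp (r * t) * y := by
    intro t
    rw [mul_add, Real.exp_add, mul_div_cancel₀ _ hr.ne', Real.exp_log hy0, mul_comm]
  rw [h.renewal y hy, smoothExt, discounted, discounted]
  simp only [zero_add, key]

variable [IsProbabilityMeasure m]

theorem continuousAt_smoothExt (h : IsRenewalSolution r s lam e m ψ) (hlam : 0 < lam) (hs : 0 < s)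
    {y : ℝ} (hy : 0 < y) : ContinuousAt (smoothExt r s lam m ψ) y := by
  have h1 : Continuous (discounted lam (lam + s) (fun t => claimMean m ψ (Real.exp (r * t)))) :=
    continuous_discounted (C := 1) (by linarith)
      ((measurable_claimMean m h.measurable).comp (by fun_prop))
      (fun t => abs_claimMean_le m h.abs_le_one _)
  exact h1.continuousAt.comp ((Real.continuousAt_log hy.ne').div_const r)

theorem continuousAt_of_ne (h : IsRenewalSolution r s lam e m ψ) (hr : 0 < r) (hlam : 0 < lam)
    (hs : 0 < s) (he : 0 < e) {y : ℝ} (hy : y ≠ e) : ContinuousAt ψ y := by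
  rcases lt_or_gt_of_ne hy with hlt | hgt
  · refine continuousAt_const.congr (f := fun _ => (1 : ℝ)) ?_
    filter_upwards [Iio_mem_nhds hlt] with w hw
    exact (h.ruined w hw).symm
  · refine (h.continuousAt_smoothExt hlam hs (he.trans hgt)).congr ?_
    filter_upwards [Ioi_mem_nhds hgt] with w hw
    exact (h.eq_smoothExt hr he (le_of_lt hw)).symm

theorem continuous_claimMean [NullSingletonClass m] (h : IsRenewalSolution r s lam e m ψ)
    (hr : 0 < r) (hlam : 0 < lam) (hs : 0 < s) (he : 0 < e) : Continuous (claimMean m ψ) :=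
  InterestRisk.continuous_claimMean m h.measurable h.abs_le_one
    (fun _ hy => h.continuousAt_of_ne hr hlam hs he hy)

theorem hasDerivAt_smoothExt [NullSingletonClass m] (h : IsRenewalSolution r s lam e m ψ)
    (hr : 0 < r) (hlam : 0 < lam) (hs : 0 < s) (he : 0 < e) {y : ℝ} (hy : 0 < y) :
    HasDerivAt (smoothExt r s lam m ψ)
      (((lam + s) * smoothExt r s lam m ψ y - lam * claimMean m ψ y) / (r * y)) y := by
  have hc := h.continuous_claimMean hr hlam hs he
  have h1 := hasDerivAt_discounted (lam := lam) (k := lam + s) (C := 1)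
    (B := fun t => claimMean m ψ (Real.exp (r * t))) (a := Real.log y / r) (by linarith)
    (Continuous.measurable (by fun_prop)) (fun t => abs_claimMean_le m h.abs_le_one _)
    (by fun_prop)
  have h2 : HasDerivAt (fun y => Real.log y / r) (y⁻¹ / r) y :=
    (Real.hasDerivAt_log hy.ne').div_const r
  refine (h1.comp y h2).congr_deriv ?_
  rw [mul_div_cancel₀ _ hr.ne', Real.exp_log hy]
  simp only [smoothExt]
  field_simp

end IsRenewalSolution

/-! ### The transform of the joint ruin time -/

/-- The properties which the Laplace transform of the joint ruin time inherits from the risk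
process, in the coordinates `x = u₁/δ₁ + e₁`, `y = u₂/δ₂ + e₂` where `eᵢ = cᵢ/(r δᵢ)`: a claim
subtracts the same amount from both coordinates, which otherwise grow at the rate `r`, and ruin
means `x < e₁` or `y < e₂`. -/
structure IsRuinTransform (r s lam e₁ e₂ : ℝ) (m : Measure ℝ) (Φ : ℝ × ℝ → ℝ) : Prop where
  measurable : Measurable Φ
  nonneg : ∀ p, 0 ≤ Φ p
  le_one : ∀ p, Φ p ≤ 1
  ruined : ∀ p : ℝ × ℝ, p.1 < e₁ ∨ p.2 < e₂ → Φ p = 1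
  renewal : ∀ p : ℝ × ℝ, e₁ ≤ p.1 → e₂ ≤ p.2 →
    Φ p = ∫ a, Real.exp (-s * a.1)
      * Φ (Real.exp (r * a.1) * p.1 - a.2, Real.exp (r * a.1) * p.2 - a.2)
        ∂((expMeasure lam).prod m)
  eq_of_add_le : ∀ x y, y + (e₁ - e₂) ≤ x → Φ (x, y) = Φ (y + (e₁ - e₂), y)
  eq_of_le : ∀ x y, x ≤ y → Φ (x, y) = Φ (x, x)

namespace IsRuinTransform

variable {r s lam e₁ e₂ : ℝ} {m : Measure ℝ} {Φ : ℝ × ℝ → ℝ}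

theorem abs_le_one (h : IsRuinTransform r s lam e₁ e₂ m Φ) (p : ℝ × ℝ) : |Φ p| ≤ 1 := by
  rw [abs_of_nonneg (h.nonneg p)]; exact h.le_one p

theorem eq_discounted [IsProbabilityMeasure m] (h : IsRuinTransform r s lam e₁ e₂ m Φ)
    (hlam : 0 < lam) (hs : 0 < s) {p : ℝ × ℝ} (h1 : e₁ ≤ p.1) (h2 : e₂ ≤ p.2) :
    Φ p = discounted lam (lam + s)
      (fun t => afterClaim m Φ (Real.exp (r * t) * p.1, Real.exp (r * t) * p.2)) 0 := by
  rw [h.renewal p h1 h2, integral_firstClaim hlam hs m h.measurable h.abs_le_one]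

/-- The transform of the first line of business. -/
def first (Φ : ℝ × ℝ → ℝ) (x : ℝ) : ℝ := Φ (x, x)

/-- The transform of the second line of business. -/
def second (D : ℝ) (Φ : ℝ × ℝ → ℝ) (y : ℝ) : ℝ := Φ (y + D, y)

theorem first_isRenewalSolution [IsProbabilityMeasure m] (h : IsRuinTransform r s lam e₁ e₂ m Φ)
    (hlam : 0 < lam) (hs : 0 < s) (he : e₂ < e₁) :
    IsRenewalSolution r s lam e₁ m (first Φ) where
  measurable := h.measurable.comp (f := fun x : ℝ => (x, x)) (by fun_prop)
  nonneg _ := h.nonneg _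
  le_one _ := h.le_one _
  ruined y hy := h.ruined _ (Or.inl hy)
  renewal y hy := by
    rw [first, h.eq_discounted hlam hs hy (he.le.trans hy)]
    rfl

/-- The line x = y + (e₁ - e₂) is not invariant: the flow increases x - y. But beyond it Φ does not
depend on x, so `eq_of_add_le` projects the state back. -/
theorem second_isRenewalSolution [IsProbabilityMeasure m]
    (h : IsRuinTransform r s lam e₁ e₂ m Φ) (hr : 0 < r) (hlam : 0 < lam) (hs : 0 < s)
    (he : e₂ < e₁) : IsRenewalSolution r s lam e₂ m (second (e₁ - e₂) Φ) where
  measurable := h.measurable.comp (f := fun y : ℝ => (y + (e₁ - e₂), y)) (by fun_prop)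
  nonneg _ := h.nonneg _
  le_one _ := h.le_one _
  ruined y hy := h.ruined _ (Or.inr hy)
  renewal y hy := by
    rw [second, h.eq_discounted hlam hs (by simp only; linarith) hy]
    refine setIntegral_congr_fun measurableSet_Ioi fun t ht => ?_
    simp only [zero_add, afterClaim, claimMean, second]
    congr 1
    refine integral_congr_ae (Eventually.of_forall fun z => ?_)
    simp only
    have h1 : 1 ≤ Real.exp (r * t) := Real.one_le_exp (by have : 0 < t := ht; positivity)
    exact h.eq_of_add_le _ _ (by nlinarith)

theorem eq_first (h : IsRuinTransform r s lam e₁ e₂ m Φ) {p : ℝ × ℝ} (hp : p.1 ≤ p.2) :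
    Φ p = first Φ p.1 := h.eq_of_le p.1 p.2 hp

theorem eq_second (h : IsRuinTransform r s lam e₁ e₂ m Φ) {p : ℝ × ℝ}
    (hp : p.2 + (e₁ - e₂) ≤ p.1) : Φ p = second (e₁ - e₂) Φ p.2 := h.eq_of_add_le p.1 p.2 hp

end IsRuinTransform

/-! ### The first claim before a deterministic time -/

/-- Law of the waiting time for a claim and of its size. -/
def claimLaw (lam : ℝ) (m : Measure ℝ) : Measure (ℝ × ℝ) := (expMeasure lam).prod m

theorem isProbabilityMeasure_claimLaw {lam : ℝ} (hlam : 0 < lam) (m : Measure ℝ)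
    [IsProbabilityMeasure m] : IsProbabilityMeasure (claimLaw lam m) := by
  have : IsProbabilityMeasure (expMeasure lam) := isProbabilityMeasure_expMeasure hlam
  unfold claimLaw; infer_instance

theorem ae_claimLaw_fst_pos (lam : ℝ) (m : Measure ℝ) [IsProbabilityMeasure m] :
    ∀ᵐ a ∂claimLaw lam m, 0 < a.1 :=
  Measure.quasiMeasurePreserving_fst.ae (ae_expMeasure_pos lam)

theorem ae_claimLaw_fst_ne {lam : ℝ} (m : Measure ℝ) [IsProbabilityMeasure m] (τ : ℝ) :
    ∀ᵐ a ∂claimLaw lam m, a.1 ≠ τ := by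
  have : ∀ᵐ t ∂expMeasure lam, t ≠ τ := by simp [ae_iff]
  exact Measure.quasiMeasurePreserving_fst.ae this

theorem ae_claimLaw_snd_ne {lam : ℝ} (m : Measure ℝ) [IsProbabilityMeasure m]
    [NullSingletonClass m] {φ : ℝ → ℝ} (hφ : Measurable φ) :
    ∀ᵐ a ∂claimLaw lam m, a.2 ≠ φ a.1 := by
  have hs : MeasurableSet {a : ℝ × ℝ | a.2 = φ a.1} :=
    measurableSet_eq_fun (by fun_prop) (by fun_prop)
  have : (claimLaw lam m) {a : ℝ × ℝ | a.2 = φ a.1} = 0 := by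
    rw [claimLaw, Measure.measure_prod_null hs]
    refine Eventually.of_forall fun t => ?_
    have : Prod.mk t ⁻¹' {a : ℝ × ℝ | a.2 = φ a.1} = {φ t} := by ext; simp
    simp [this]
  simpa [ae_iff] using this

theorem integral_exp_claimLaw {lam s : ℝ} (hlam : 0 < lam) (hs : 0 < lam + s) (m : Measure ℝ)
    [IsProbabilityMeasure m] :
    ∫ a, Real.exp (-s * a.1) ∂claimLaw lam m = lam / (lam + s) := by
  have : IsProbabilityMeasure (expMeasure lam) := isProbabilityMeasure_expMeasure hlam
  rw [← integral_exp_expMeasure hlam hs, claimLaw,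
    integral_fun_fst (μ := expMeasure lam) (ν := m) (fun t => Real.exp (-s * t))]
  simp

theorem integrable_exp_claimLaw {lam s : ℝ} (hlam : 0 < lam) (hs : 0 < s) (m : Measure ℝ)
    [IsProbabilityMeasure m] :
    Integrable (fun a : ℝ × ℝ => Real.exp (-s * a.1)) (claimLaw lam m) := by
  have : IsProbabilityMeasure (expMeasure lam) := isProbabilityMeasure_expMeasure hlam
  exact (integrable_exp_expMeasure hlam hs).comp_fst m

/-- The integrand of `truncStep`. -/
def truncIntegrand (r s : ℝ) (G : ℝ × ℝ → ℝ) (p a : ℝ × ℝ) : ℝ :=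
  if a.1 < p.2 then Real.exp (-s * a.1) * G (Real.exp (r * a.1) * p.1 - a.2, p.2 - a.1) else 0

/-- Discounted expected value of `G` after the first claim, if this claim comes before the time
`τ`; here `p = (x, τ)` and `G` is a function of the state and of the time left. -/
def truncStep (r s lam : ℝ) (m : Measure ℝ) (G : ℝ × ℝ → ℝ) (p : ℝ × ℝ) : ℝ :=
  ∫ a, truncIntegrand r s G p a ∂claimLaw lam m

theorem measurable_truncIntegrand {r s : ℝ} {G : ℝ × ℝ → ℝ} (hG : Measurable G) :
    Measurable (fun b : (ℝ × ℝ) × (ℝ × ℝ) => truncIntegrand r s G b.1 b.2) := by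
  refine Measurable.ite (measurableSet_lt (by fun_prop) (by fun_prop)) ?_ measurable_const
  fun_prop

theorem measurable_truncIntegrand_right {r s : ℝ} {G : ℝ × ℝ → ℝ} (hG : Measurable G)
    (p : ℝ × ℝ) : Measurable (truncIntegrand r s G p) :=
  (measurable_truncIntegrand hG).comp measurable_prodMk_left

theorem abs_truncIntegrand_le {r s C : ℝ} {G : ℝ × ℝ → ℝ} {p : ℝ × ℝ} (hC0 : 0 ≤ C)
    (hC : ∀ q : ℝ × ℝ, 0 < q.2 → q.2 ≤ p.2 → |G q| ≤ C) {a : ℝ × ℝ} (ha : 0 < a.1) :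
    |truncIntegrand r s G p a| ≤ Real.exp (-s * a.1) * C := by
  unfold truncIntegrand
  split_ifs with h
  · rw [abs_mul, Real.abs_exp]
    exact mul_le_mul_of_nonneg_left (hC _ (by simpa using h) (by simpa using ha.le))
      (Real.exp_pos _).le
  · simpa using mul_nonneg (Real.exp_pos (-s * a.1)).le hC0

section

variable {r s lam : ℝ} {m : Measure ℝ} [IsProbabilityMeasure m]

theorem integrable_truncIntegrand (hlam : 0 < lam) (hs : 0 < s) {G : ℝ × ℝ → ℝ} {C : ℝ}
    (hG : Measurable G) {p : ℝ × ℝ} (hC0 : 0 ≤ C)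
    (hC : ∀ q : ℝ × ℝ, 0 < q.2 → q.2 ≤ p.2 → |G q| ≤ C) :
    Integrable (truncIntegrand r s G p) (claimLaw lam m) := by
  refine Integrable.mono' ((integrable_exp_claimLaw hlam hs m).mul_const C)
    (measurable_truncIntegrand_right hG p).aestronglyMeasurable ?_
  filter_upwards [ae_claimLaw_fst_pos lam m] with a ha
  exact abs_truncIntegrand_le hC0 hC ha

/-- The factor is the mean of the discount over one waiting time. Only values of `G` with time left
in (0, p.2] enter, which later allows functions that grow linearly in the time left. -/
theorem abs_truncStep_le (hlam : 0 < lam) (hs : 0 < s) {G : ℝ × ℝ → ℝ} {C : ℝ} {p : ℝ × ℝ}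
    (hC0 : 0 ≤ C) (hC : ∀ q : ℝ × ℝ, 0 < q.2 → q.2 ≤ p.2 → |G q| ≤ C) :
    |truncStep r s lam m G p| ≤ lam / (lam + s) * C := by
  rw [← integral_exp_claimLaw hlam (by linarith) m, ← integral_mul_const]
  rw [← Real.norm_eq_abs, truncStep]
  refine norm_integral_le_of_norm_le ((integrable_exp_claimLaw hlam hs m).mul_const C) ?_
  filter_upwards [ae_claimLaw_fst_pos lam m] with a ha
  exact abs_truncIntegrand_le hC0 hC ha

theorem truncStep_sub (hlam : 0 < lam) (hs : 0 < s) {G G' : ℝ × ℝ → ℝ} {C : ℝ}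
    (hG : Measurable G) (hG' : Measurable G') {p : ℝ × ℝ} (hC0 : 0 ≤ C)
    (hC : ∀ q : ℝ × ℝ, 0 < q.2 → q.2 ≤ p.2 → |G q| ≤ C)
    (hC' : ∀ q : ℝ × ℝ, 0 < q.2 → q.2 ≤ p.2 → |G' q| ≤ C) :
    truncStep r s lam m (fun q => G q - G' q) p
      = truncStep r s lam m G p - truncStep r s lam m G' p := by
  rw [truncStep, truncStep, truncStep,
    ← integral_sub (integrable_truncIntegrand hlam hs hG hC0 hC)
      (integrable_truncIntegrand hlam hs hG' hC0 hC')]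
  congr 1
  ext a
  unfold truncIntegrand
  split_ifs <;> ring

theorem truncStep_add (hlam : 0 < lam) (hs : 0 < s) {G G' : ℝ × ℝ → ℝ} {C : ℝ}
    (hG : Measurable G) (hG' : Measurable G') {p : ℝ × ℝ} (hC0 : 0 ≤ C)
    (hC : ∀ q : ℝ × ℝ, 0 < q.2 → q.2 ≤ p.2 → |G q| ≤ C)
    (hC' : ∀ q : ℝ × ℝ, 0 < q.2 → q.2 ≤ p.2 → |G' q| ≤ C) :
    truncStep r s lam m (fun q => G q + G' q) p
      = truncStep r s lam m G p + truncStep r s lam m G' p := by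
  rw [truncStep, truncStep, truncStep,
    ← integral_add (integrable_truncIntegrand hlam hs hG hC0 hC)
      (integrable_truncIntegrand hlam hs hG' hC0 hC')]
  congr 1
  ext a
  unfold truncIntegrand
  split_ifs <;> ring

/-- Dominated convergence: the integrand fails to be continuous in `p` only if the claim comes
exactly at the time p.2 or lands exactly on the level `e`. Both have probability 0, as neither
waiting times nor sizes have atoms. -/
theorem continuous_truncStep [NullSingletonClass m] (hlam : 0 < lam) (hs : 0 < s)
    {G : ℝ × ℝ → ℝ} {C e : ℝ} (hG : Measurable G) (hC : ∀ q : ℝ × ℝ, |G q| ≤ C)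
    (hcont : ∀ q : ℝ × ℝ, q.1 ≠ e → ContinuousAt G q) : Continuous (truncStep r s lam m G) := by
  have hC0 : 0 ≤ C := (abs_nonneg _).trans (hC 0)
  refine continuous_iff_continuousAt.2 fun p => ?_
  refine continuousAt_of_dominated (bound := fun a => Real.exp (-s * a.1) * C) ?_ ?_
    ((integrable_exp_claimLaw hlam hs m).mul_const C) ?_
  · exact Eventually.of_forall fun q =>
      (measurable_truncIntegrand_right hG q).aestronglyMeasurable
  · refine Eventually.of_forall fun q => ?_
    filter_upwards [ae_claimLaw_fst_pos lam m] with a ha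
    exact abs_truncIntegrand_le hC0 (fun q _ _ => hC q) ha
  · filter_upwards [ae_claimLaw_fst_ne (lam := lam) m p.2,
      ae_claimLaw_snd_ne (lam := lam) m (φ := fun t => Real.exp (r * t) * p.1 - e) (by fun_prop)]
      with a h1 h2
    rcases lt_or_gt_of_ne h1 with h | h
    · have hc : ContinuousAt (fun q : ℝ × ℝ =>
          Real.exp (-s * a.1) * G (Real.exp (r * a.1) * q.1 - a.2, q.2 - a.1)) p := by
        refine ContinuousAt.mul continuousAt_const ?_
        have hG' : ContinuousAt G (Real.exp (r * a.1) * p.1 - a.2, p.2 - a.1) :=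
          hcont _ (fun h3 => h2 (by simp only at h3; linarith))
        exact ContinuousAt.comp
          (f := fun q : ℝ × ℝ => (Real.exp (r * a.1) * q.1 - a.2, q.2 - a.1)) (x := p) hG'
          (by fun_prop)
      refine hc.congr ?_
      filter_upwards [continuousAt_snd.eventually (Ioi_mem_nhds h)] with q hq
      have : a.1 < q.2 := hq
      simp [truncIntegrand, this]
    · refine (continuousAt_const (y := (0 : ℝ))).congr ?_
      filter_upwards [continuousAt_snd.eventually (Iio_mem_nhds h)] with q hq
      have : ¬ a.1 < q.2 := not_lt.2 (le_of_lt hq)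
      simp [truncIntegrand, this]

theorem intervalIntegral_truncIntegrand {G : ℝ × ℝ → ℝ} {x τ : ℝ} {a : ℝ × ℝ} (ha : 0 < a.1)
    (hτ : 0 ≤ τ) : ∫ σ in (0 : ℝ)..τ, truncIntegrand r s G (x, σ) a
      = truncIntegrand r s (fun q => ∫ σ in (0 : ℝ)..q.2, G (q.1, σ)) (x, τ) a := by
  have key : ∀ σ, truncIntegrand r s G (x, σ) a = (Ioi a.1).indicator (fun σ =>
      Real.exp (-s * a.1) * G (Real.exp (r * a.1) * x - a.2, σ - a.1)) σ := by
    intro σ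
    unfold truncIntegrand
    by_cases h : a.1 < σ
    · rw [if_pos h, indicator_of_mem (by simpa using h)]
    · rw [if_neg h, indicator_of_notMem (by simpa using h)]
  simp_rw [key]
  rw [intervalIntegral.integral_of_le hτ, setIntegral_indicator measurableSet_Ioi]
  unfold truncIntegrand
  simp only
  split_ifs with h
  · rw [← intervalIntegral.integral_const_mul]
    have h1 : Ioc 0 τ ∩ Ioi a.1 = Ioc a.1 τ := by
      ext σ; simp only [mem_inter_iff, mem_Ioc, mem_Ioi]; constructor
      · rintro ⟨⟨_, h2⟩, h3⟩; exact ⟨h3, h2⟩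
      · rintro ⟨h2, h3⟩; exact ⟨⟨by linarith, h3⟩, h2⟩
    rw [h1, ← intervalIntegral.integral_of_le h.le,
      intervalIntegral.integral_comp_sub_right
        (fun σ => Real.exp (-s * a.1) * G (Real.exp (r * a.1) * x - a.2, σ)) a.1, sub_self]
  · have h1 : Ioc 0 τ ∩ Ioi a.1 = ∅ := by
      ext σ; simp only [mem_inter_iff, mem_Ioc, mem_Ioi, mem_empty_iff_false, iff_false]
      rintro ⟨⟨_, h2⟩, h3⟩; linarith
    simp [h1]

/-- Fubini: integrating in the time left commutes with a claim, since a claim at time t merely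
shifts the time left by t and nothing is counted before t. It passes from the equation for the
τ-derivative to that for its primitive. -/
theorem intervalIntegral_truncStep (hlam : 0 < lam) (hs : 0 < s) {G : ℝ × ℝ → ℝ} {C : ℝ}
    (hG : Measurable G) (hC : ∀ q : ℝ × ℝ, |G q| ≤ C) {x τ : ℝ} (hτ : 0 ≤ τ) :
    ∫ σ in (0 : ℝ)..τ, truncStep r s lam m G (x, σ)
      = truncStep r s lam m (fun q => ∫ σ in (0 : ℝ)..q.2, G (q.1, σ)) (x, τ) := by
  have hC0 : 0 ≤ C := (abs_nonneg _).trans (hC 0)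
  have : IsProbabilityMeasure (claimLaw lam m) := isProbabilityMeasure_claimLaw hlam m
  unfold truncStep
  rw [intervalIntegral.integral_of_le hτ, integral_integral_swap]
  · refine integral_congr_ae ?_
    filter_upwards [ae_claimLaw_fst_pos lam m] with a ha
    rw [← intervalIntegral.integral_of_le hτ, intervalIntegral_truncIntegrand ha hτ]
  · refine Integrable.of_bound (C := C) ?_ ?_
    · have := (measurable_truncIntegrand (r := r) (s := s) hG).comp
        (f := fun b : ℝ × (ℝ × ℝ) => ((x, b.1), b.2)) (by fun_prop)
      exact this.aestronglyMeasurable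
    · have h := (Measure.quasiMeasurePreserving_snd (μ := volume.restrict (Ioc 0 τ))
        (ν := claimLaw lam m)).ae (ae_claimLaw_fst_pos lam m)
      filter_upwards [h] with b hb
      refine (abs_truncIntegrand_le hC0 (fun q _ _ => hC q) hb).trans ?_
      have : Real.exp (-s * b.2.1) ≤ 1 := by rw [Real.exp_le_one_iff]; nlinarith
      exact mul_le_of_le_one_left hC0 this

theorem truncStep_eq_setIntegral (hlam : 0 < lam) (hs : 0 < s) {G : ℝ × ℝ → ℝ} {C : ℝ}
    (hG : Measurable G) (hC : ∀ q : ℝ × ℝ, |G q| ≤ C) {x τ : ℝ} (hτ : 0 ≤ τ) :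
    truncStep r s lam m G (x, τ) = ∫ t in (0 : ℝ)..τ,
      lam * Real.exp (-(lam + s) * t) * ∫ z, G (Real.exp (r * t) * x - z, τ - t) ∂m := by
  have : IsProbabilityMeasure (expMeasure lam) := isProbabilityMeasure_expMeasure hlam
  have hi := integrable_truncIntegrand (r := r) (m := m) (p := (x, τ)) hlam hs hG
    ((abs_nonneg _).trans (hC 0)) (fun q _ _ => hC q)
  unfold truncStep claimLaw at *
  rw [integral_prod _ hi, integral_expMeasure hlam, intervalIntegral.integral_of_le hτ,
    ← integral_indicator measurableSet_Ioi, ← integral_indicator measurableSet_Ioc]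
  refine integral_congr_ae ?_
  have h0 : ∀ᵐ t : ℝ, t ≠ τ := by simp [ae_iff]
  filter_upwards [h0] with t ht
  by_cases h1 : 0 < t
  · rw [indicator_of_mem (by simpa using h1)]
    rcases lt_or_gt_of_ne ht with h2 | h2
    · rw [indicator_of_mem (by exact ⟨h1, h2.le⟩)]
      have : Real.exp (-(lam + s) * t) = Real.exp (-lam * t) * Real.exp (-s * t) := by
        rw [← Real.exp_add]; ring_nf
      simp only [truncIntegrand, h2, if_true, integral_const_mul, this]
      ring
    · rw [indicator_of_notMem (by rintro ⟨_, h3⟩; linarith)]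
      simp [truncIntegrand, not_lt.2 h2.le]
  · rw [indicator_of_notMem (by simpa using h1),
      indicator_of_notMem (by rintro ⟨h3, _⟩; exact h1 h3)]

end

/-- A function with the contraction property of the renewal operator on a bounded time interval
vanishes there. -/
theorem eq_zero_of_abs_le_mul {α : Type*} {E : α → ℝ} {S : Set α} {θ C : ℝ} (hθ0 : 0 ≤ θ)
    (hθ : θ < 1) (hC : ∀ q ∈ S, |E q| ≤ C)
    (hstep : ∀ M, 0 ≤ M → (∀ q ∈ S, |E q| ≤ M) → ∀ q ∈ S, |E q| ≤ θ * M) :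
    ∀ q ∈ S, E q = 0 := by
  intro q hq
  have hC0 : 0 ≤ C := (abs_nonneg _).trans (hC q hq)
  have key : ∀ n : ℕ, ∀ q ∈ S, |E q| ≤ θ ^ n * C := by
    intro n
    induction n with
    | zero => simpa using hC
    | succ n ih =>
      intro q hq
      have := hstep (θ ^ n * C) (by positivity) ih q hq
      rwa [pow_succ', mul_assoc]
  have hlim : Tendsto (fun n : ℕ => θ ^ n * C) atTop (𝓝 0) := by
    simpa using (tendsto_pow_atTop_nhds_zero_of_lt_one hθ0 hθ).mul_const C
  have := ge_of_tendsto' hlim (fun n => key n q hq)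
  exact abs_eq_zero.1 (le_antisymm this (abs_nonneg _))

/-! ### The terminal value problem for the derivative in the time to the crossing -/

/-- Banach's fixed point theorem in the bounded continuous functions on the plane. The indicator
encodes that below `e` the transform is constant, so its derivative vanishes; its jump is smoothed
by `continuous_truncStep`. Clamping the time at 0 makes the source term bounded everywhere. -/
theorem exists_truncStep_fixedPoint {r s lam e : ℝ} (hlam : 0 < lam) (hs : 0 < s)
    (m : Measure ℝ) [IsProbabilityMeasure m] [NullSingletonClass m] {b : ℝ → ℝ} {Cb : ℝ}
    (hb : Continuous b) (hCb : ∀ x, |b x| ≤ Cb) :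
    ∃ V : ℝ × ℝ → ℝ, Continuous V ∧ (∃ C, ∀ q, |V q| ≤ C) ∧
      ∀ q : ℝ × ℝ, V q = truncStep r s lam m ({q : ℝ × ℝ | e ≤ q.1}.indicator V) q
        + Real.exp (-(lam + s) * max q.2 0) * b (Real.exp (r * max q.2 0) * q.1) := by
  have hS : MeasurableSet {q : ℝ × ℝ | e ≤ q.1} := measurableSet_le (by fun_prop) (by fun_prop)
  have hind : ∀ V : BoundedContinuousFunction (ℝ × ℝ) ℝ, ∀ q,
      |({q : ℝ × ℝ | e ≤ q.1}.indicator V) q| ≤ ‖V‖ := by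
    intro V q
    by_cases hq : q ∈ {q : ℝ × ℝ | e ≤ q.1}
    · rw [indicator_of_mem hq]; exact V.norm_coe_le_norm q
    · rw [indicator_of_notMem hq]; simp
  have hmeas : ∀ V : BoundedContinuousFunction (ℝ × ℝ) ℝ,
      Measurable ({q : ℝ × ℝ | e ≤ q.1}.indicator V) :=
    fun V => V.continuous.measurable.indicator hS
  have hcont : ∀ V : BoundedContinuousFunction (ℝ × ℝ) ℝ,
      Continuous (truncStep r s lam m ({q : ℝ × ℝ | e ≤ q.1}.indicator V)) := by
    intro V
    refine continuous_truncStep (e := e) hlam hs (hmeas V) (hind V) fun q hq => ?_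
    rcases lt_or_gt_of_ne hq with h | h
    · refine (continuousAt_const (y := (0 : ℝ))).congr ?_
      filter_upwards [continuousAt_fst.eventually (Iio_mem_nhds h)] with p hp
      exact (indicator_of_notMem (by simpa using hp) _).symm
    · refine V.continuous.continuousAt.congr ?_
      filter_upwards [continuousAt_fst.eventually (Ioi_mem_nhds h)] with p hp
      exact (indicator_of_mem (show p ∈ {q : ℝ × ℝ | e ≤ q.1} from le_of_lt hp) _).symm
  have hCb0 : 0 ≤ Cb := (abs_nonneg _).trans (hCb 0)
  have hθ0 : 0 ≤ lam / (lam + s) := by positivity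
  let A : BoundedContinuousFunction (ℝ × ℝ) ℝ → BoundedContinuousFunction (ℝ × ℝ) ℝ := fun V =>
    BoundedContinuousFunction.ofNormedAddCommGroup
      (fun q => truncStep r s lam m ({q : ℝ × ℝ | e ≤ q.1}.indicator V) q
        + Real.exp (-(lam + s) * max q.2 0) * b (Real.exp (r * max q.2 0) * q.1))
      (by have := hcont V; fun_prop) (lam / (lam + s) * ‖V‖ + Cb) (by
        intro q
        refine (norm_add_le _ _).trans (add_le_add ?_ ?_)
        · exact abs_truncStep_le hlam hs (norm_nonneg V) (fun q _ _ => hind V q)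
        · rw [norm_mul, Real.norm_eq_abs, Real.abs_exp]
          have h1 : Real.exp (-(lam + s) * max q.2 0) ≤ 1 := by
            rw [Real.exp_le_one_iff]
            have := le_max_right q.2 0
            nlinarith
          exact (mul_le_of_le_one_left (norm_nonneg _) h1).trans (hCb _))
  have hA : ∀ V q, A V q = truncStep r s lam m ({q : ℝ × ℝ | e ≤ q.1}.indicator V) q
        + Real.exp (-(lam + s) * max q.2 0) * b (Real.exp (r * max q.2 0) * q.1) :=
    fun V q => rfl
  have hcontr : ContractingWith (Real.toNNReal (lam / (lam + s))) A := by
    constructor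
    · rw [Real.toNNReal_lt_one, div_lt_one (by linarith)]
      linarith
    · refine LipschitzWith.of_dist_le_mul fun V W => ?_
      rw [Real.coe_toNNReal _ hθ0]
      refine (BoundedContinuousFunction.dist_le (mul_nonneg hθ0 dist_nonneg)).2 ?_
      intro q
      have hd : ∀ q' : ℝ × ℝ, |({q : ℝ × ℝ | e ≤ q.1}.indicator V) q'
          - ({q : ℝ × ℝ | e ≤ q.1}.indicator W) q'| ≤ dist V W := by
        intro q'
        by_cases hq : q' ∈ {q : ℝ × ℝ | e ≤ q.1}
        · rw [indicator_of_mem hq, indicator_of_mem hq]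
          rw [← Real.dist_eq]
          exact BoundedContinuousFunction.dist_coe_le_dist (f := V) (g := W) q'
        · rw [indicator_of_notMem hq, indicator_of_notMem hq]; simp
      have h1 := truncStep_sub (r := r) (m := m) (p := q) (C := max ‖V‖ ‖W‖) hlam hs
        (hmeas V) (hmeas W) (le_max_of_le_left (norm_nonneg V))
        (fun q _ _ => (hind V q).trans (le_max_left _ _))
        (fun q _ _ => (hind W q).trans (le_max_right _ _))
      rw [Real.dist_eq, hA, hA, add_sub_add_right_eq_sub, ← h1]
      exact abs_truncStep_le hlam hs dist_nonneg (fun q _ _ => hd q)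
  refine ⟨hcontr.fixedPoint, hcontr.fixedPoint.continuous,
    ⟨‖hcontr.fixedPoint‖, fun q => hcontr.fixedPoint.norm_coe_le_norm q⟩, fun q => ?_⟩
  rw [← hA]
  exact DFunLike.congr_fun hcontr.fixedPoint_isFixedPt.symm q

namespace IsRenewalSolution

variable {r s lam e : ℝ} {m : Measure ℝ} {ψ : ℝ → ℝ}

/-- The derivative of the transform of a single line of business. -/
def slope (r s lam : ℝ) (m : Measure ℝ) (ψ : ℝ → ℝ) (y : ℝ) : ℝ :=
  ((lam + s) * smoothExt r s lam m ψ y - lam * claimMean m ψ y) / (r * y)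

/-- The terminal condition of the problem for the derivative. -/
def crossingSlope (r s lam e D : ℝ) (m : Measure ℝ) (ψ : ℝ → ℝ) (x : ℝ) : ℝ :=
  r * D * slope r s lam m ψ (max x (e + D) - D)

theorem crossingSlope_of_le {D x : ℝ} (hx : e + D ≤ x) :
    crossingSlope r s lam e D m ψ x = r * D * slope r s lam m ψ (x - D) := by
  rw [crossingSlope, max_eq_left hx]

variable [IsProbabilityMeasure m]

theorem continuousAt_slope [NullSingletonClass m] (h : IsRenewalSolution r s lam e m ψ)
    (hr : 0 < r) (hlam : 0 < lam) (hs : 0 < s) (he : 0 < e) {y : ℝ} (hy : 0 < y) :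
    ContinuousAt (slope r s lam m ψ) y := by
  have h1 := h.continuousAt_smoothExt hlam hs hy
  have h2 := (h.continuous_claimMean hr hlam hs he).continuousAt (x := y)
  unfold slope
  exact ContinuousAt.div (by fun_prop) (by fun_prop) (by positivity)

theorem abs_slope_le (h : IsRenewalSolution r s lam e m ψ) (hr : 0 < r) (hlam : 0 < lam)
    (hs : 0 < s) (he : 0 < e) {y : ℝ} (hy : e ≤ y) :
    |slope r s lam m ψ y| ≤ ((lam + s) + lam) / (r * e) := by
  have hy0 : 0 < y := he.trans_le hy
  unfold slope
  rw [abs_div, abs_of_pos (show 0 < r * y by positivity)]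
  refine div_le_div₀ (by positivity) ?_ (by positivity) (by gcongr)
  rw [← h.eq_smoothExt hr he hy]
  refine (abs_sub _ _).trans (add_le_add ?_ ?_)
  · rw [abs_mul, abs_of_pos (show 0 < lam + s by linarith)]
    exact mul_le_of_le_one_right (by linarith) (h.abs_le_one y)
  · rw [abs_mul, abs_of_pos hlam]
    exact mul_le_of_le_one_right hlam.le (abs_claimMean_le m h.abs_le_one y)

/-- The clamp at `e + D` keeps the argument of `slope` at least `e`, so the source term is
continuous, and likewise bounded, on the whole line, as the fixed point argument requires. -/
theorem continuous_crossingSlope [NullSingletonClass m] (h : IsRenewalSolution r s lam e m ψ)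
    (hr : 0 < r) (hlam : 0 < lam) (hs : 0 < s) (he : 0 < e) (D : ℝ) :
    Continuous (crossingSlope r s lam e D m ψ) := by
  refine continuous_const.mul (continuous_iff_continuousAt.2 fun x => ?_)
  refine ContinuousAt.comp (g := slope r s lam m ψ) (f := fun x => max x (e + D) - D)
    (h.continuousAt_slope hr hlam hs he ?_) (by fun_prop)
  have := le_max_right x (e + D)
  linarith

theorem abs_crossingSlope_le (h : IsRenewalSolution r s lam e m ψ)
    (hr : 0 < r) (hlam : 0 < lam) (hs : 0 < s) (he : 0 < e) {D : ℝ} (hD : 0 < D) (x : ℝ) :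
    |crossingSlope r s lam e D m ψ x| ≤ r * D * (((lam + s) + lam) / (r * e)) := by
  unfold crossingSlope
  rw [abs_mul, abs_of_pos (show 0 < r * D by positivity)]
  have := le_max_right x (e + D)
  gcongr
  exact h.abs_slope_le hr hlam hs he (by linarith)

/-- The discounted transform along the line on which the crossing happens. -/
theorem intervalIntegral_crossingSlope [NullSingletonClass m]
    (h : IsRenewalSolution r s lam e m ψ) (hr : 0 < r) (hlam : 0 < lam) (hs : 0 < s)
    (he : 0 < e) {D : ℝ} (hD : 0 < D) {x τ : ℝ} (hx : e + D ≤ x) (hτ : 0 ≤ τ) :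
    ∫ σ in (0 : ℝ)..τ, Real.exp (-(lam + s) * max σ 0)
        * crossingSlope r s lam e D m ψ (Real.exp (r * max σ 0) * x)
      = Real.exp (-(lam + s) * τ) * ψ (Real.exp (r * τ) * x - D) - ψ (x - D)
        + truncStep r s lam m (fun q => ψ (q.1 - D)) (x, τ) := by
  have hx0 : 0 < x := by linarith
  have hge : ∀ σ : ℝ, 0 ≤ σ → e + D ≤ Real.exp (r * σ) * x := by
    intro σ hσ
    have : 1 ≤ Real.exp (r * σ) := Real.one_le_exp (by positivity)
    nlinarith
  have hcm := h.continuous_claimMean hr hlam hs he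
  have hcs := h.continuous_crossingSlope hr hlam hs he D
  have hm : Measurable (fun q : ℝ × ℝ => ψ (q.1 - D)) := h.measurable.comp (by fun_prop)
  rw [truncStep_eq_setIntegral (C := 1) hlam hs hm (fun q => h.abs_le_one _) hτ]
  have h1 : ∀ t : ℝ, (∫ z, (fun q : ℝ × ℝ => ψ (q.1 - D)) (Real.exp (r * t) * x - z, τ - t) ∂m)
      = claimMean m ψ (Real.exp (r * t) * x - D) := by
    intro t
    simp only [claimMean]
    congr 1; ext z; ring_nf
  simp_rw [h1]
  -- In this product rule the terms with `lam + s` cancel by the differential equation for `ψ`,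
  -- leaving the source term and the density of the first claim at time σ.
  have hderiv : ∀ σ ∈ uIcc 0 τ, HasDerivAt
      (fun σ => Real.exp (-(lam + s) * σ) * smoothExt r s lam m ψ (Real.exp (r * σ) * x - D))
      (Real.exp (-(lam + s) * max σ 0) * crossingSlope r s lam e D m ψ (Real.exp (r * max σ 0) * x)
        - lam * Real.exp (-(lam + s) * σ) * claimMean m ψ (Real.exp (r * σ) * x - D)) σ := by
    intro σ hσ
    rw [uIcc_of_le hτ] at hσ
    have hY : e ≤ Real.exp (r * σ) * x - D := by linarith [hge σ hσ.1]
    have hY0 : 0 < Real.exp (r * σ) * x - D := he.trans_le hY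
    have d1 : HasDerivAt (fun σ => Real.exp (-(lam + s) * σ))
        (Real.exp (-(lam + s) * σ) * (-(lam + s))) σ := by
      simpa using ((hasDerivAt_id σ).const_mul (-(lam + s))).exp
    have d2 : HasDerivAt (fun σ => Real.exp (r * σ) * x - D) (Real.exp (r * σ) * r * x) σ := by
      simpa using ((((hasDerivAt_id σ).const_mul r).exp).mul_const x).sub_const D
    have d3 := d1.mul ((h.hasDerivAt_smoothExt hr hlam hs he hY0).comp σ d2)
    refine d3.congr_deriv ?_
    rw [max_eq_left hσ.1, crossingSlope_of_le (hge σ hσ.1), slope]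
    simp only [Function.comp]
    -- The speed of Y = e^{rσ}x - D exceeds the flow speed rY by rD. The part rY is absorbed by the
    -- equation for `ψ`; the excess produces `crossingSlope`.
    have hX : Real.exp (r * σ) * r * x = r * (Real.exp (r * σ) * x - D) + r * D := by ring
    rw [hX]
    generalize Real.exp (r * σ) * x - D = Y at hY0
    field_simp
    ring
  have hint : ∫ σ in (0 : ℝ)..τ, (Real.exp (-(lam + s) * max σ 0)
        * crossingSlope r s lam e D m ψ (Real.exp (r * max σ 0) * x)
        - lam * Real.exp (-(lam + s) * σ) * claimMean m ψ (Real.exp (r * σ) * x - D)) = _ :=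
    intervalIntegral.integral_eq_sub_of_hasDerivAt hderiv
      (Continuous.intervalIntegrable (by fun_prop) _ _)
  rw [intervalIntegral.integral_sub (Continuous.intervalIntegrable (by fun_prop) _ _)
    (Continuous.intervalIntegrable (by fun_prop) _ _)] at hint
  have e1 := h.eq_smoothExt hr he (y := Real.exp (r * τ) * x - D) (by linarith [hge τ hτ])
  have e2 := h.eq_smoothExt hr he (y := x - D) (by linarith)
  rw [e1, e2]
  simp only [mul_zero, Real.exp_zero, one_mul] at hint
  linarith

end IsRenewalSolution

/-! ### Identification of the integrated fixed point with the joint transform -/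

namespace IsRuinTransform

variable {r s lam e₁ e₂ : ℝ} {m : Measure ℝ} {Φ : ℝ × ℝ → ℝ}

/-- The transform as a function of the first coordinate and of the time `τ` which the flow needs
to reach the line `x - y = e₁ - e₂`. -/
def crossingForm (r D : ℝ) (Φ : ℝ × ℝ → ℝ) (q : ℝ × ℝ) : ℝ :=
  Φ (q.1, q.1 - D * Real.exp (-r * q.2))

theorem measurable_crossingForm (h : IsRuinTransform r s lam e₁ e₂ m Φ) (D : ℝ) :
    Measurable (crossingForm r D Φ) :=
  h.measurable.comp (f := fun q : ℝ × ℝ => (q.1, q.1 - D * Real.exp (-r * q.2))) (by fun_prop)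

variable [IsProbabilityMeasure m]

/-- The renewal integral is cut at the crossing time τ. Its tail is the renewal integral started at
the point of the crossing line reached without claims, where Φ is the transform of the second line.
-/
theorem crossingForm_eq (h : IsRuinTransform r s lam e₁ e₂ m Φ) (hr : 0 < r) (hlam : 0 < lam)
    (hs : 0 < s) (he : e₂ < e₁) (he₂ : 0 < e₂) {x τ : ℝ} (hx : e₁ ≤ x) (hτ : 0 ≤ τ) :
    crossingForm r (e₁ - e₂) Φ (x, τ)
      = truncStep r s lam m (crossingForm r (e₁ - e₂) Φ) (x, τ)
        + Real.exp (-(lam + s) * τ)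
          * second (e₁ - e₂) Φ (Real.exp (r * τ) * x - (e₁ - e₂)) := by
  set D := e₁ - e₂ with hDdef
  have hD : 0 < D := sub_pos.2 he
  have hexp : Real.exp (-r * τ) ≤ 1 := by rw [Real.exp_le_one_iff]; nlinarith
  set y := x - D * Real.exp (-r * τ) with hy
  have hy2 : e₂ ≤ y := by nlinarith
  have hy0 : 0 < y := he₂.trans_le hy2
  have hx0 : 0 < x := by linarith
  have h1 : 1 ≤ Real.exp (r * τ) := Real.one_le_exp (by positivity)
  set B : ℝ → ℝ := fun t => afterClaim m Φ (Real.exp (r * t) * x, Real.exp (r * t) * y) with hB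
  have hBm : Measurable B := (measurable_afterClaim m h.measurable).comp
    (f := fun t : ℝ => (Real.exp (r * t) * x, Real.exp (r * t) * y)) (by fun_prop)
  have hBb : ∀ t, |B t| ≤ 1 := fun t => abs_afterClaim_le m h.abs_le_one _
  have e0 : crossingForm r D Φ (x, τ) = discounted lam (lam + s) B 0 :=
    h.eq_discounted hlam hs hx hy2
  have e1 : Φ (Real.exp (r * τ) * x, Real.exp (r * τ) * y) = discounted lam (lam + s) B τ := by
    rw [h.eq_discounted hlam hs (p := (Real.exp (r * τ) * x, Real.exp (r * τ) * y))
      (by simp only; nlinarith) (by simp only; nlinarith),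
      discounted_comp_flow (r := r) (afterClaim m Φ) (x, y) τ]
  have e2 : Real.exp (r * τ) * y = Real.exp (r * τ) * x - D := by
    rw [hy, mul_sub, mul_left_comm, ← Real.exp_add]; simp
  have e3 : truncStep r s lam m (crossingForm r D Φ) (x, τ)
      = lam * ∫ t in (0 : ℝ)..τ, Real.exp (-(lam + s) * t) * B t := by
    rw [truncStep_eq_setIntegral (C := 1) hlam hs (h.measurable_crossingForm D)
      (fun q => h.abs_le_one _) hτ, ← intervalIntegral.integral_const_mul]
    congr 1; ext t
    rw [mul_assoc]
    congr 2
    simp only [hB, afterClaim, crossingForm]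
    congr 1; ext z
    congr 2
    -- After time t the difference x - y has grown by e^{rt} and claims leave it alone, so the time
    -- to the crossing is exactly τ - t.
    have : Real.exp (-r * (τ - t)) = Real.exp (r * t) * Real.exp (-r * τ) := by
      rw [← Real.exp_add]; ring_nf
    rw [this, hy]; ring
  rw [e2] at e1
  have e4 : second D Φ (Real.exp (r * τ) * x - D) = discounted lam (lam + s) B τ := by
    rw [← e1, second]; simp
  rw [e0, e3, e4, discounted_eq_sub (by linarith) hBm hBb 0,
    discounted_eq_sub (by linarith) hBm hBb τ]
  have e5 : Real.exp (-(lam + s) * τ) * Real.exp ((lam + s) * τ) = 1 := by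
    rw [← Real.exp_add, Real.exp_eq_one_iff]; ring
  simp only [mul_zero, Real.exp_zero, intervalIntegral.integral_same, sub_zero, mul_one]
  linear_combination (-lam * ((∫ t in Ioi (0 : ℝ), Real.exp (-(lam + s) * t) * B t)
        - ∫ t in (0 : ℝ)..τ, Real.exp (-(lam + s) * t) * B t)) * e5

/-- Below the crossing line the transform is continuously differentiable in the time to the
crossing. -/
theorem exists_crossing_derivative [NullSingletonClass m]
    (h : IsRuinTransform r s lam e₁ e₂ m Φ) (hr : 0 < r) (hlam : 0 < lam) (hs : 0 < s)
    (he : e₂ < e₁) (he₂ : 0 < e₂) :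
    ∃ V : ℝ × ℝ → ℝ, Continuous V ∧
      (∀ x, e₁ ≤ x → V (x, 0) = r * (e₁ - e₂)
        * IsRenewalSolution.slope r s lam m (second (e₁ - e₂) Φ) (x - (e₁ - e₂))) ∧
      ∀ x τ, e₁ ≤ x → 0 ≤ τ → Φ (x, x - (e₁ - e₂) * Real.exp (-r * τ))
        = second (e₁ - e₂) Φ (x - (e₁ - e₂)) + ∫ σ in (0 : ℝ)..τ, V (x, σ) := by
  have hψ := h.second_isRenewalSolution hr hlam hs he
  set D := e₁ - e₂ with hDdef
  have hD : 0 < D := sub_pos.2 he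
  set ψ := second D Φ
  obtain ⟨V, hVc, ⟨C, hC⟩, hV⟩ := exists_truncStep_fixedPoint (r := r) (e := e₁) hlam hs m
    (hψ.continuous_crossingSlope hr hlam hs he₂ D) (hψ.abs_crossingSlope_le hr hlam hs he₂ hD)
  have hC0 : 0 ≤ C := (abs_nonneg _).trans (hC 0)
  have heD : e₂ + D = e₁ := by rw [hDdef]; ring
  refine ⟨V, hVc, fun x hx => ?_, ?_⟩
  -- With no time left no claim precedes the crossing: the bound on `G` is vacuous and holds with
  -- the constant 0.
  · have h1 : truncStep r s lam m ({q : ℝ × ℝ | e₁ ≤ q.1}.indicator V) (x, 0) = 0 := by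
      have := abs_truncStep_le (r := r) (m := m) (p := (x, 0)) (C := 0)
        (G := {q : ℝ × ℝ | e₁ ≤ q.1}.indicator V) hlam hs le_rfl
        (fun q h1 h2 => absurd h1 (not_lt.2 h2))
      simpa using this
    rw [hV, h1]
    simp only [max_self, mul_zero, Real.exp_zero, one_mul, zero_add]
    exact IsRenewalSolution.crossingSlope_of_le (by rw [heD]; exact hx)
  set V₁ := {q : ℝ × ℝ | e₁ ≤ q.1}.indicator V with hV₁
  have hS : MeasurableSet {q : ℝ × ℝ | e₁ ≤ q.1} :=
    measurableSet_le (by fun_prop) (by fun_prop)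
  have hV₁m : Measurable V₁ := hVc.measurable.indicator hS
  have hV₁C : ∀ q, |V₁ q| ≤ C := by
    intro q
    by_cases hq : q ∈ {q : ℝ × ℝ | e₁ ≤ q.1}
    · rw [hV₁, indicator_of_mem hq]; exact hC q
    · rw [hV₁, indicator_of_notMem hq]; simpa using hC0
  set W : ℝ × ℝ → ℝ := fun q => ∫ σ in (0 : ℝ)..q.2, V₁ (q.1, σ) with hW
  have hWm : Measurable W := by
    have : W = {q : ℝ × ℝ | e₁ ≤ q.1}.indicator
        (fun q => ∫ σ in (0 : ℝ)..q.2, V (q.1, σ)) := by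
      ext q
      by_cases hq : q ∈ {q : ℝ × ℝ | e₁ ≤ q.1}
      · rw [indicator_of_mem hq]
        have : ∀ σ : ℝ, V₁ (q.1, σ) = V (q.1, σ) := fun σ => indicator_of_mem (by exact hq) _
        simp [hW, this]
      · rw [indicator_of_notMem hq]
        have : ∀ σ : ℝ, V₁ (q.1, σ) = 0 := fun σ => indicator_of_notMem (by exact hq) _
        simp [hW, this]
    rw [this]
    refine Measurable.indicator ?_ hS
    refine (intervalIntegral.continuous_parametric_intervalIntegral_of_continuous
      (f := fun q : ℝ × ℝ => fun σ => V (q.1, σ)) ?_ continuous_snd).measurable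
    exact hVc.comp (f := fun a : (ℝ × ℝ) × ℝ => (a.1.1, a.2)) (by fun_prop)
  have hWb : ∀ q : ℝ × ℝ, 0 ≤ q.2 → |W q| ≤ C * q.2 := by
    intro q hq
    have := intervalIntegral.norm_integral_le_of_norm_le_const (a := 0) (b := q.2)
      (f := fun σ => V₁ (q.1, σ)) (C := C) (fun σ _ => hV₁C _)
    simpa [abs_of_nonneg hq] using this
  have hψm : Measurable (fun q : ℝ × ℝ => ψ (q.1 - D)) := hψ.measurable.comp (by fun_prop)
  -- The fixed point equation of `V`, integrated in τ: the primitive satisfies the same truncated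
  -- renewal equation as `crossingForm`.
  have hsol : ∀ x τ, e₁ ≤ x → 0 ≤ τ → ψ (x - D) + W (x, τ)
      = truncStep r s lam m (fun q => ψ (q.1 - D) + W q) (x, τ)
        + Real.exp (-(lam + s) * τ) * ψ (Real.exp (r * τ) * x - D) := by
    intro x τ hx hτ
    have hCτ : 0 ≤ C * τ := by positivity
    rw [truncStep_add (C := 1 + C * τ) hlam hs hψm hWm (by positivity)
      (fun q _ _ => (hψ.abs_le_one _).trans (by linarith))
      (fun q h1 h2 => (hWb q h1.le).trans (by nlinarith)),
      ← intervalIntegral_truncStep (C := C) hlam hs hV₁m hV₁C hτ]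
    have h1 := hψ.intervalIntegral_crossingSlope hr hlam hs he₂ hD (x := x) (by linarith) hτ
    have hcs := hψ.continuous_crossingSlope hr hlam hs he₂ D
    have hts : Continuous (truncStep r s lam m V₁) := by
      have : truncStep r s lam m V₁ = fun q => V q - Real.exp (-(lam + s) * max q.2 0)
          * IsRenewalSolution.crossingSlope r s lam e₂ D m ψ (Real.exp (r * max q.2 0) * q.1) := by
        ext q; rw [hV q]; ring
      rw [this]; fun_prop
    have h2 : W (x, τ) = (∫ σ in (0 : ℝ)..τ, truncStep r s lam m V₁ (x, σ))
        + ∫ σ in (0 : ℝ)..τ, Real.exp (-(lam + s) * max σ 0)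
          * IsRenewalSolution.crossingSlope r s lam e₂ D m ψ (Real.exp (r * max σ 0) * x) := by
      rw [← intervalIntegral.integral_add (Continuous.intervalIntegrable (by fun_prop) _ _)
        (Continuous.intervalIntegrable (by fun_prop) _ _)]
      refine intervalIntegral.integral_congr fun σ _ => ?_
      have : V₁ (x, σ) = V (x, σ) := indicator_of_mem (by exact hx) _
      simp only [this]
      exact hV (x, σ)
    rw [h2, h1]
    ring
  have hWx : ∀ x τ, e₁ ≤ x → W (x, τ) = ∫ σ in (0 : ℝ)..τ, V (x, σ) := by
    intro x τ hx
    have : ∀ σ : ℝ, V₁ (x, σ) = V (x, σ) := fun σ => indicator_of_mem (by exact hx) _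
    simp [hW, this]
  intro x τ hx hτ
  rw [← hWx x τ hx]
  -- `W` is known to be bounded only on bounded time intervals, so the contraction is run on times
  -- left up to τ; a truncated step never leaves this strip.
  have hfin : ∀ q ∈ {q : ℝ × ℝ | 0 ≤ q.2 ∧ q.2 ≤ τ},
      crossingForm r D Φ q - (ψ (q.1 - D) + W q) = 0 := by
    have hCτ : 0 ≤ C * τ := by positivity
    have hbd : ∀ q : ℝ × ℝ, 0 ≤ q.2 → q.2 ≤ τ → |ψ (q.1 - D) + W q| ≤ 1 + C * τ := by
      intro q h1 h2
      refine (abs_add_le _ _).trans (add_le_add (hψ.abs_le_one _) ((hWb q h1).trans ?_))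
      gcongr
    refine eq_zero_of_abs_le_mul (θ := lam / (lam + s)) (C := 1 + (1 + C * τ)) (by positivity)
      (by rw [div_lt_one (by linarith)]; linarith) ?_ ?_
    · intro q hq
      exact (abs_sub _ _).trans (add_le_add (h.abs_le_one _) (hbd q hq.1 hq.2))
    · intro M hM hle q hq
      rcases lt_or_ge q.1 e₁ with hlt | hge
      -- Below `e₁` the first line is ruined, and then x - D < e₂, so both functions equal 1.
      · have h1 : crossingForm r D Φ q = 1 := h.ruined _ (Or.inl hlt)
        have h2 : ψ (q.1 - D) = 1 := hψ.ruined _ (by rw [hDdef]; linarith)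
        have h3 : W q = 0 := by
          have : ∀ σ : ℝ, V₁ (q.1, σ) = 0 :=
            fun σ => indicator_of_notMem (by simpa using hlt) _
          simp [hW, this]
        rw [h1, h2, h3]
        simp only [add_zero, sub_self, abs_zero]
        positivity
      · have h1 := h.crossingForm_eq hr hlam hs he he₂ hge hq.1
        have h2 := hsol q.1 q.2 hge hq.1
        rw [← hDdef] at h1
        have h3 := truncStep_sub (r := r) (m := m) (p := q) (C := 1 + C * τ) hlam hs
          (h.measurable_crossingForm D) (G' := fun q => ψ (q.1 - D) + W q) (hψm.add hWm)
          (by positivity)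
          (fun q _ _ => (h.abs_le_one _).trans (by linarith))
          (fun q' h3 h4 => hbd q' h3.le (h4.trans hq.2))
        have h4 : crossingForm r D Φ q - (ψ (q.1 - D) + W q)
            = truncStep r s lam m (fun q => crossingForm r D Φ q - (ψ (q.1 - D) + W q)) q := by
          rw [h3]
          change crossingForm r D Φ (q.1, q.2) - (ψ (q.1 - D) + W (q.1, q.2)) = _
          rw [h1, h2]
          simp only [Prod.mk.eta]
          ring
        rw [h4]
        exact abs_truncStep_le hlam hs hM (fun q' h5 h6 => hle q' ⟨h5.le, h6.trans hq.2⟩)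
  have := hfin (x, τ) ⟨hτ, le_rfl⟩
  exact sub_eq_zero.1 this

end IsRuinTransform

/-! ### Comparison with the first line of business -/

theorem ae_claimLaw_snd_nonneg {lam : ℝ} (hlam : 0 < lam) {m : Measure ℝ}
    [IsProbabilityMeasure m] (hm : ∀ᵐ z ∂m, 0 ≤ z) : ∀ᵐ a ∂claimLaw lam m, 0 ≤ a.2 := by
  have : IsProbabilityMeasure (expMeasure lam) := isProbabilityMeasure_expMeasure hlam
  exact Measure.quasiMeasurePreserving_snd.ae hm

theorem lintegral_exp_claimLaw {lam s : ℝ} (hlam : 0 < lam) (hs : 0 < s) (m : Measure ℝ)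
    [IsProbabilityMeasure m] :
    ∫⁻ a, ENNReal.ofReal (Real.exp (-s * a.1)) ∂claimLaw lam m
      = ENNReal.ofReal (lam / (lam + s)) := by
  rw [← integral_exp_claimLaw hlam (by linarith) m,
    ofReal_integral_eq_lintegral_ofReal (integrable_exp_claimLaw hlam hs m)
      (Eventually.of_forall fun a => (Real.exp_pos _).le)]

namespace IsRuinTransform

variable {r s lam e₁ e₂ : ℝ} {m : Measure ℝ} {Φ : ℝ × ℝ → ℝ}

/-- The difference of the transforms of the joint ruin time and of the ruin time of the first line
of business. -/
def gap (Φ : ℝ × ℝ → ℝ) (x q : ℝ) : ENNReal := ENNReal.ofReal |Φ (x, x - q) - Φ (x, x)|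

theorem measurable_gap (h : IsRuinTransform r s lam e₁ e₂ m Φ) :
    Measurable (fun p : ℝ × ℝ => gap Φ p.1 p.2) := by
  have := h.measurable
  unfold gap
  fun_prop

theorem gap_le_one (h : IsRuinTransform r s lam e₁ e₂ m Φ) (x q : ℝ) : gap Φ x q ≤ 1 := by
  unfold gap
  rw [← ENNReal.ofReal_one]
  refine ENNReal.ofReal_le_ofReal (abs_le.2 ⟨?_, ?_⟩)
  · linarith [h.nonneg (x, x - q), h.le_one (x, x)]
  · linarith [h.nonneg (x, x), h.le_one (x, x - q)]

theorem gap_eq_zero (h : IsRuinTransform r s lam e₁ e₂ m Φ) {x q : ℝ} (hx : x < e₁) :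
    gap Φ x q = 0 := by
  unfold gap
  rw [h.ruined _ (Or.inl hx), h.ruined _ (Or.inl hx)]
  simp

variable [IsProbabilityMeasure m]

/-- Both (x, x - q) and (x, x) are solvent, so their renewal equations may be subtracted. Values in
[0, ∞] let the later interchanges of integrals use Tonelli only. -/
theorem gap_le_lintegral (h : IsRuinTransform r s lam e₁ e₂ m Φ) (hlam : 0 < lam) (hs : 0 < s)
    (he : e₂ < e₁) {x q : ℝ} (hx : e₁ ≤ x) (hq : q ≤ x - e₂) :
    gap Φ x q ≤ ∫⁻ a, ENNReal.ofReal (Real.exp (-s * a.1))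
      * gap Φ (Real.exp (r * a.1) * x - a.2) (Real.exp (r * a.1) * q) ∂claimLaw lam m := by
  have hint : ∀ p : ℝ × ℝ, Integrable (fun a : ℝ × ℝ => Real.exp (-s * a.1)
      * Φ (Real.exp (r * a.1) * p.1 - a.2, Real.exp (r * a.1) * p.2 - a.2)) (claimLaw lam m) := by
    intro p
    refine (integrable_exp_claimLaw hlam hs m).mul_bdd (c := 1) ?_ ?_
    · exact (h.measurable.comp (f := fun a : ℝ × ℝ => (Real.exp (r * a.1) * p.1 - a.2,
        Real.exp (r * a.1) * p.2 - a.2)) (by fun_prop)).aestronglyMeasurable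
    · exact Eventually.of_forall fun a => h.abs_le_one _
  have h1 := h.renewal (x, x - q) hx (by simp only; linarith)
  have h2 := h.renewal (x, x) hx (by simp only; linarith)
  rw [gap, h1, h2]
  rw [claimLaw] at hint
  rw [← integral_sub (hint (x, x - q)) (hint (x, x)), ← Real.norm_eq_abs, ofReal_norm]
  refine (enorm_integral_le_lintegral_enorm _).trans (le_of_eq ?_)
  refine lintegral_congr fun a => ?_
  simp only
  rw [← mul_sub, enorm_mul, ← ofReal_norm, ← ofReal_norm, Real.norm_eq_abs, Real.abs_exp, gap,
    Real.norm_eq_abs]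
  congr 4
  ring_nf

theorem gap_le_add_lintegral (h : IsRuinTransform r s lam e₁ e₂ m Φ) (hlam : 0 < lam)
    (hs : 0 < s) (he : e₂ < e₁) (x q : ℝ) :
    gap Φ x q ≤ {p : ℝ × ℝ | e₁ ≤ p.1 ∧ p.1 - p.2 < e₂}.indicator 1 (x, q)
      + ∫⁻ a, ENNReal.ofReal (Real.exp (-s * a.1))
        * gap Φ (Real.exp (r * a.1) * x - a.2) (Real.exp (r * a.1) * q) ∂claimLaw lam m := by
  rcases lt_or_ge x e₁ with hx | hx
  · rw [h.gap_eq_zero hx]; exact zero_le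
  · rcases lt_or_ge (x - q) e₂ with hq | hq
    · rw [indicator_of_mem (by exact ⟨hx, hq⟩)]
      exact (h.gap_le_one x q).trans le_self_add
    · exact (h.gap_le_lintegral hlam hs he hx (by linarith)).trans le_add_self

/-- Weighted integral of the gap along a line of states, in the time of the flow. -/
def gapIntegral (r k : ℝ) (Φ : ℝ × ℝ → ℝ) (x q z : ℝ) : ENNReal :=
  ∫⁻ t, ENNReal.ofReal (Real.exp (-k * t)) * gap Φ (Real.exp (r * t) * x - z) (Real.exp (r * t) * q)

theorem le_iSup_gapIntegral {k x q w : ℝ} (hw : 0 ≤ w) :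
    gapIntegral r k Φ x q w ≤ ⨆ w : Ici (0 : ℝ), gapIntegral r k Φ x q w :=
  le_iSup (fun w : Ici (0 : ℝ) => gapIntegral r k Φ x q w) ⟨w, hw⟩

omit [IsProbabilityMeasure m] in
theorem measurable_gap_comp (h : IsRuinTransform r s lam e₁ e₂ m Φ) {α : Type*}
    [MeasurableSpace α] {f g : α → ℝ} (hf : Measurable f) (hg : Measurable g) :
    Measurable (fun a => gap Φ (f a) (g a)) :=
  h.measurable_gap.comp (hf.prodMk hg)

omit [IsProbabilityMeasure m] in
-- Before the flow time log(e₁/x)/r the first coordinate is below `e₁` and the gap vanishes. The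
-- bound is uniform in `z`; this finiteness permits absorbing the supremum later.
theorem gapIntegral_le (h : IsRuinTransform r s lam e₁ e₂ m Φ) (hr : 0 < r)
    (he₁ : 0 < e₁) {k x q z : ℝ} (hx : 0 < x) (hz : 0 ≤ z) :
    gapIntegral r k Φ x q z ≤ ∫⁻ t in Ici (Real.log (e₁ / x) / r),
      ENNReal.ofReal (Real.exp (-k * t)) := by
  rw [← lintegral_indicator measurableSet_Ici]
  refine lintegral_mono fun t => ?_
  by_cases ht : t ∈ Ici (Real.log (e₁ / x) / r)
  · rw [indicator_of_mem ht]
    exact mul_le_of_le_one_right zero_le (h.gap_le_one _ _)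
  · rw [indicator_of_notMem ht, h.gap_eq_zero, mul_zero]
    rw [mem_Ici, not_le, lt_div_iff₀ hr, Real.lt_log_iff_exp_lt (by positivity), lt_div_iff₀ hx,
      mul_comm t r] at ht
    linarith

theorem lintegral_exp_Ici_lt_top {k : ℝ} (hk : 0 < k) (a : ℝ) :
    ∫⁻ t in Ici a, ENNReal.ofReal (Real.exp (-k * t)) < ⊤ := by
  rw [setLIntegral_congr Ioi_ae_eq_Ici.symm]
  exact (integrableOn_exp_neg_mul hk a).lintegral_lt_top

/-- Flow times at which the second line is ruined and the first is not. -/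
theorem lintegral_crossing_le (hr : 0 < r) {k : ℝ} (hk : 0 < k) (he : e₂ < e₁) (he₂ : 0 < e₂)
    {x q z : ℝ} (hq : 0 < q) (hqx : q < x) (hz : 0 ≤ z) :
    ∫⁻ t, ENNReal.ofReal (Real.exp (-k * t))
      * {p : ℝ × ℝ | e₁ ≤ p.1 ∧ p.1 - p.2 < e₂}.indicator (1 : ℝ × ℝ → ENNReal)
        (Real.exp (r * t) * x - z, Real.exp (r * t) * q)
      ≤ ENNReal.ofReal (Real.exp (-k * (Real.log ((e₁ - e₂) / q) / r))
        * (Real.log (x / (x - q)) / r)) := by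
  have hD : 0 < e₁ - e₂ := sub_pos.2 he
  have he₁ : 0 < e₁ := he₂.trans he
  have hx : 0 < x := hq.trans hqx
  have hxq : 0 < x - q := sub_pos.2 hqx
  set c := Real.exp (-k * (Real.log ((e₁ - e₂) / q) / r)) with hc
  set a := Real.log ((e₁ + z) / x) / r with ha
  set b := Real.log ((e₂ + z) / (x - q)) / r with hb
  have hle : ∀ t, ENNReal.ofReal (Real.exp (-k * t))
      * {p : ℝ × ℝ | e₁ ≤ p.1 ∧ p.1 - p.2 < e₂}.indicator (1 : ℝ × ℝ → ENNReal)
        (Real.exp (r * t) * x - z, Real.exp (r * t) * q)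
      ≤ (Icc a b).indicator (fun _ => ENNReal.ofReal c) t := by
    intro t
    by_cases ht : (Real.exp (r * t) * x - z, Real.exp (r * t) * q)
        ∈ {p : ℝ × ℝ | e₁ ≤ p.1 ∧ p.1 - p.2 < e₂}
    · obtain ⟨h1, h2⟩ := ht
      simp only at h1 h2
      -- The first line is solvent from time `a` on and the second is ruined before time `b`.
      have hmem : t ∈ Icc a b := by
        constructor
        · rw [ha, div_le_iff₀ hr, Real.log_le_iff_le_exp (by positivity), div_le_iff₀ hx,
            mul_comm t r]
          linarith
        · rw [hb, le_div_iff₀ hr, Real.le_log_iff_exp_le (by positivity), le_div_iff₀ hxq,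
            mul_comm t r]
          linarith
      rw [indicator_of_mem (by exact ⟨h1, h2⟩), indicator_of_mem hmem, Pi.one_apply, mul_one]
      refine ENNReal.ofReal_le_ofReal (Real.exp_le_exp.2 ?_)
      -- Subtracting the two conditions gives e^{rt}q > e₁ - e₂: the event is late, so its weight is
      -- small.
      have h3 : Real.log ((e₁ - e₂) / q) / r ≤ t := by
        rw [div_le_iff₀ hr, Real.log_le_iff_le_exp (by positivity), div_le_iff₀ hq,
          mul_comm t r]
        linarith
      nlinarith
    · rw [indicator_of_notMem ht, mul_zero]; exact zero_le
  refine (lintegral_mono hle).trans ?_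
  rw [lintegral_indicator measurableSet_Icc, setLIntegral_const, Real.volume_Icc,
    ← ENNReal.ofReal_mul (Real.exp_pos _).le]
  refine ENNReal.ofReal_le_ofReal (mul_le_mul_of_nonneg_left ?_ (Real.exp_pos _).le)
  rw [hb, ha, ← sub_div]
  refine div_le_div_of_nonneg_right ?_ hr.le
  rw [Real.log_div (by positivity) hxq.ne', Real.log_div (by positivity) hx.ne',
    Real.log_div hx.ne' hxq.ne']
  -- This makes the bound on the length b - a independent of `z`, as a supremum over shifts
  -- requires.
  have : Real.log (e₂ + z) ≤ Real.log (e₁ + z) :=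
    Real.log_le_log (by positivity) (by linarith)
  linarith

/-- Integrate the one-step inequality along the flow line. A claim of size a.2 after a wait a.1
leads to another shift of the same flow line at the flow time t + a.1. Since t runs over all of ℝ,
translation invariance applies, at the price e^{k a.1} against the discount e^{-s a.1}; hence k < s
and the factor lam/(lam + (s - k)). -/
theorem gapIntegral_le_add (h : IsRuinTransform r s lam e₁ e₂ m Φ) (hr : 0 < r) (hlam : 0 < lam)
    (hs : 0 < s) {k : ℝ} (hk : 0 < k) (hks : k < s) (he : e₂ < e₁) (he₂ : 0 < e₂)
    (hm : ∀ᵐ z ∂m, 0 ≤ z) {x q z : ℝ} (hq : 0 < q) (hqx : q < x) (hz : 0 ≤ z) :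
    gapIntegral r k Φ x q z
      ≤ ENNReal.ofReal (Real.exp (-k * (Real.log ((e₁ - e₂) / q) / r))
          * (Real.log (x / (x - q)) / r))
        + ENNReal.ofReal (lam / (lam + (s - k))) * ⨆ w : Ici (0 : ℝ), gapIntegral r k Φ x q w := by
  have : IsProbabilityMeasure (claimLaw lam m) := isProbabilityMeasure_claimLaw hlam m
  have hmeas : Measurable (fun b : ℝ × (ℝ × ℝ) => ENNReal.ofReal (Real.exp (-k * b.1))
      * (ENNReal.ofReal (Real.exp (-s * b.2.1))
        * gap Φ (Real.exp (r * b.2.1) * (Real.exp (r * b.1) * x - z) - b.2.2)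
          (Real.exp (r * b.2.1) * (Real.exp (r * b.1) * q)))) := by
    have := h.measurable_gap_comp
      (f := fun b : ℝ × (ℝ × ℝ) => Real.exp (r * b.2.1) * (Real.exp (r * b.1) * x - z) - b.2.2)
      (g := fun b => Real.exp (r * b.2.1) * (Real.exp (r * b.1) * q)) (by fun_prop) (by fun_prop)
    fun_prop
  have hmeas1 : Measurable (fun t : ℝ => ENNReal.ofReal (Real.exp (-k * t))
      * {p : ℝ × ℝ | e₁ ≤ p.1 ∧ p.1 - p.2 < e₂}.indicator (1 : ℝ × ℝ → ENNReal)
        (Real.exp (r * t) * x - z, Real.exp (r * t) * q)) := by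
    have hS : MeasurableSet {p : ℝ × ℝ | e₁ ≤ p.1 ∧ p.1 - p.2 < e₂} :=
      (measurableSet_le measurable_const measurable_fst).inter
        (measurableSet_lt (measurable_fst.sub measurable_snd) measurable_const)
    have := ((measurable_one (α := ENNReal)).indicator hS).comp
      (f := fun t : ℝ => (Real.exp (r * t) * x - z, Real.exp (r * t) * q)) (by fun_prop)
    exact Measurable.mul (by fun_prop) this
  calc gapIntegral r k Φ x q z
      ≤ ∫⁻ t, (ENNReal.ofReal (Real.exp (-k * t))
          * {p : ℝ × ℝ | e₁ ≤ p.1 ∧ p.1 - p.2 < e₂}.indicator (1 : ℝ × ℝ → ENNReal)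
            (Real.exp (r * t) * x - z, Real.exp (r * t) * q)
          + ∫⁻ a, ENNReal.ofReal (Real.exp (-k * t)) * (ENNReal.ofReal (Real.exp (-s * a.1))
            * gap Φ (Real.exp (r * a.1) * (Real.exp (r * t) * x - z) - a.2)
              (Real.exp (r * a.1) * (Real.exp (r * t) * q))) ∂claimLaw lam m) := by
        refine lintegral_mono fun t => ?_
        rw [lintegral_const_mul' _ _ ENNReal.ofReal_ne_top, ← mul_add]
        gcongr
        exact h.gap_le_add_lintegral hlam hs he _ _
    _ = _ := lintegral_add_left hmeas1 _
    _ ≤ _ := by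
        refine add_le_add (lintegral_crossing_le hr hk he he₂ hq hqx hz) ?_
        rw [lintegral_lintegral_swap hmeas.aemeasurable,
          ← lintegral_exp_claimLaw hlam (sub_pos.2 hks) m,
          ← lintegral_mul_const _ (by fun_prop)]
        refine lintegral_mono_ae ?_
        filter_upwards [ae_claimLaw_snd_nonneg hlam hm] with a ha
        -- The accumulated shift after the claim: the old one carried along the flow plus the new
        -- claim.
        have hw : 0 ≤ Real.exp (r * a.1) * z + a.2 := by positivity
        refine le_trans (le_of_eq ?_) (mul_le_mul_right (le_iSup_gapIntegral hw) _)
        have hshift : gapIntegral r k Φ x q (Real.exp (r * a.1) * z + a.2)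
            = ∫⁻ t, ENNReal.ofReal (Real.exp (-k * (t + a.1)))
              * gap Φ (Real.exp (r * (t + a.1)) * x - (Real.exp (r * a.1) * z + a.2))
                (Real.exp (r * (t + a.1)) * q) :=
          (lintegral_add_right_eq_self _ a.1).symm
        rw [hshift, ← lintegral_const_mul' _ _ ENNReal.ofReal_ne_top]
        refine lintegral_congr fun t => ?_
        have e1 : ∀ x, Real.exp (r * (t + a.1)) * x
            = Real.exp (r * a.1) * (Real.exp (r * t) * x) := by
          intro x; rw [← mul_assoc, ← Real.exp_add]; ring_nf
        rw [← mul_assoc, ← mul_assoc (ENNReal.ofReal _), ← ENNReal.ofReal_mul (Real.exp_pos _).le,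
          ← ENNReal.ofReal_mul (Real.exp_pos _).le, ← Real.exp_add, ← Real.exp_add, e1, e1]
        congr 2
        · congr 1; ring
        · ring

/-- The supremum K is finite and K ≤ b + θK with θ = lam/(lam + (s - k)) < 1; solving for K gives
the factor (lam + (s - k))/(s - k). -/
theorem iSup_gapIntegral_le (h : IsRuinTransform r s lam e₁ e₂ m Φ) (hr : 0 < r)
    (hlam : 0 < lam) (hs : 0 < s) {k : ℝ} (hk : 0 < k) (hks : k < s) (he : e₂ < e₁)
    (he₂ : 0 < e₂) (hm : ∀ᵐ z ∂m, 0 ≤ z) {x q : ℝ} (hq : 0 < q) (hqx : q < x) :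
    ⨆ w : Ici (0 : ℝ), gapIntegral r k Φ x q w
      ≤ ENNReal.ofReal ((lam + (s - k)) / (s - k)
        * (Real.exp (-k * (Real.log ((e₁ - e₂) / q) / r)) * (Real.log (x / (x - q)) / r))) := by
  set K := ⨆ w : Ici (0 : ℝ), gapIntegral r k Φ x q w with hK
  set b := Real.exp (-k * (Real.log ((e₁ - e₂) / q) / r)) * (Real.log (x / (x - q)) / r) with hb
  have hx : 0 < x := hq.trans hqx
  have hb0 : 0 ≤ b := by
    have : 0 ≤ Real.log (x / (x - q)) :=
      Real.log_nonneg ((one_le_div (sub_pos.2 hqx)).2 (by linarith))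
    positivity
  have hfin : K ≠ ⊤ := by
    refine ne_top_of_le_ne_top
      (lintegral_exp_Ici_lt_top hk (Real.log (e₁ / x) / r)).ne (iSup_le fun w => ?_)
    exact h.gapIntegral_le hr (he₂.trans he) hx w.2
  have hle : K ≤ ENNReal.ofReal b + ENNReal.ofReal (lam / (lam + (s - k))) * K :=
    iSup_le fun w => h.gapIntegral_le_add hr hlam hs hk hks he he₂ hm hq hqx w.2
  have hsk : 0 < s - k := sub_pos.2 hks
  rw [← ENNReal.ofReal_toReal hfin] at hle ⊢
  set κ := K.toReal with hκ
  have hκ0 : 0 ≤ κ := ENNReal.toReal_nonneg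
  rw [← ENNReal.ofReal_mul (by positivity), ← ENNReal.ofReal_add hb0 (by positivity),
    ENNReal.ofReal_le_ofReal_iff (by positivity)] at hle
  refine ENNReal.ofReal_le_ofReal ?_
  rw [div_mul_eq_mul_div, le_div_iff₀ hsk]
  have hpos : 0 < lam + (s - k) := by positivity
  have h1 := mul_le_mul_of_nonneg_left hle hpos.le
  have h2 : (lam + (s - k)) * (b + lam / (lam + (s - k)) * κ) = (lam + (s - k)) * b + lam * κ := by
    field_simp
  nlinarith

/-- The joint transform and the transform of the first line of business differ by `o(q)` as the
distance `q` to the states in which only the first line matters goes to `0`. -/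
theorem abs_sub_first_le (h : IsRuinTransform r s lam e₁ e₂ m Φ) (hr : 0 < r)
    (hlam : 0 < lam) (hs : 0 < s) (he : e₂ < e₁) (he₂ : 0 < e₂) (hm : ∀ᵐ z ∂m, 0 ≤ z)
    {x q : ℝ} (hx : e₁ ≤ x) (hq : 0 < q) (hqx : q ≤ x - e₂) :
    |Φ (x, x - q) - first Φ x|
      ≤ lam * ((lam + s / 2) / (s / 2)) / (r * e₂)
        * Real.exp (-(s / 2) * (Real.log ((e₁ - e₂) / q) / r)) * q := by
  -- Any rate strictly between 0 and `s` would do: k > 0 makes the exponential factor tend to 0 with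
  -- q, and k < s keeps the one-step factor below 1.
  set k := s / 2 with hk
  have hk0 : 0 < k := by positivity
  have hsk : s - k = k := by rw [hk]; ring
  have hx0 : 0 < x := he₂.trans (he.trans_le hx)
  have hxq : 0 < x - q := by linarith
  have : SFinite (expMeasure lam) := by
    have : IsProbabilityMeasure (expMeasure lam) := isProbabilityMeasure_expMeasure hlam
    infer_instance
  have hmeas : Measurable (fun a : ℝ × ℝ => ENNReal.ofReal (Real.exp (-s * a.1))
      * gap Φ (Real.exp (r * a.1) * x - a.2) (Real.exp (r * a.1) * q)) := by
    have := h.measurable_gap_comp (f := fun a : ℝ × ℝ => Real.exp (r * a.1) * x - a.2)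
      (g := fun a => Real.exp (r * a.1) * q) (by fun_prop) (by fun_prop)
    fun_prop
  -- The density of the first claim time turns a pointwise value into an integral along the flow;
  -- for t > 0 the factor e^{-(lam + s)t} is at most e^{-kt}.
  have h1 : gap Φ x q ≤ ENNReal.ofReal lam * ⨆ w : Ici (0 : ℝ), gapIntegral r k Φ x q w := by
    refine (h.gap_le_lintegral hlam hs he hx hqx).trans ?_
    rw [claimLaw, lintegral_prod_symm' _ hmeas]
    have h2 : ∀ᵐ z ∂m, ∫⁻ t, ENNReal.ofReal (Real.exp (-s * t))
        * gap Φ (Real.exp (r * t) * x - z) (Real.exp (r * t) * q) ∂expMeasure lam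
        ≤ ENNReal.ofReal lam * ⨆ w : Ici (0 : ℝ), gapIntegral r k Φ x q w := by
      filter_upwards [hm] with z hz
      refine le_trans ?_ (mul_le_mul_right (le_iSup_gapIntegral hz) _)
      have hmz : Measurable (fun t : ℝ => ENNReal.ofReal (Real.exp (-s * t))
          * gap Φ (Real.exp (r * t) * x - z) (Real.exp (r * t) * q)) :=
        hmeas.comp (f := fun t : ℝ => (t, z)) (by fun_prop)
      rw [lintegral_expMeasure lam hmz,
        gapIntegral, ← lintegral_const_mul' _ _ ENNReal.ofReal_ne_top,
        ← lintegral_indicator measurableSet_Ioi]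
      refine lintegral_mono fun t => ?_
      by_cases ht : 0 < t
      · rw [indicator_of_mem (by exact ht), ← mul_assoc, ← mul_assoc,
          ← ENNReal.ofReal_mul (by positivity), ← ENNReal.ofReal_mul hlam.le]
        refine mul_le_mul_left (ENNReal.ofReal_le_ofReal ?_) _
        rw [mul_assoc, ← Real.exp_add]
        refine mul_le_mul_of_nonneg_left (Real.exp_le_exp.2 ?_) hlam.le
        nlinarith
      · rw [indicator_of_notMem (by exact ht)]; exact zero_le
    refine (lintegral_mono_ae h2).trans ?_
    simp
  have h3 := h1.trans (mul_le_mul_right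
    (h.iSup_gapIntegral_le hr hlam hs hk0 (by linarith) he he₂ hm hq (by linarith)) _)
  rw [gap, ← ENNReal.ofReal_mul hlam.le, hsk] at h3
  have hlog0 : 0 ≤ Real.log (x / (x - q)) := Real.log_nonneg ((one_le_div hxq).2 (by linarith))
  rw [ENNReal.ofReal_le_ofReal_iff (by positivity)] at h3
  refine h3.trans ?_
  have hlog : Real.log (x / (x - q)) ≤ q / e₂ := by
    refine (Real.log_le_sub_one_of_pos (by positivity)).trans ?_
    have : x / (x - q) - 1 = q / (x - q) := by field_simp; ring
    rw [this]
    gcongr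
    linarith
  calc lam * ((lam + k) / k * (Real.exp (-k * (Real.log ((e₁ - e₂) / q) / r))
        * (Real.log (x / (x - q)) / r)))
      ≤ lam * ((lam + k) / k * (Real.exp (-k * (Real.log ((e₁ - e₂) / q) / r))
        * (q / e₂ / r))) := by gcongr
    _ = _ := by field_simp

end IsRuinTransform

/-! ### Differentiability of the transform -/

/-- R = o(l) and l = O(p - p₀), so R has derivative 0. Remainders can thus be compared with a scalar
coordinate transversal to a seam. -/
theorem differentiableWithinAt_of_abs_le {R l : ℝ × ℝ → ℝ} {S : Set (ℝ × ℝ)} {p₀ : ℝ × ℝ}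
    (hl : DifferentiableWithinAt ℝ l S p₀) (hl0 : l p₀ = 0) (hR0 : R p₀ = 0)
    (h : ∀ ε > 0, ∀ᶠ p in 𝓝[S] p₀, |R p| ≤ ε * |l p|) : DifferentiableWithinAt ℝ R S p₀ := by
  refine HasFDerivWithinAt.differentiableWithinAt (f' := 0) ?_
  rw [hasFDerivWithinAt_iff_isLittleO]
  have h1 : R =o[𝓝[S] p₀] l := Asymptotics.isLittleO_iff.2 fun ε hε => h ε hε
  have h2 : l =O[𝓝[S] p₀] fun p => p - p₀ := by
    have := hl.isBigO_sub
    simpa [hl0] using this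
  simpa [hR0] using h1.trans_isBigO h2

theorem differentiableWithinAt_comp_fst {g : ℝ → ℝ} {g' : ℝ} {p : ℝ × ℝ} (S : Set (ℝ × ℝ))
    (h : HasDerivAt g g' p.1) : DifferentiableWithinAt ℝ (fun p : ℝ × ℝ => g p.1) S p :=
  (h.differentiableAt.comp p differentiableAt_fst).differentiableWithinAt

theorem differentiableWithinAt_comp_snd {g : ℝ → ℝ} {g' : ℝ} {p : ℝ × ℝ} (S : Set (ℝ × ℝ))
    (h : HasDerivAt g g' p.2) : DifferentiableWithinAt ℝ (fun p : ℝ × ℝ => g p.2) S p :=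
  (h.differentiableAt.comp p differentiableAt_snd).differentiableWithinAt

/-- The states in which no line of business is ruined. -/
def solvent (e₁ e₂ : ℝ) : Set (ℝ × ℝ) := {p | e₁ ≤ p.1 ∧ e₂ ≤ p.2}

theorem log_div_div_nonneg {r D q : ℝ} (hr : 0 < r) (hq : 0 < q) (hqD : q ≤ D) :
    0 ≤ Real.log (D / q) / r :=
  div_nonneg (Real.log_nonneg ((one_le_div hq).2 hqD)) hr.le

theorem mul_exp_neg_log_div {r D q : ℝ} (hr : 0 < r) (hD : 0 < D) (hq : 0 < q) :
    D * Real.exp (-r * (Real.log (D / q) / r)) = q := by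
  have : -r * (Real.log (D / q) / r) = -Real.log (D / q) := by field_simp
  rw [this, Real.exp_neg, Real.exp_log (by positivity)]
  field_simp

namespace IsRuinTransform

variable {r s lam e₁ e₂ : ℝ} {m : Measure ℝ} {Φ : ℝ × ℝ → ℝ} [IsProbabilityMeasure m]
  [NullSingletonClass m]

theorem differentiableWithinAt_of_lt_crossing (h : IsRuinTransform r s lam e₁ e₂ m Φ) (hr : 0 < r)
    (hlam : 0 < lam) (hs : 0 < s) (he : e₂ < e₁) (he₂ : 0 < e₂) {p : ℝ × ℝ}
    (hp : p ∈ solvent e₁ e₂) (hq : e₁ - e₂ < p.1 - p.2) :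
    DifferentiableWithinAt ℝ Φ (solvent e₁ e₂) p := by
  have hψ := h.second_isRenewalSolution hr hlam hs he
  refine ((differentiableWithinAt_comp_snd (solvent e₁ e₂)
    (hψ.hasDerivAt_smoothExt hr hlam hs he₂
      (he₂.trans_le hp.2))).congr_of_eventuallyEq_of_mem ?_ hp)
  have : ∀ᶠ q : ℝ × ℝ in 𝓝 p, e₁ - e₂ < q.1 - q.2 :=
    (continuousAt_fst.sub continuousAt_snd).eventually (Ioi_mem_nhds hq)
  filter_upwards [mem_nhdsWithin_of_mem_nhds this, self_mem_nhdsWithin] with q h1 h2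
  rw [h.eq_second (by linarith), hψ.eq_smoothExt hr he₂ h2.2]

theorem differentiableWithinAt_of_neg (h : IsRuinTransform r s lam e₁ e₂ m Φ) (hr : 0 < r)
    (hlam : 0 < lam) (hs : 0 < s) (he : e₂ < e₁) (he₂ : 0 < e₂) {p : ℝ × ℝ}
    (hp : p ∈ solvent e₁ e₂) (hq : p.1 - p.2 < 0) :
    DifferentiableWithinAt ℝ Φ (solvent e₁ e₂) p := by
  have hψ := h.first_isRenewalSolution hlam hs he
  have he₁ := he₂.trans he
  refine ((differentiableWithinAt_comp_fst (solvent e₁ e₂)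
    (hψ.hasDerivAt_smoothExt hr hlam hs he₁
      (he₁.trans_le hp.1))).congr_of_eventuallyEq_of_mem ?_ hp)
  have : ∀ᶠ q : ℝ × ℝ in 𝓝 p, q.1 - q.2 < 0 :=
    (continuousAt_fst.sub continuousAt_snd).eventually (Iio_mem_nhds hq)
  filter_upwards [mem_nhdsWithin_of_mem_nhds this, self_mem_nhdsWithin] with q h1 h2
  rw [h.eq_first (by linarith), hψ.eq_smoothExt hr he₁ h2.1]

omit [NullSingletonClass m] in
theorem tendsto_crossing_factor (hr : 0 < r) (hs : 0 < s) {D : ℝ} (hD : 0 < D) :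
    Tendsto (fun q => Real.exp (-(s / 2) * (Real.log (D / q) / r))) (𝓝[>] 0) (𝓝 0) := by
  have h1 : Tendsto (fun q : ℝ => D / q) (𝓝[>] 0) atTop := by
    simpa [div_eq_mul_inv] using tendsto_inv_nhdsGT_zero.const_mul_atTop hD
  have h2 := (Real.tendsto_log_atTop.comp h1).atTop_div_const hr
  exact Real.tendsto_exp_atBot.comp
    (h2.const_mul_atTop_of_neg (r := -(s / 2)) (by linarith))

/-- Near the diagonal Φ is the differentiable transform of the first line plus a remainder, which is
0 on one side and o(x - y) on the other by `abs_sub_first_le`. -/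
theorem differentiableWithinAt_of_eq_zero (h : IsRuinTransform r s lam e₁ e₂ m Φ) (hr : 0 < r)
    (hlam : 0 < lam) (hs : 0 < s) (he : e₂ < e₁) (he₂ : 0 < e₂) (hm : ∀ᵐ z ∂m, 0 ≤ z)
    {p : ℝ × ℝ} (hp : p ∈ solvent e₁ e₂) (hq : p.1 - p.2 = 0) :
    DifferentiableWithinAt ℝ Φ (solvent e₁ e₂) p := by
  have hψ := h.first_isRenewalSolution hlam hs he
  have he₁ := he₂.trans he
  have hD : 0 < e₁ - e₂ := sub_pos.2 he
  have hl : DifferentiableWithinAt ℝ (fun p : ℝ × ℝ => p.1 - p.2) (solvent e₁ e₂) p := by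
    fun_prop
  have hR : DifferentiableWithinAt ℝ (fun p => Φ p - first Φ p.1) (solvent e₁ e₂) p := by
    refine differentiableWithinAt_of_abs_le hl hq ?_ ?_
    · rw [h.eq_first (by linarith), sub_self]
    · intro ε hε
      set C := lam * ((lam + s / 2) / (s / 2)) / (r * e₂) with hC
      have hlim := (tendsto_crossing_factor (r := r) (s := s) hr hs hD).const_mul C
      rw [mul_zero] at hlim
      have hev : ∀ᶠ q in 𝓝 (0 : ℝ), q ∈ Ioi (0 : ℝ) →
          C * Real.exp (-(s / 2) * (Real.log ((e₁ - e₂) / q) / r)) < ε :=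
        eventually_nhdsWithin_iff.1 (hlim.eventually (Iio_mem_nhds hε))
      have hcont : Tendsto (fun p : ℝ × ℝ => p.1 - p.2) (𝓝 p) (𝓝 0) := by
        have : ContinuousAt (fun p : ℝ × ℝ => p.1 - p.2) p := by fun_prop
        rwa [ContinuousAt, hq] at this
      filter_upwards [mem_nhdsWithin_of_mem_nhds (hcont.eventually hev), self_mem_nhdsWithin]
        with p' h1 h2
      rcases le_or_gt (p'.1 - p'.2) 0 with h3 | h3
      · rw [h.eq_first (by linarith), sub_self, abs_zero]; positivity
      · have h4 := h.abs_sub_first_le hr hlam hs he he₂ hm h2.1 h3 (by linarith [h2.2])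
        rw [show (p'.1, p'.1 - (p'.1 - p'.2)) = p' by ext <;> simp] at h4
        refine h4.trans ?_
        rw [abs_of_pos h3]
        exact mul_le_mul_of_nonneg_right (h1 h3).le h3.le
  have h1 := (differentiableWithinAt_comp_fst (solvent e₁ e₂)
    (hψ.hasDerivAt_smoothExt hr hlam hs he₁ (he₁.trans_le hp.1))).add hR
  refine (h1.congr_of_eventuallyEq_of_mem ?_ hp)
  filter_upwards [self_mem_nhdsWithin] with q hq
  simp only [Pi.add_apply]
  rw [← hψ.eq_smoothExt hr he₁ hq.1]
  ring

/-- The remainder after subtracting the second line's transform is 0 for x - y ≥ D. Below, its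
τ-derivative at fixed x is continuous and vanishes at τ = 0, so the mean value inequality makes it
o(τ), and τ is at most a constant times D - (x - y). -/
theorem differentiableWithinAt_of_eq_crossing (h : IsRuinTransform r s lam e₁ e₂ m Φ) (hr : 0 < r)
    (hlam : 0 < lam) (hs : 0 < s) (he : e₂ < e₁) (he₂ : 0 < e₂)
    {p : ℝ × ℝ} (hp : p ∈ solvent e₁ e₂) (hq : p.1 - p.2 = e₁ - e₂) :
    DifferentiableWithinAt ℝ Φ (solvent e₁ e₂) p := by
  have hψ := h.second_isRenewalSolution hr hlam hs he
  obtain ⟨V, hVc, hV0, hV⟩ := h.exists_crossing_derivative hr hlam hs he he₂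
  set D := e₁ - e₂ with hDdef
  have hD : 0 < D := sub_pos.2 he
  set ψ := second D Φ with hψdef
  have hl : DifferentiableWithinAt ℝ (fun p : ℝ × ℝ => p.1 - p.2 - D) (solvent e₁ e₂) p := by
    fun_prop
  have hR : DifferentiableWithinAt ℝ (fun p => Φ p - ψ p.2) (solvent e₁ e₂) p := by
    refine differentiableWithinAt_of_abs_le hl (by rw [hq, sub_self]) ?_ ?_
    · rw [h.eq_second (by linarith), sub_self]
    · intro ε hε
      -- Calibrated so that ε'τ ≤ ε(D - q), using log(D/q) ≤ (D - q)/(D/2) for q > D/2.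
      set ε' := ε * (r * (D / 2)) with hε'
      have hε'0 : 0 < ε' := by positivity
      set J : ℝ × ℝ → ℝ := fun b => V b - r * D * Real.exp (-r * b.2)
        * IsRenewalSolution.slope r s lam m ψ (b.1 - D * Real.exp (-r * b.2)) with hJ
      have hJ0 : J (p.1, 0) = 0 := by
        simp only [hJ, hV0 p.1 hp.1, mul_zero, Real.exp_zero, mul_one, sub_self]
      have hJc : ContinuousAt J (p.1, 0) := by
        have h1 : ContinuousAt (fun b : ℝ × ℝ => IsRenewalSolution.slope r s lam m ψ
            (b.1 - D * Real.exp (-r * b.2))) (p.1, 0) := by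
          refine ContinuousAt.comp (g := IsRenewalSolution.slope r s lam m ψ)
            (f := fun b : ℝ × ℝ => b.1 - D * Real.exp (-r * b.2))
            (hψ.continuousAt_slope hr hlam hs he₂ ?_) (by fun_prop)
          have := hp.1
          simp only [mul_zero, Real.exp_zero, mul_one]
          linarith
        have h2 := hVc.continuousAt (x := (p.1, (0 : ℝ)))
        fun_prop
      have hev : ∀ᶠ b in 𝓝 (p.1, (0 : ℝ)), |J b| < ε' := by
        have := hJc.abs
        rw [ContinuousAt, hJ0, abs_zero] at this
        exact this.eventually (Iio_mem_nhds hε'0)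
      rw [nhds_prod_eq] at hev
      obtain ⟨pa, hpa, pb, hpb, hab⟩ := eventually_prod_iff.1 hev
      obtain ⟨η, hη, hpbη⟩ := Metric.eventually_nhds_iff.1 hpb
      have hτc : ContinuousAt (fun p : ℝ × ℝ => Real.log (D / (p.1 - p.2)) / r) p := by
        have h1 : p.1 - p.2 ≠ 0 := by rw [hq]; exact hD.ne'
        have h2 : D / (p.1 - p.2) ≠ 0 := by rw [hq, div_self hD.ne']; norm_num
        have h3 : ContinuousAt (fun p : ℝ × ℝ => D / (p.1 - p.2)) p :=
          ContinuousAt.div (by fun_prop) (by fun_prop) h1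
        exact (h3.log h2).div_const r
      have hτ0 : ∀ᶠ p' in 𝓝 p, Real.log (D / (p'.1 - p'.2)) / r < η := by
        rw [ContinuousAt, hq, div_self hD.ne', Real.log_one, zero_div] at hτc
        exact hτc.eventually (Iio_mem_nhds hη)
      have hq2 : ∀ᶠ p' : ℝ × ℝ in 𝓝 p, D / 2 < p'.1 - p'.2 :=
        (continuousAt_fst.sub continuousAt_snd).eventually
          (Ioi_mem_nhds (show D / 2 < p.1 - p.2 by rw [hq]; linarith))
      filter_upwards [mem_nhdsWithin_of_mem_nhds hτ0, mem_nhdsWithin_of_mem_nhds hq2,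
        mem_nhdsWithin_of_mem_nhds (continuousAt_fst.eventually hpa), self_mem_nhdsWithin]
        with p' h1 h2 h3 h4
      rcases le_or_gt D (p'.1 - p'.2) with h5 | h5
      · rw [h.eq_second (by linarith), sub_self, abs_zero]; positivity
      · set x := p'.1
        set q := p'.1 - p'.2 with hqdef
        set τ := Real.log (D / q) / r with hτdef
        have hq0 : 0 < q := by linarith
        have hτ : 0 ≤ τ := log_div_div_nonneg hr hq0 h5.le
        have hqτ : D * Real.exp (-r * τ) = q := mul_exp_neg_log_div hr hD hq0
        have hpos : ∀ σ : ℝ, 0 ≤ σ → e₂ ≤ x - D * Real.exp (-r * σ) := by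
          intro σ hσ
          have : Real.exp (-r * σ) ≤ 1 := by rw [Real.exp_le_one_iff]; nlinarith
          have := h4.1
          nlinarith
        have hder : ∀ σ ∈ Icc 0 τ, HasDerivWithinAt
            (fun σ => (ψ (x - D) + ∫ u in (0 : ℝ)..σ, V (x, u))
              - smoothExt r s lam m ψ (x - D * Real.exp (-r * σ))) (J (x, σ)) (Icc 0 τ) σ := by
          intro σ hσ
          have hVx : Continuous fun u => V (x, u) := by fun_prop
          have d1 := (hVx.integral_hasStrictDerivAt 0 σ).hasDerivAt.const_add (ψ (x - D))
          have d2 : HasDerivAt (fun σ => x - D * Real.exp (-r * σ))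
              (-(D * (Real.exp (-r * σ) * -r))) σ := by
            simpa using (((hasDerivAt_id σ).const_mul (-r)).exp.const_mul D).const_sub x
          have d3 := (hψ.hasDerivAt_smoothExt hr hlam hs he₂
            (he₂.trans_le (hpos σ hσ.1))).comp σ d2
          refine ((d1.sub d3).congr_deriv ?_).hasDerivWithinAt
          simp only [hJ, IsRenewalSolution.slope]
          ring
        have hb : ∀ σ ∈ Ico 0 τ, ‖J (x, σ)‖ ≤ ε' := by
          intro σ hσ
          refine (hab h3 (hpbη ?_)).le
          rw [Real.dist_eq, sub_zero, abs_of_nonneg hσ.1]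
          exact hσ.2.trans h1
        have hmv := norm_image_sub_le_of_norm_deriv_le_segment' hder hb τ ⟨hτ, le_rfl⟩
        simp only [mul_zero, Real.exp_zero, mul_one, intervalIntegral.integral_same, add_zero,
          sub_zero] at hmv
        rw [← hV x τ h4.1 hτ, hqτ, ← hψ.eq_smoothExt hr he₂ (y := x - D) (by linarith [h4.1]), sub_self,
          sub_zero, show x - q = p'.2 by rw [hqdef]; ring,
          ← hψ.eq_smoothExt hr he₂ (y := p'.2) h4.2, Real.norm_eq_abs] at hmv
        refine hmv.trans ?_
        have hlog : Real.log (D / q) ≤ (D - q) / (D / 2) := by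
          refine (Real.log_le_sub_one_of_pos (by positivity)).trans ?_
          rw [show D / q - 1 = (D - q) / q by field_simp]
          exact div_le_div_of_nonneg_left (by linarith) (by positivity) h2.le
        rw [abs_sub_comm, abs_of_pos (by linarith : 0 < D - q), hτdef, hε']
        calc ε * (r * (D / 2)) * (Real.log (D / q) / r)
            ≤ ε * (r * (D / 2)) * ((D - q) / (D / 2) / r) := by gcongr
          _ = ε * (D - q) := by field_simp
  have h1 := (differentiableWithinAt_comp_snd (solvent e₁ e₂)
    (hψ.hasDerivAt_smoothExt hr hlam hs he₂ (he₂.trans_le hp.2))).add hR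
  refine (h1.congr_of_eventuallyEq_of_mem ?_ hp)
  filter_upwards [self_mem_nhdsWithin] with q hq
  simp only [Pi.add_apply]
  rw [← hψ.eq_smoothExt hr he₂ hq.2]
  ring

/-- Continuity comes before differentiability here: the derivative along the flow needs a continuous
`afterClaim`, which in turn rests on continuity of Φ in all solvent states. -/
theorem continuousWithinAt_of_between (h : IsRuinTransform r s lam e₁ e₂ m Φ) (hr : 0 < r)
    (hlam : 0 < lam) (hs : 0 < s) (he : e₂ < e₁) (he₂ : 0 < e₂)
    {p : ℝ × ℝ} (hp : p ∈ solvent e₁ e₂) (hq0 : 0 < p.1 - p.2) (hq : p.1 - p.2 < e₁ - e₂) :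
    ContinuousWithinAt Φ (solvent e₁ e₂) p := by
  have hψ := h.second_isRenewalSolution hr hlam hs he
  obtain ⟨V, hVc, -, hV⟩ := h.exists_crossing_derivative hr hlam hs he he₂
  set D := e₁ - e₂ with hDdef
  have hD : 0 < D := sub_pos.2 he
  set ψ := second D Φ with hψdef
  have h1 : ContinuousAt (fun p : ℝ × ℝ => smoothExt r s lam m ψ (p.1 - D)) p := by
    refine ContinuousAt.comp (g := smoothExt r s lam m ψ) (f := fun p : ℝ × ℝ => p.1 - D)
      (hψ.continuousAt_smoothExt hlam hs ?_) (by fun_prop)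
    have := hp.1
    linarith
  have h2 : Continuous (fun b : ℝ × ℝ => ∫ σ in (0 : ℝ)..b.2, V (b.1, σ)) := by
    refine intervalIntegral.continuous_parametric_intervalIntegral_of_continuous
      (f := fun q : ℝ × ℝ => fun σ => V (q.1, σ)) ?_ continuous_snd
    exact hVc.comp (f := fun a : (ℝ × ℝ) × ℝ => (a.1.1, a.2)) (by fun_prop)
  have h3 : ContinuousAt (fun p : ℝ × ℝ => (p.1, Real.log (D / (p.1 - p.2)) / r)) p := by
    have h5 : D / (p.1 - p.2) ≠ 0 := by positivity
    have h6 : ContinuousAt (fun p : ℝ × ℝ => D / (p.1 - p.2)) p :=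
      ContinuousAt.div (by fun_prop) (by fun_prop) hq0.ne'
    exact continuousAt_fst.prodMk ((h6.log h5).div_const r)
  have h4 := h1.add (ContinuousAt.comp (g := fun b : ℝ × ℝ => ∫ σ in (0 : ℝ)..b.2, V (b.1, σ))
    h2.continuousAt h3)
  refine h4.continuousWithinAt.congr_of_eventuallyEq_of_mem ?_ hp
  have hev : ∀ᶠ p' : ℝ × ℝ in 𝓝 p, p'.1 - p'.2 ∈ Ioo 0 D :=
    (continuousAt_fst.sub continuousAt_snd).eventually (Ioo_mem_nhds hq0 hq)
  filter_upwards [mem_nhdsWithin_of_mem_nhds hev, self_mem_nhdsWithin] with p' h5 h6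
  have h7 := hV p'.1 _ h6.1 (log_div_div_nonneg hr h5.1 h5.2.le)
  rw [mul_exp_neg_log_div hr hD h5.1, sub_sub_cancel, Prod.mk.eta,
    hψ.eq_smoothExt hr he₂ (by linarith [h6.1])] at h7
  exact h7

theorem continuousOn_solvent (h : IsRuinTransform r s lam e₁ e₂ m Φ) (hr : 0 < r)
    (hlam : 0 < lam) (hs : 0 < s) (he : e₂ < e₁) (he₂ : 0 < e₂) (hm : ∀ᵐ z ∂m, 0 ≤ z) :
    ContinuousOn Φ (solvent e₁ e₂) := by
  intro p hp
  rcases lt_trichotomy (p.1 - p.2) 0 with h1 | h1 | h1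
  · exact (h.differentiableWithinAt_of_neg hr hlam hs he he₂ hp h1).continuousWithinAt
  · exact (h.differentiableWithinAt_of_eq_zero hr hlam hs he he₂ hm hp h1).continuousWithinAt
  · rcases lt_trichotomy (p.1 - p.2) (e₁ - e₂) with h2 | h2 | h2
    · exact h.continuousWithinAt_of_between hr hlam hs he he₂ hp h1 h2
    · exact (h.differentiableWithinAt_of_eq_crossing hr hlam hs he he₂ hp h2).continuousWithinAt
    · exact (h.differentiableWithinAt_of_lt_crossing hr hlam hs he he₂ hp h2).continuousWithinAt

/-- Φ is continuous on the solvent states and equals 1 outside, so it can jump only on the lines x =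
e₁ and y = e₂, each of which a claim hits with probability 0. -/
theorem continuous_afterClaim (h : IsRuinTransform r s lam e₁ e₂ m Φ) (hr : 0 < r)
    (hlam : 0 < lam) (hs : 0 < s) (he : e₂ < e₁) (he₂ : 0 < e₂) (hm : ∀ᵐ z ∂m, 0 ≤ z) :
    Continuous (afterClaim m Φ) := by
  refine continuous_iff_continuousAt.2 fun p => ?_
  refine continuousAt_afterClaim m h.measurable h.abs_le_one ?_
  filter_upwards [ae_sub_ne m p.1 e₁, ae_sub_ne m p.2 e₂] with z h1 h2
  by_cases h3 : (p.1 - z < e₁) ∨ (p.2 - z < e₂)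
  · refine (continuousAt_const (y := (1 : ℝ))).congr ?_
    have : ∀ᶠ q : ℝ × ℝ in 𝓝 (p.1 - z, p.2 - z), q.1 < e₁ ∨ q.2 < e₂ := by
      rcases h3 with h3 | h3
      · filter_upwards [continuousAt_fst.eventually (Iio_mem_nhds h3)] with q hq
        exact Or.inl hq
      · filter_upwards [continuousAt_snd.eventually (Iio_mem_nhds h3)] with q hq
        exact Or.inr hq
    filter_upwards [this] with q hq
    exact (h.ruined q hq).symm
  · push Not at h3
    refine (h.continuousOn_solvent hr hlam hs he he₂ hm _ h3).continuousAt ?_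
    have h4 : Ioi e₁ ×ˢ Ioi e₂ ∈ 𝓝 (p.1 - z, p.2 - z) :=
      prod_mem_nhds (Ioi_mem_nhds (lt_of_le_of_ne h3.1 h1.symm))
        (Ioi_mem_nhds (lt_of_le_of_ne h3.2 h2.symm))
    exact mem_of_superset h4 fun q hq => ⟨le_of_lt hq.1, le_of_lt hq.2⟩

/-- The right hand side of the renewal equation along the flow line through `p`. -/
def alongFlow (r s lam : ℝ) (m : Measure ℝ) (Φ : ℝ × ℝ → ℝ) (p : ℝ × ℝ) (a : ℝ) : ℝ :=
  discounted lam (lam + s)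
    (fun t => afterClaim m Φ (Real.exp (r * t) * p.1, Real.exp (r * t) * p.2)) a

omit [NullSingletonClass m] in
theorem alongFlow_eq (h : IsRuinTransform r s lam e₁ e₂ m Φ) (hlam : 0 < lam) (hs : 0 < s)
    {p : ℝ × ℝ} {a : ℝ}
    (hp : (Real.exp (r * a) * p.1, Real.exp (r * a) * p.2) ∈ solvent e₁ e₂) :
    alongFlow r s lam m Φ p a = Φ (Real.exp (r * a) * p.1, Real.exp (r * a) * p.2) := by
  rw [h.eq_discounted hlam hs hp.1 hp.2, discounted_comp_flow (afterClaim m Φ) p a]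
  rfl

/-- The renewal integral makes sense for negative flow times too, so the derivative is two-sided
even where the backward flow leaves the solvent states. -/
theorem hasDerivAt_alongFlow (h : IsRuinTransform r s lam e₁ e₂ m Φ) (hr : 0 < r)
    (hlam : 0 < lam) (hs : 0 < s) (he : e₂ < e₁) (he₂ : 0 < e₂) (hm : ∀ᵐ z ∂m, 0 ≤ z)
    {p : ℝ × ℝ} (hp : p ∈ solvent e₁ e₂) :
    HasDerivAt (alongFlow r s lam m Φ p) ((lam + s) * Φ p - lam * afterClaim m Φ p) 0 := by
  have hc := h.continuous_afterClaim hr hlam hs he he₂ hm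
  have h1 := hasDerivAt_discounted (lam := lam) (k := lam + s) (C := 1) (a := 0)
    (B := fun t => afterClaim m Φ (Real.exp (r * t) * p.1, Real.exp (r * t) * p.2))
    (by linarith) (Continuous.measurable (by fun_prop))
    (fun t => abs_afterClaim_le m h.abs_le_one _) (by fun_prop)
  have h2 : alongFlow r s lam m Φ p 0 = Φ p := by
    rw [h.alongFlow_eq hlam hs (by simpa using hp)]; simp
  refine h1.congr_deriv ?_
  rw [← h2]
  simp [alongFlow]

/-- Go from p to p' first along the ray through p, a flow line, up to the abscissa of p', then
vertically. The ray part is differentiable by `hasDerivAt_alongFlow`; the vertical part is the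
integral of `V` between two values of τ, and joint continuity of `V` linearises it. -/
theorem differentiableWithinAt_of_between (h : IsRuinTransform r s lam e₁ e₂ m Φ) (hr : 0 < r)
    (hlam : 0 < lam) (hs : 0 < s) (he : e₂ < e₁) (he₂ : 0 < e₂) (hm : ∀ᵐ z ∂m, 0 ≤ z)
    {p : ℝ × ℝ} (hp : p ∈ solvent e₁ e₂) (hq0 : 0 < p.1 - p.2) (hq : p.1 - p.2 < e₁ - e₂) :
    DifferentiableWithinAt ℝ Φ (solvent e₁ e₂) p := by
  obtain ⟨V, hVc, -, hV⟩ := h.exists_crossing_derivative hr hlam hs he he₂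
  set D := e₁ - e₂ with hDdef
  have hD : 0 < D := sub_pos.2 he
  have hx : 0 < p.1 := (he₂.trans he).trans_le hp.1
  set q₀ := p.1 - p.2 with hq₀
  set τ₁ : ℝ × ℝ → ℝ := fun p' => Real.log (D / (p'.1 - p'.2)) / r with hτ₁
  -- `τ₂` is the time to the crossing from the point of the ray with abscissa p'.1, `τ₁` that from
  -- p' itself.
  set τ₂ : ℝ × ℝ → ℝ := fun p' => Real.log (D / (q₀ * (p'.1 / p.1))) / r with hτ₂
  set l : ℝ × ℝ → ℝ := fun p' => τ₁ p' - τ₂ p' with hl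
  have hg : ∀ q, 0 < q → DifferentiableAt ℝ (fun q => Real.log (D / q) / r) q := by
    intro q hq
    have h1 : DifferentiableAt ℝ (fun q => D / q) q :=
      (differentiableAt_const D).fun_div differentiableAt_id hq.ne'
    exact (h1.log (by positivity)).div_const r
  have hτ₁d : DifferentiableAt ℝ τ₁ p :=
    DifferentiableAt.comp p (f := fun p' : ℝ × ℝ => p'.1 - p'.2) (hg _ hq0) (by fun_prop)
  have hq₀x : q₀ * (p.1 / p.1) = q₀ := by field_simp
  have hτ₂d : DifferentiableAt ℝ τ₂ p :=
    DifferentiableAt.comp p (f := fun p' : ℝ × ℝ => q₀ * (p'.1 / p.1)) (hg _ (by positivity))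
      (by fun_prop)
  have hτ0 : τ₂ p = τ₁ p := by simp only [hτ₁, hτ₂, hq₀x]; rfl
  have hl0 : l p = 0 := by simp only [hl, hτ0, sub_self]
  have hld : DifferentiableWithinAt ℝ l (solvent e₁ e₂) p :=
    (hτ₁d.sub hτ₂d).differentiableWithinAt
  set V₀ := V (p.1, τ₁ p) with hV₀
  set T : ℝ × ℝ → ℝ := fun p' => Φ p' - Φ (p'.1, p'.1 - q₀ * (p'.1 / p.1)) with hT
  have hTp : T p = 0 := by
    have : p.1 - q₀ = p.2 := sub_sub_cancel _ _
    simp only [hT, hq₀x, this, Prod.mk.eta, sub_self]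
  have hev1 : ∀ᶠ p' : ℝ × ℝ in 𝓝 p, p'.1 - p'.2 ∈ Ioo 0 D :=
    (continuousAt_fst.sub continuousAt_snd).eventually (Ioo_mem_nhds hq0 hq)
  have hev2 : ∀ᶠ p' : ℝ × ℝ in 𝓝 p, q₀ * (p'.1 / p.1) ∈ Ioo 0 D := by
    have : ContinuousAt (fun p' : ℝ × ℝ => q₀ * (p'.1 / p.1)) p := by fun_prop
    refine this.eventually ?_
    simp only [hq₀x]
    exact Ioo_mem_nhds hq0 hq
  have hR : DifferentiableWithinAt ℝ (fun p' => T p' - V₀ * l p') (solvent e₁ e₂) p := by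
    refine differentiableWithinAt_of_abs_le hld hl0 (by rw [hTp, hl0]; simp) ?_
    intro ε hε
    have hVc0 : ContinuousAt (fun b => V b - V₀) (p.1, τ₁ p) := by fun_prop
    have hev : ∀ᶠ b in 𝓝 (p.1, τ₁ p), |V b - V₀| < ε := by
      have := hVc0.abs
      rw [ContinuousAt, hV₀, sub_self, abs_zero] at this
      exact this.eventually (Iio_mem_nhds hε)
    rw [nhds_prod_eq] at hev
    obtain ⟨pa, hpa, pb, hpb, hab⟩ := eventually_prod_iff.1 hev
    obtain ⟨η, hη, hpbη⟩ := Metric.eventually_nhds_iff.1 hpb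
    have h1 : ∀ᶠ p' in 𝓝 p, τ₁ p' ∈ Metric.ball (τ₁ p) η :=
      hτ₁d.continuousAt.eventually (Metric.ball_mem_nhds _ hη)
    have h2 : ∀ᶠ p' in 𝓝 p, τ₂ p' ∈ Metric.ball (τ₁ p) η := by
      refine hτ₂d.continuousAt.eventually ?_
      rw [hτ0]
      exact Metric.ball_mem_nhds _ hη
    filter_upwards [mem_nhdsWithin_of_mem_nhds h1, mem_nhdsWithin_of_mem_nhds h2,
      mem_nhdsWithin_of_mem_nhds hev1, mem_nhdsWithin_of_mem_nhds hev2,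
      mem_nhdsWithin_of_mem_nhds (continuousAt_fst.eventually hpa), self_mem_nhdsWithin]
      with p' h1 h2 h3 h4 h5 h6
    have e1 := hV p'.1 _ h6.1 (log_div_div_nonneg hr h3.1 h3.2.le)
    have e2 := hV p'.1 _ h6.1 (log_div_div_nonneg hr h4.1 h4.2.le)
    rw [mul_exp_neg_log_div hr hD h3.1, sub_sub_cancel, Prod.mk.eta] at e1
    rw [mul_exp_neg_log_div hr hD h4.1] at e2
    have hVx : Continuous fun u => V (p'.1, u) := by fun_prop
    have e3 : T p' = ∫ σ in (τ₂ p')..(τ₁ p'), V (p'.1, σ) := by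
      rw [hT]
      simp only
      rw [e1, e2, add_sub_add_left_eq_sub]
      exact intervalIntegral.integral_interval_sub_left
        (hVx.intervalIntegrable 0 _) (hVx.intervalIntegrable 0 _)
    have e4 : T p' - V₀ * l p' = ∫ σ in (τ₂ p')..(τ₁ p'), (V (p'.1, σ) - V₀) := by
      rw [intervalIntegral.integral_sub (hVx.intervalIntegrable _ _)
        intervalIntegrable_const, ← e3, intervalIntegral.integral_const, smul_eq_mul]
      simp only [hl]
      ring
    rw [e4]
    refine intervalIntegral.norm_integral_le_of_norm_le_const
      (f := fun σ => V (p'.1, σ) - V₀) fun σ hσ => (hab h5 (hpbη ?_)).le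
    have : Set.uIcc (τ₂ p') (τ₁ p') ⊆ Metric.ball (τ₁ p) η :=
      (convex_ball (τ₁ p) η).ordConnected.uIcc_subset h2 h1
    exact this (uIoc_subset_uIcc hσ)
  have hray : DifferentiableWithinAt ℝ (fun p' : ℝ × ℝ =>
      alongFlow r s lam m Φ p (Real.log (p'.1 / p.1) / r)) (solvent e₁ e₂) p := by
    have d1 :=
      (((hasDerivAt_id p.1).div_const p.1).log (by simp [hx.ne'])).div_const r
    have d2 := h.hasDerivAt_alongFlow hr hlam hs he he₂ hm hp
    have h0 : Real.log (p.1 / p.1) / r = 0 := by rw [div_self hx.ne']; simp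
    rw [← h0] at d2
    exact differentiableWithinAt_comp_fst _ (d2.comp p.1 d1)
  have hsum := (hray.add hR).add (hld.const_mul V₀)
  refine (hsum.congr_of_eventuallyEq_of_mem ?_ hp)
  filter_upwards [mem_nhdsWithin_of_mem_nhds hev2, self_mem_nhdsWithin] with p' h4 h6
  have hx' : 0 < p'.1 := (he₂.trans he).trans_le h6.1
  have hexp : Real.exp (r * (Real.log (p'.1 / p.1) / r)) = p'.1 / p.1 := by
    rw [mul_div_cancel₀ _ hr.ne', Real.exp_log (by positivity)]
  have e1 : Real.exp (r * (Real.log (p'.1 / p.1) / r)) * p.1 = p'.1 := by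
    rw [hexp]; field_simp
  have e2 : Real.exp (r * (Real.log (p'.1 / p.1) / r)) * p.2 = p'.1 - q₀ * (p'.1 / p.1) := by
    rw [hexp, hq₀]; field_simp; ring
  have e3 : alongFlow r s lam m Φ p (Real.log (p'.1 / p.1) / r)
      = Φ (p'.1, p'.1 - q₀ * (p'.1 / p.1)) := by
    rw [h.alongFlow_eq hlam hs, e1, e2]
    rw [e1, e2]
    exact ⟨h6.1, by have := h6.1; have := h4.2; simp only; linarith⟩
  simp only [Pi.add_apply, e3, hT]
  ring

theorem differentiableWithinAt (h : IsRuinTransform r s lam e₁ e₂ m Φ) (hr : 0 < r)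
    (hlam : 0 < lam) (hs : 0 < s) (he : e₂ < e₁) (he₂ : 0 < e₂) (hm : ∀ᵐ z ∂m, 0 ≤ z)
    {p : ℝ × ℝ} (hp : p ∈ solvent e₁ e₂) : DifferentiableWithinAt ℝ Φ (solvent e₁ e₂) p := by
  rcases lt_trichotomy (p.1 - p.2) 0 with h1 | h1 | h1
  · exact h.differentiableWithinAt_of_neg hr hlam hs he he₂ hp h1
  · exact h.differentiableWithinAt_of_eq_zero hr hlam hs he he₂ hm hp h1
  · rcases lt_trichotomy (p.1 - p.2) (e₁ - e₂) with h2 | h2 | h2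
    · exact h.differentiableWithinAt_of_between hr hlam hs he he₂ hm hp h1 h2
    · exact h.differentiableWithinAt_of_eq_crossing hr hlam hs he he₂ hp h2
    · exact h.differentiableWithinAt_of_lt_crossing hr hlam hs he he₂ hp h2

end IsRuinTransform

/-! ### Uniqueness of bounded solutions -/

/-- The reserves at time `t` if there are no claims. -/
def claimFree (r c₁ c₂ : ℝ) (u : ℝ × ℝ) (t : ℝ) : ℝ × ℝ :=
  (Real.exp (r * t) * (u.1 + c₁ / r) - c₁ / r, Real.exp (r * t) * (u.2 + c₂ / r) - c₂ / r)

theorem hasDerivAt_claimFree (r c₁ c₂ : ℝ) (u : ℝ × ℝ) (t : ℝ) :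
    HasDerivAt (claimFree r c₁ c₂ u)
      (r * ((claimFree r c₁ c₂ u t).1 + c₁ / r), r * ((claimFree r c₁ c₂ u t).2 + c₂ / r)) t := by
  have h : ∀ x c : ℝ, HasDerivAt (fun t => Real.exp (r * t) * (x + c / r) - c / r)
      (r * (Real.exp (r * t) * (x + c / r) - c / r + c / r)) t := by
    intro x c
    have h1 := (((hasDerivAt_id t).const_mul r).exp.mul_const (x + c / r)).sub_const (c / r)
    refine h1.congr_deriv ?_
    simp only [id]
    ring
  exact (h u.1 c₁).prodMk (h u.2 c₂)

theorem claimFree_zero (r c₁ c₂ : ℝ) (u : ℝ × ℝ) : claimFree r c₁ c₂ u 0 = u := by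
  simp [claimFree]

section

variable {r lam s c₁ c₂ δ₁ δ₂ : ℝ} {f : ℝ → ℝ} {b : ℝ → ℝ} {g g₁ g₂ : ℝ × ℝ → ℝ}

theorem claimFree_mem_quadrant (hr : 0 < r) (hc₁ : 0 < c₁) (hc₂ : 0 < c₂) {u : ℝ × ℝ}
    (hu : u ∈ quadrant) {t : ℝ} (ht : 0 ≤ t) : claimFree r c₁ c₂ u t ∈ quadrant := by
  have h : ∀ x c : ℝ, 0 ≤ x → 0 < c → 0 ≤ Real.exp (r * t) * (x + c / r) - c / r := by
    intro x c hx hc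
    have h1 : 1 ≤ Real.exp (r * t) := Real.one_le_exp (by positivity)
    have h2 : 0 < c / r := by positivity
    nlinarith
  exact ⟨h _ _ hu.1 hc₁, h _ _ hu.2 hc₂⟩

/-- Distance to the states in which the first line is always the worse one. -/
def lead (r c₁ c₂ δ₁ δ₂ : ℝ) (u : ℝ × ℝ) : ℝ :=
  (u.1 / δ₁ + c₁ / (r * δ₁)) - (u.2 / δ₂ + c₂ / (r * δ₂))

theorem mem_region_iff_lead (u : ℝ × ℝ) :
    u ∈ region δ₁ δ₂ ↔ lead r c₁ c₂ δ₁ δ₂ u ≤ c₁ / (r * δ₁) - c₂ / (r * δ₂) := by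
  simp only [region, lead, mem_ofPred_eq]
  constructor <;> intro h <;> linarith

theorem lead_claimFree (hr : 0 < r) (hδ₁ : 0 < δ₁) (hδ₂ : 0 < δ₂) (u : ℝ × ℝ) (t : ℝ) :
    lead r c₁ c₂ δ₁ δ₂ (claimFree r c₁ c₂ u t)
      = Real.exp (r * t) * lead r c₁ c₂ δ₁ δ₂ u := by
  simp only [lead, claimFree]
  field_simp
  ring

theorem lead_sub (hδ₁ : 0 < δ₁) (hδ₂ : 0 < δ₂) (u : ℝ × ℝ) (z : ℝ) :
    lead r c₁ c₂ δ₁ δ₂ (u.1 - δ₁ * z, u.2 - δ₂ * z) = lead r c₁ c₂ δ₁ δ₂ u := by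
  simp only [lead]
  field_simp
  ring

theorem sub_mem_region (hδ₁ : 0 < δ₁) (hδ₂ : 0 < δ₂) {u : ℝ × ℝ} (hu : u ∈ region δ₁ δ₂)
    (z : ℝ) : (u.1 - δ₁ * z, u.2 - δ₂ * z) ∈ region δ₁ δ₂ := by
  -- Without premiums `lead` is u₁/δ₁ - u₂/δ₂, which claims preserve; r = 1 is arbitrary.
  rw [mem_region_iff_lead (r := 1) (c₁ := 0) (c₂ := 0)] at hu ⊢
  rwa [lead_sub hδ₁ hδ₂]

/-- The curves without claims have the derivative which occurs in the equation. -/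
theorem SatisfiesIDEAt.hasDerivWithinAt (hr : 0 < r) {D : Set (ℝ × ℝ)} {u : ℝ × ℝ} {t : ℝ}
    {I : Set ℝ} (hI : MapsTo (claimFree r c₁ c₂ u) I D)
    (h : SatisfiesIDEAt r lam c₁ c₂ δ₁ δ₂ f s D g (claimFree r c₁ c₂ u t)) :
    HasDerivWithinAt (fun t => g (claimFree r c₁ c₂ u t))
      ((lam + s) * g (claimFree r c₁ c₂ u t)
        - lam * ∫ z in Ioi (0 : ℝ), g ((claimFree r c₁ c₂ u t).1 - δ₁ * z,
          (claimFree r c₁ c₂ u t).2 - δ₂ * z) * f z) I t := by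
  obtain ⟨g', hg', heq⟩ := h
  have h1 := hg'.comp_hasDerivWithinAt t
    (hasDerivAt_claimFree r c₁ c₂ u t).hasDerivWithinAt hI
  refine h1.congr_deriv ?_
  set v := claimFree r c₁ c₂ u t
  have h2 : ((r * (v.1 + c₁ / r), r * (v.2 + c₂ / r)) : ℝ × ℝ)
      = (r * (v.1 + c₁ / r)) • ((1 : ℝ), (0 : ℝ)) + (r * (v.2 + c₂ / r)) • ((0 : ℝ), (1 : ℝ)) := by
    ext <;> simp
  rw [h2, map_add, map_smul, map_smul, smul_eq_mul, smul_eq_mul]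
  have h3 : r * ((v.1 + c₁ / r) * g' (1, 0) + (v.2 + c₂ / r) * g' (0, 1)
      - (lam + s) / r * g v + lam / r * ∫ z in Ioi (0 : ℝ),
        g (v.1 - δ₁ * z, v.2 - δ₂ * z) * f z) = 0 := by rw [heq, mul_zero]
  have h4 : r * ((lam + s) / r * g v) = (lam + s) * g v := by field_simp
  have h5 : ∀ x, r * (lam / r * x) = lam * x := by intro x; field_simp
  rw [mul_add, mul_sub, h4, h5] at h3
  linarith

/-- No measurability of `g` is assumed. Up to z = u₁/δ₁ the point stays where `g` is differentiable,
hence continuous; beyond, the first reserve is negative and `g` equals 1. -/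
theorem IsBoundedSolution.integrableOn
    (hg : IsBoundedSolution r lam c₁ c₂ δ₁ δ₂ f s b g) (hδ₁ : 0 < δ₁) (hδ₂ : 0 < δ₂)
    (hf : IntegrableOn f (Ioi 0)) {u : ℝ × ℝ} (hu : u ∈ quadrant ∩ region δ₁ δ₂) :
    IntegrableOn (fun z => g (u.1 - δ₁ * z, u.2 - δ₂ * z) * f z) (Ioi 0) := by
  obtain ⟨C, hC⟩ := hg.bounded
  have hz0 : 0 ≤ u.1 / δ₁ := div_nonneg hu.1.1 hδ₁.le
  have hcont : ContinuousOn g (quadrant ∩ region δ₁ δ₂) := by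
    intro v hv
    obtain ⟨g', hg', -⟩ := hg.equation v hv
    exact hg'.continuousWithinAt
  rw [← Ioc_union_Ioi_eq_Ioi hz0]
  refine IntegrableOn.union ?_ ?_
  · have h1 : ContinuousOn (fun z => g (u.1 - δ₁ * z, u.2 - δ₂ * z)) (Ioc 0 (u.1 / δ₁)) := by
      refine hcont.comp (by fun_prop) fun z hz => ⟨⟨?_, ?_⟩, sub_mem_region hδ₁ hδ₂ hu.2 z⟩
      · have := (le_div_iff₀ hδ₁).1 hz.2
        simp only
        linarith
      · have := (le_div_iff₀ hδ₂).1 (hz.2.trans hu.2)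
        simp only
        linarith
    have hf' : IntegrableOn f (Ioc 0 (u.1 / δ₁)) := hf.mono_set fun z hz => hz.1
    refine Integrable.bdd_mul (c := C) hf' (h1.aestronglyMeasurable measurableSet_Ioc) ?_
    exact Eventually.of_forall fun z => hC _ (sub_mem_region hδ₁ hδ₂ hu.2 z)
  · refine (hf.mono_set (Ioi_subset_Ioi hz0)).congr_fun (fun z hz => ?_) measurableSet_Ioi
    have h1 : u.1 - δ₁ * z < 0 := by
      have := (div_lt_iff₀ hδ₁).1 hz
      linarith
    rw [hg.ruined _ (sub_mem_region hδ₁ hδ₂ hu.2 z) (by simpa using Or.inl h1), one_mul]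

theorem abs_setIntegral_sub_le
    (h₁ : IsBoundedSolution r lam c₁ c₂ δ₁ δ₂ f s b g₁)
    (h₂ : IsBoundedSolution r lam c₁ c₂ δ₁ δ₂ f s b g₂)
    (hδ₁ : 0 < δ₁) (hδ₂ : 0 < δ₂) (hf0 : ∀ z, 0 ≤ f z) (hf : IntegrableOn f (Ioi 0))
    (hf1 : ∫ z in Ioi (0 : ℝ), f z = 1) {M : ℝ} (hM : 0 ≤ M)
    (hle : ∀ u ∈ quadrant ∩ region δ₁ δ₂, |g₁ u - g₂ u| ≤ M) {u : ℝ × ℝ}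
    (hu : u ∈ quadrant ∩ region δ₁ δ₂) :
    |(∫ z in Ioi (0 : ℝ), g₁ (u.1 - δ₁ * z, u.2 - δ₂ * z) * f z)
      - ∫ z in Ioi (0 : ℝ), g₂ (u.1 - δ₁ * z, u.2 - δ₂ * z) * f z| ≤ M := by
  rw [← integral_sub (h₁.integrableOn hδ₁ hδ₂ hf hu) (h₂.integrableOn hδ₁ hδ₂ hf hu),
    ← Real.norm_eq_abs]
  have hb : ∫ z in Ioi (0 : ℝ), M * f z = M := by rw [integral_const_mul, hf1, mul_one]
  rw [← hb]
  refine norm_integral_le_of_norm_le (hf.const_mul M) (Eventually.of_forall fun z => ?_)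
  rw [← sub_mul, norm_mul, Real.norm_eq_abs, Real.norm_eq_abs, abs_of_nonneg (hf0 z)]
  refine mul_le_mul_of_nonneg_right ?_ (hf0 z)
  have hmem := sub_mem_region hδ₁ hδ₂ hu.2 z
  by_cases hq : (u.1 - δ₁ * z, u.2 - δ₂ * z) ∈ quadrant
  · exact hle _ ⟨hq, hmem⟩
  · have h3 : min (u.1 - δ₁ * z) (u.2 - δ₂ * z) < 0 := by
      by_contra h
      rw [not_lt, le_min_iff] at h
      exact hq h
    rw [h₁.ruined _ hmem h3, h₂.ruined _ hmem h3]
    simpa using hM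

/-- By (1), the derivative of e^{-(lam + s)t}(g₁ - g₂) along a claim-free curve is -lam e^{-(lam +
s)t} times the difference of the claim integrals, which is at most M in absolute value. Integrating
gives the contraction factor plus an end term. -/
theorem abs_sub_le_along_claimFree
    (h₁ : IsBoundedSolution r lam c₁ c₂ δ₁ δ₂ f s b g₁)
    (h₂ : IsBoundedSolution r lam c₁ c₂ δ₁ δ₂ f s b g₂) (hr : 0 < r) (hlam : 0 < lam)
    (hs : 0 < s) (hδ₁ : 0 < δ₁) (hδ₂ : 0 < δ₂) (hf0 : ∀ z, 0 ≤ f z)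
    (hf : IntegrableOn f (Ioi 0)) (hf1 : ∫ z in Ioi (0 : ℝ), f z = 1) {M : ℝ} (hM : 0 ≤ M)
    (hle : ∀ u ∈ quadrant ∩ region δ₁ δ₂, |g₁ u - g₂ u| ≤ M) {u : ℝ × ℝ} {τ : ℝ} (hτ : 0 ≤ τ)
    (hmaps : MapsTo (claimFree r c₁ c₂ u) (Icc 0 τ) (quadrant ∩ region δ₁ δ₂)) :
    |g₁ u - g₂ u| ≤ lam / (lam + s) * M + Real.exp (-(lam + s) * τ)
      * |g₁ (claimFree r c₁ c₂ u τ) - g₂ (claimFree r c₁ c₂ u τ)| := by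
  set γ := claimFree r c₁ c₂ u with hγ
  set k := lam + s with hk
  have hk0 : 0 < k := by positivity
  set H : ℝ → ℝ := fun t => (∫ z in Ioi (0 : ℝ), g₁ ((γ t).1 - δ₁ * z, (γ t).2 - δ₂ * z) * f z)
      - ∫ z in Ioi (0 : ℝ), g₂ ((γ t).1 - δ₁ * z, (γ t).2 - δ₂ * z) * f z with hH
  set F : ℝ → ℝ := fun t => Real.exp (-k * t) * (g₁ (γ t) - g₂ (γ t)) with hF
  have hFd : ∀ t ∈ Icc 0 τ, HasDerivWithinAt F (-lam * Real.exp (-k * t) * H t) (Icc 0 τ) t := by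
    intro t ht
    have d1 := SatisfiesIDEAt.hasDerivWithinAt hr hmaps (h₁.equation _ (hmaps ht))
    have d2 := SatisfiesIDEAt.hasDerivWithinAt hr hmaps (h₂.equation _ (hmaps ht))
    have d3 : HasDerivAt (fun t => Real.exp (-k * t)) (Real.exp (-k * t) * -k) t := by
      simpa using ((hasDerivAt_id t).const_mul (-k)).exp
    refine (d3.hasDerivWithinAt.mul (d1.sub d2)).congr_deriv ?_
    simp only [hH, Pi.sub_apply]
    ring
  have hbd : ∀ t ∈ Icc 0 τ, ‖F t - F 0‖ ≤ lam / k * M * (1 - Real.exp (-k * t)) := by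
    refine image_norm_le_of_norm_deriv_right_le_deriv_boundary'
      (f' := fun t => -lam * Real.exp (-k * t) * H t)
      (B' := fun t => lam * M * Real.exp (-k * t)) ?_ ?_ (by simp) (by fun_prop) ?_ ?_
    · exact fun t ht => ((hFd t ht).continuousWithinAt).sub continuousWithinAt_const
    · intro t ht
      have := ((hFd t ⟨ht.1, ht.2.le⟩).sub_const (F 0)).mono_of_mem_nhdsWithin
        (Icc_mem_nhdsGE_of_mem ht)
      exact this
    · intro t _
      have d3 : HasDerivAt (fun t => Real.exp (-k * t)) (Real.exp (-k * t) * -k) t := by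
        simpa using ((hasDerivAt_id t).const_mul (-k)).exp
      refine ((d3.const_sub 1).const_mul (lam / k * M)).hasDerivWithinAt.congr_deriv ?_
      field_simp
    · intro t ht
      have h3 := abs_setIntegral_sub_le h₁ h₂ hδ₁ hδ₂ hf0 hf hf1 hM hle (hmaps ⟨ht.1, ht.2.le⟩)
      rw [norm_mul, norm_mul, norm_neg, Real.norm_eq_abs, Real.norm_eq_abs, Real.norm_eq_abs,
        Real.abs_exp, abs_of_pos hlam]
      calc lam * Real.exp (-k * t) * |H t| ≤ lam * Real.exp (-k * t) * M := by gcongr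
        _ = _ := by ring
  have h4 := hbd τ ⟨hτ, le_rfl⟩
  have h5 : F 0 = g₁ u - g₂ u := by simp [hF, hγ, claimFree_zero]
  have h6 : |F 0| ≤ |F τ - F 0| + |F τ| := by
    have := abs_sub (F τ) (F τ - F 0)
    rw [sub_sub_cancel] at this
    linarith
  have h7 : |F τ| = Real.exp (-k * τ) * |g₁ (γ τ) - g₂ (γ τ)| := by
    simp only [hF, abs_mul, Real.abs_exp]
  rw [← h5, ← h7]
  have h8 : lam / k * M * (1 - Real.exp (-k * τ)) ≤ lam / k * M :=
    mul_le_of_le_one_right (by positivity) (by linarith [Real.exp_pos (-k * τ)])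
  rw [Real.norm_eq_abs] at h4
  linarith

/-- The boundary value problem has at most one bounded solution. -/
theorem IsBoundedSolution.eqOn_region
    (h₁ : IsBoundedSolution r lam c₁ c₂ δ₁ δ₂ f s b g₁)
    (h₂ : IsBoundedSolution r lam c₁ c₂ δ₁ δ₂ f s b g₂) (hr : 0 < r) (hlam : 0 < lam)
    (hs : 0 < s) (hc₁ : 0 < c₁) (hc₂ : 0 < c₂) (hδ₁ : 0 < δ₁) (hδ₂ : 0 < δ₂)
    (hcδ : c₂ / δ₂ < c₁ / δ₁) (hf0 : ∀ z, 0 ≤ f z)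
    (hf : IntegrableOn f (Ioi 0)) (hf1 : ∫ z in Ioi (0 : ℝ), f z = 1) :
    EqOn g₁ g₂ (region δ₁ δ₂) := by
  set D := c₁ / (r * δ₁) - c₂ / (r * δ₂) with hDdef
  have hD : 0 < D := by
    have e : D = (c₁ / δ₁ - c₂ / δ₂) / r := by rw [hDdef]; field_simp
    rw [e]
    exact div_pos (sub_pos.2 hcδ) hr
  obtain ⟨C₁, hC₁⟩ := h₁.bounded
  obtain ⟨C₂, hC₂⟩ := h₂.bounded
  have key : ∀ u ∈ quadrant ∩ region δ₁ δ₂, g₁ u - g₂ u = 0 := by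
    refine eq_zero_of_abs_le_mul (θ := lam / (lam + s)) (C := C₁ + C₂) (by positivity)
      (by rw [div_lt_one (by linarith)]; linarith) ?_ ?_
    · intro u hu
      exact (abs_sub _ _).trans (add_le_add (hC₁ u hu.2) (hC₂ u hu.2))
    · intro M hM hle u hu
      -- A positive lead grows along the curve, so remaining in the region up to τ need only be
      -- checked at τ; a nonpositive one never leaves it.
      have hmaps : ∀ τ : ℝ, Real.exp (r * τ) * lead r c₁ c₂ δ₁ δ₂ u ≤ D ∨
          lead r c₁ c₂ δ₁ δ₂ u ≤ 0 →
          MapsTo (claimFree r c₁ c₂ u) (Icc 0 τ) (quadrant ∩ region δ₁ δ₂) := by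
        intro τ hτ t ht
        refine ⟨claimFree_mem_quadrant hr hc₁ hc₂ hu.1 ht.1, ?_⟩
        rw [mem_region_iff_lead (r := r) (c₁ := c₁) (c₂ := c₂), lead_claimFree hr hδ₁ hδ₂]
        rcases le_or_gt (lead r c₁ c₂ δ₁ δ₂ u) 0 with h | h
        · exact (mul_nonpos_of_nonneg_of_nonpos (Real.exp_pos _).le h).trans hD.le
        · have h3 := hτ.resolve_right (not_le.2 h)
          refine le_trans ?_ h3
          refine mul_le_mul_of_nonneg_right (Real.exp_le_exp.2 ?_) h.le
          exact mul_le_mul_of_nonneg_left ht.2 hr.le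
      rcases le_or_gt (lead r c₁ c₂ δ₁ δ₂ u) 0 with h | h
      -- The curve never meets the boundary line; letting τ → ∞, boundedness makes the discounted
      -- end term disappear.
      · have hlim : Tendsto (fun τ : ℝ => lam / (lam + s) * M + Real.exp (-(lam + s) * τ) * M)
            atTop (𝓝 (lam / (lam + s) * M)) := by
          have h3 : Tendsto (fun τ : ℝ => Real.exp (-(lam + s) * τ)) atTop (𝓝 0) :=
            Real.tendsto_exp_atBot.comp
              (tendsto_id.const_mul_atTop_of_neg (r := -(lam + s)) (by linarith))
          simpa using (h3.mul_const M).const_add (lam / (lam + s) * M)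
        refine ge_of_tendsto hlim ?_
        filter_upwards [eventually_ge_atTop (0 : ℝ)] with τ hτ
        refine (abs_sub_le_along_claimFree h₁ h₂ hr hlam hs hδ₁ hδ₂ hf0 hf hf1 hM hle hτ
          (hmaps τ (Or.inr h))).trans ?_
        gcongr
        exact hle _ (hmaps τ (Or.inr h) ⟨hτ, le_rfl⟩)
      · have hle' := (mem_region_iff_lead (r := r) (c₁ := c₁) (c₂ := c₂) u).1 hu.2
        -- The time at which the curve meets the boundary line, where both solutions have the
        -- prescribed value and the end term is 0.
        set τ := Real.log (D / lead r c₁ c₂ δ₁ δ₂ u) / r with hτdef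
        have hτ : 0 ≤ τ := log_div_div_nonneg hr h hle'
        have he : Real.exp (r * τ) * lead r c₁ c₂ δ₁ δ₂ u = D := by
          rw [hτdef, mul_div_cancel₀ _ hr.ne', Real.exp_log (by positivity)]
          field_simp
        have hm := hmaps τ (Or.inl he.le)
        have h3 := abs_sub_le_along_claimFree h₁ h₂ hr hlam hs hδ₁ hδ₂ hf0 hf hf1 hM hle hτ hm
        set v := claimFree r c₁ c₂ u τ with hv
        have hvq := (hm ⟨hτ, le_rfl⟩).1
        have hv2 : v = (v.1, δ₂ / δ₁ * v.1) := by
          have h4 : lead r c₁ c₂ δ₁ δ₂ v = D := by rw [hv, lead_claimFree hr hδ₁ hδ₂, he]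
          ext
          · rfl
          · simp only [lead, hDdef] at h4
            have h5 : v.1 / δ₁ = v.2 / δ₂ := by linarith
            rw [div_mul_eq_mul_div, mul_div_assoc, h5]
            field_simp
        have h0 : g₁ v - g₂ v = 0 := by
          rw [hv2, h₁.boundary _ hvq.1, h₂.boundary _ hvq.1, sub_self]
        rw [h0, abs_zero, mul_zero, add_zero] at h3
        exact h3
  intro u hu
  by_cases hq : u ∈ quadrant
  · exact sub_eq_zero.1 (key u ⟨hq, hu⟩)
  · have h3 : min u.1 u.2 < 0 := by
      by_contra h
      rw [not_lt, le_min_iff] at h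
      exact hq h
    rw [h₁.ruined u hu h3, h₂.ruined u hu h3]

end

/-! ### Paths of the reserves -/

section Paths

variable {Ω : Type*} {r s c c₁ c₂ δ δ₁ δ₂ e e₁ e₂ : ℝ} {T σ : ℕ → Ω → ℝ} {ω : Ω}

/-- The reserve of a line of business, measured in units of its share of the claims and shifted by
the capital whose interest is the premium. -/
def surplus (r : ℝ) (T σ : ℕ → Ω → ℝ) (x t : ℝ) (ω : Ω) : ℝ :=
  Real.exp (r * t) * x
    - ∑ k ∈ Finset.range (claimCount T t ω), Real.exp (r * (t - arrival T k ω)) * σ k ω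

/-- First time at which one of the two surpluses is below its threshold. -/
def lapseTime (r e₁ e₂ : ℝ) (T σ : ℕ → Ω → ℝ) (p : ℝ × ℝ) (ω : Ω) : ENNReal :=
  infTime {t : ℝ | 0 ≤ t ∧ (surplus r T σ p.1 t ω < e₁ ∨ surplus r T σ p.2 t ω < e₂)}

theorem integral_exp_mul_sub (hr : 0 < r) (t : ℝ) :
    ∫ v in (0 : ℝ)..t, Real.exp (r * (t - v)) = (Real.exp (r * t) - 1) / r := by
  have h : ∀ v ∈ uIcc 0 t, HasDerivAt (fun v => -(Real.exp (r * (t - v)) / r))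
      (Real.exp (r * (t - v))) v := by
    intro v _
    have h1 := (((((hasDerivAt_id v).const_sub t).const_mul r).exp).div_const r).neg
    refine h1.congr_deriv ?_
    simp only [id]
    field_simp
  rw [intervalIntegral.integral_eq_sub_of_hasDerivAt h
    (Continuous.intervalIntegrable (by fun_prop) _ _)]
  simp only [sub_self, mul_zero, Real.exp_zero, sub_zero]
  ring

theorem reserve_eq (hr : 0 < r) (hδ : 0 < δ) (u t : ℝ) :
    reserve r c δ T σ u t ω
      = δ * (surplus r T σ (u / δ + c / (r * δ)) t ω - c / (r * δ)) := by
  rw [reserve, surplus, integral_exp_mul_sub hr]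
  field_simp
  ring

theorem reserve_neg_iff (hr : 0 < r) (hδ : 0 < δ) (u t : ℝ) :
    reserve r c δ T σ u t ω < 0 ↔ surplus r T σ (u / δ + c / (r * δ)) t ω < c / (r * δ) := by
  rw [reserve_eq hr hδ, ← sub_neg (b := c / (r * δ))]
  simp [mul_neg_iff, hδ, hδ.not_gt]

theorem ruinTimeMin_eq (hr : 0 < r) (hδ₁ : 0 < δ₁) (hδ₂ : 0 < δ₂) (u : ℝ × ℝ) :
    ruinTimeMin r c₁ c₂ δ₁ δ₂ T σ u ω = lapseTime r (c₁ / (r * δ₁)) (c₂ / (r * δ₂)) T σ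
      (u.1 / δ₁ + c₁ / (r * δ₁), u.2 / δ₂ + c₂ / (r * δ₂)) ω := by
  simp only [ruinTimeMin, lapseTime, min_lt_iff, reserve_neg_iff hr hδ₁, reserve_neg_iff hr hδ₂]

theorem surplus_sub_surplus (x y t : ℝ) :
    surplus r T σ x t ω - surplus r T σ y t ω = Real.exp (r * t) * (x - y) := by
  simp only [surplus]
  ring

/-- If the first line is far enough ahead then the second one is ruined first. -/
theorem lapseTime_of_add_le (hr : 0 < r) (he : e₂ ≤ e₁) {x y : ℝ} (h : y + (e₁ - e₂) ≤ x) :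
    lapseTime r e₁ e₂ T σ (x, y) ω = infTime {t : ℝ | 0 ≤ t ∧ surplus r T σ y t ω < e₂} := by
  unfold lapseTime
  congr 1
  ext t
  refine and_congr_right fun ht => or_iff_right_of_imp fun h1 => ?_
  have h2 := surplus_sub_surplus (r := r) (T := T) (σ := σ) (ω := ω) x y t
  have h3 : 1 ≤ Real.exp (r * t) := Real.one_le_exp (by positivity)
  simp only at h1
  nlinarith

/-- The second surplus stays at least as large as the first and has the lower threshold. -/
theorem lapseTime_of_le (he : e₂ ≤ e₁) {x y : ℝ} (h : x ≤ y) :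
    lapseTime r e₁ e₂ T σ (x, y) ω = infTime {t : ℝ | 0 ≤ t ∧ surplus r T σ x t ω < e₁} := by
  unfold lapseTime
  congr 1
  ext t
  refine and_congr_right fun ht => or_iff_left_of_imp fun h1 => ?_
  have h2 := surplus_sub_surplus (r := r) (T := T) (σ := σ) (ω := ω) y x t
  have h3 := mul_nonneg (Real.exp_pos (r * t)).le (sub_nonneg.2 h)
  simp only at h1
  linarith

theorem infTime_eq_ofReal_add {a : ℝ} (ha : 0 ≤ a) {Q R : ℝ → Prop}
    (h : ∀ t, 0 ≤ t → (Q t ↔ a ≤ t ∧ R (t - a))) :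
    infTime {t | 0 ≤ t ∧ Q t} = ENNReal.ofReal a + infTime {t | 0 ≤ t ∧ R t} := by
  rw [infTime, infTime, ENNReal.add_sInf, sInf_image, iInf_image]
  refine le_antisymm (le_iInf₂ fun t ht => ?_) (le_iInf₂ fun t ht => ?_)
  · rw [← ENNReal.ofReal_add ha ht.1]
    refine iInf₂_le (a + t) ⟨add_nonneg ha ht.1, (h _ (add_nonneg ha ht.1)).2 ⟨?_, ?_⟩⟩
    · linarith [ht.1]
    · rw [add_sub_cancel_left]; exact ht.2
  · obtain ⟨h1, h2⟩ := (h t ht.1).1 ht.2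
    refine (iInf₂_le (t - a) ⟨sub_nonneg.2 h1, h2⟩).trans ?_
    rw [← ENNReal.ofReal_add ha (sub_nonneg.2 h1), add_sub_cancel]

theorem infTime_of_zero_mem {A : Set ℝ} (h : 0 ∈ A) : infTime A = 0 := by
  rw [infTime, ← nonpos_iff_eq_zero, ← ENNReal.ofReal_zero]
  exact sInf_le (mem_image_of_mem _ h)

theorem expNeg_zero (s : ℝ) : expNeg s 0 = 1 := by simp [expNeg]

theorem expNeg_ofReal_add {a : ℝ} (ha : 0 ≤ a) (τ : ENNReal) :
    expNeg s (ENNReal.ofReal a + τ) = Real.exp (-s * a) * expNeg s τ := by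
  by_cases h : τ = ⊤
  · simp [expNeg, h]
  · rw [expNeg, expNeg, if_neg h, if_neg (by simp [h]), ENNReal.toReal_add (by simp) h,
      ENNReal.toReal_ofReal ha, mul_add, Real.exp_add]

theorem expNeg_nonneg (s : ℝ) (τ : ENNReal) : 0 ≤ expNeg s τ := by
  unfold expNeg
  split_ifs
  exacts [le_rfl, (Real.exp_pos _).le]

theorem expNeg_le_one (hs : 0 < s) (τ : ENNReal) : expNeg s τ ≤ 1 := by
  unfold expNeg
  split_ifs
  · exact zero_le_one
  · rw [Real.exp_le_one_iff, neg_mul]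
    exact neg_nonpos.2 (by positivity)

/-- The paths with positive waiting times and only finitely many claims in bounded time. -/
def IsRegularPath (T : ℕ → Ω → ℝ) (ω : Ω) : Prop :=
  (∀ k, 0 < T k ω) ∧ Tendsto (fun n => ∑ i ∈ Finset.range n, T i ω) atTop atTop

theorem IsRegularPath.succ (h : IsRegularPath T ω) : IsRegularPath (fun k => T (k + 1)) ω := by
  refine ⟨fun k => h.1 (k + 1), ?_⟩
  have h1 := tendsto_atTop_add_const_right atTop (-T 0 ω) ((tendsto_add_atTop_iff_nat 1).2 h.2)
  refine h1.congr fun n => ?_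
  rw [Finset.sum_range_succ', add_neg_cancel_right]

theorem arrival_succ (k : ℕ) :
    arrival T (k + 1) ω = T 0 ω + arrival (fun k => T (k + 1)) k ω := by
  rw [arrival, arrival, Finset.sum_range_succ', add_comm]

theorem arrival_zero : arrival T 0 ω = T 0 ω := by simp [arrival]

theorem IsRegularPath.arrival_pos (h : IsRegularPath T ω) (k : ℕ) : 0 < arrival T k ω :=
  Finset.sum_pos (fun i _ => h.1 i) (by simp)

theorem IsRegularPath.finite_arrival_le (h : IsRegularPath T ω) (t : ℝ) :
    {k : ℕ | arrival T k ω ≤ t}.Finite := by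
  have h1 : Tendsto (fun k => arrival T k ω) atTop atTop := (tendsto_add_atTop_iff_nat 1).2 h.2
  have h2 := h1.eventually_gt_atTop t
  rw [← Nat.cofinite_eq_atTop, eventually_cofinite] at h2
  simpa using h2

theorem IsRegularPath.claimCount_of_lt (h : IsRegularPath T ω) {t : ℝ} (ht : t < T 0 ω) :
    claimCount T t ω = 0 := by
  have : {k : ℕ | arrival T k ω ≤ t} = ∅ := by
    refine eq_empty_of_forall_notMem fun k hk => ?_
    have hk : arrival T k ω ≤ t := hk
    cases k with
    | zero => rw [arrival_zero] at hk; linarith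
    | succ k => rw [arrival_succ] at hk; linarith [h.succ.arrival_pos k]
  rw [claimCount, this, ncard_empty]

/-- Finiteness is essential: `ncard` of an infinite set is 0, which would break the count. -/
theorem IsRegularPath.claimCount_of_le (h : IsRegularPath T ω) {t : ℝ} (ht : T 0 ω ≤ t) :
    claimCount T t ω = claimCount (fun k => T (k + 1)) (t - T 0 ω) ω + 1 := by
  have : {k : ℕ | arrival T k ω ≤ t} = insert 0
      (Nat.succ '' {k : ℕ | arrival (fun k => T (k + 1)) k ω ≤ t - T 0 ω}) := by
    ext k
    cases k with
    | zero => simp [arrival_zero, ht]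
    | succ k => simp [arrival_succ, le_sub_iff_add_le']
  rw [claimCount, this, ncard_insert_of_notMem (by simp) ((h.succ.finite_arrival_le _).image _),
    ncard_image_of_injective _ Nat.succ_injective, claimCount]

theorem IsRegularPath.surplus_of_lt (h : IsRegularPath T ω) {t : ℝ} (ht : t < T 0 ω) (x : ℝ) :
    surplus r T σ x t ω = Real.exp (r * t) * x := by
  rw [surplus, h.claimCount_of_lt ht, Finset.sum_range_zero, sub_zero]

theorem IsRegularPath.surplus_of_le (h : IsRegularPath T ω) {t : ℝ} (ht : T 0 ω ≤ t) (x : ℝ) :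
    surplus r T σ x t ω = surplus r (fun k => T (k + 1)) (fun k => σ (k + 1))
      (Real.exp (r * T 0 ω) * x - σ 0 ω) (t - T 0 ω) ω := by
  rw [surplus, surplus, h.claimCount_of_le ht, Finset.sum_range_succ', arrival_zero]
  simp only [arrival_succ, ← sub_sub]
  have h1 : Real.exp (r * t) = Real.exp (r * (t - T 0 ω)) * Real.exp (r * T 0 ω) := by
    rw [← Real.exp_add]
    congr 1
    ring
  rw [h1]
  ring

/-- The state after the first claim at time `t` and of size `z`. -/
def stateAfter (r : ℝ) (p : ℝ × ℝ) (t z : ℝ) : ℝ × ℝ :=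
  (Real.exp (r * t) * p.1 - z, Real.exp (r * t) * p.2 - z)

/-- Surpluses at or above positive thresholds only grow before the first claim, so no lapse can
precede it; afterwards the process restarts. -/
theorem IsRegularPath.lapseTime_of_mem_solvent (h : IsRegularPath T ω) (hr : 0 < r) (he₁ : 0 < e₁)
    (he₂ : 0 < e₂) {p : ℝ × ℝ} (hp : p ∈ solvent e₁ e₂) :
    lapseTime r e₁ e₂ T σ p ω = ENNReal.ofReal (T 0 ω)
      + lapseTime r e₁ e₂ (fun k => T (k + 1)) (fun k => σ (k + 1))
        (stateAfter r p (T 0 ω) (σ 0 ω)) ω := by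
  refine infTime_eq_ofReal_add (h.1 0).le fun t ht => ?_
  rcases lt_or_ge t (T 0 ω) with h1 | h1
  · have h2 : 1 ≤ Real.exp (r * t) := Real.one_le_exp (by positivity)
    rw [h.surplus_of_lt h1, h.surplus_of_lt h1]
    refine iff_of_false ?_ fun h3 => h1.not_ge h3.1
    rintro (h3 | h3)
    · nlinarith [hp.1]
    · nlinarith [hp.2]
  · rw [h.surplus_of_le h1, h.surplus_of_le h1]
    exact (and_iff_right h1).symm

theorem IsRegularPath.lapseTime_of_notMem_solvent (h : IsRegularPath T ω) {p : ℝ × ℝ}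
    (hp : p ∉ solvent e₁ e₂) : lapseTime r e₁ e₂ T σ p ω = 0 := by
  refine infTime_of_zero_mem ⟨le_rfl, ?_⟩
  rw [h.surplus_of_lt (h.1 0), h.surplus_of_lt (h.1 0), mul_zero, Real.exp_zero, one_mul, one_mul]
  by_contra h1
  push Not at h1
  exact hp h1

open Classical in
/-- The discounted indicator of a lapse which occurs at one of the first `n` claims. -/
def lapseApprox (r s e₁ e₂ : ℝ) : ℕ → (ℕ ⊕ ℕ → ℝ) → ℝ × ℝ → ℝ
  | 0, _, p => if p ∈ solvent e₁ e₂ then 0 else 1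
  | n + 1, w, p => if p ∈ solvent e₁ e₂ then
      Real.exp (-s * w (Sum.inl 0)) * lapseApprox r s e₁ e₂ n (w ∘ Sum.map Nat.succ Nat.succ)
        (stateAfter r p (w (Sum.inl 0)) (w (Sum.inr 0))) else 1

/-- A lapse missed by the approximation comes no earlier than the n-th claim, so it is discounted at
least by that arrival time. The induction ranges over all `T`, `σ`, since removing the first claim
shifts the sequences. -/
theorem abs_expNeg_lapseTime_sub_le (hr : 0 < r) (hs : 0 < s) (he₁ : 0 < e₁) (he₂ : 0 < e₂)
    (n : ℕ) : ∀ (T σ : ℕ → Ω → ℝ) (p : ℝ × ℝ), IsRegularPath T ω →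
    |expNeg s (lapseTime r e₁ e₂ T σ p ω) - lapseApprox r s e₁ e₂ n (fun i => Sum.elim T σ i ω) p|
      ≤ Real.exp (-s * ∑ i ∈ Finset.range n, T i ω) := by
  induction n with
  | zero =>
    intro T σ p h
    simp only [Finset.range_zero, Finset.sum_empty, mul_zero, Real.exp_zero]
    by_cases hp : p ∈ solvent e₁ e₂
    · rw [lapseApprox, if_pos hp, sub_zero, abs_of_nonneg (expNeg_nonneg _ _)]
      exact expNeg_le_one hs _
    · rw [lapseApprox, if_neg hp, h.lapseTime_of_notMem_solvent hp, expNeg_zero, sub_self, abs_zero]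
      exact zero_le_one
  | succ n ih =>
    intro T σ p h
    by_cases hp : p ∈ solvent e₁ e₂
    · have h1 : (fun i => Sum.elim T σ i ω) ∘ Sum.map Nat.succ Nat.succ
          = fun i => Sum.elim (fun k => T (k + 1)) (fun k => σ (k + 1)) i ω := by
        ext i
        cases i <;> rfl
      rw [lapseApprox, if_pos hp, h.lapseTime_of_mem_solvent hr he₁ he₂ hp,
        expNeg_ofReal_add (h.1 0).le, h1]
      simp only [Sum.elim_inl, Sum.elim_inr]
      rw [← mul_sub, abs_mul, Real.abs_exp, Finset.sum_range_succ', mul_add, Real.exp_add,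
        mul_comm (Real.exp (-s * ∑ _ ∈ _, _))]
      exact mul_le_mul_of_nonneg_left (ih _ _ _ h.succ) (Real.exp_pos _).le
    · rw [lapseApprox, if_neg hp, h.lapseTime_of_notMem_solvent hp, expNeg_zero, sub_self, abs_zero]
      exact (Real.exp_pos _).le

theorem measurable_stateAfter (r : ℝ) :
    Measurable fun a : (ℝ × ℝ) × ℝ × ℝ => stateAfter r a.1 a.2.1 a.2.2 := by
  unfold stateAfter
  fun_prop

theorem measurableSet_solvent (e₁ e₂ : ℝ) : MeasurableSet (solvent e₁ e₂) :=
  (measurableSet_le measurable_const measurable_fst).inter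
    (measurableSet_le measurable_const measurable_snd)

theorem measurable_lapseApprox (r s e₁ e₂ : ℝ) (n : ℕ) :
    Measurable fun a : (ℕ ⊕ ℕ → ℝ) × ℝ × ℝ => lapseApprox r s e₁ e₂ n a.1 a.2 := by
  induction n with
  | zero =>
    exact Measurable.ite (measurable_snd (measurableSet_solvent e₁ e₂)) measurable_const
      measurable_const
  | succ n ih =>
    refine Measurable.ite (measurable_snd (measurableSet_solvent e₁ e₂)) ?_ measurable_const
    have h0 : ∀ i, Measurable fun a : (ℕ ⊕ ℕ → ℝ) × ℝ × ℝ => a.1 i :=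
      fun i => (measurable_pi_apply i).comp measurable_fst
    have h1 : Measurable fun a : (ℕ ⊕ ℕ → ℝ) × ℝ × ℝ => a.1 ∘ Sum.map Nat.succ Nat.succ :=
      measurable_pi_lambda _ fun i => h0 _
    have h2 := (measurable_stateAfter r).comp
      (measurable_snd.prodMk ((h0 (Sum.inl 0)).prodMk (h0 (Sum.inr 0))))
    exact ((h0 (Sum.inl 0)).const_mul (-s)).exp.mul (ih.comp (h1.prodMk h2))

theorem lapseApprox_mem_Icc (n : ℕ) : ∀ (w : ℕ ⊕ ℕ → ℝ) (p : ℝ × ℝ), 0 < s →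
    (∀ k, 0 ≤ w (Sum.inl k)) → lapseApprox r s e₁ e₂ n w p ∈ Icc (0 : ℝ) 1 := by
  induction n with
  | zero =>
    intro w p _ _
    rw [lapseApprox]
    split_ifs <;> simp
  | succ n ih =>
    intro w p hs hw
    rw [lapseApprox]
    split_ifs
    · have h1 := ih (w ∘ Sum.map Nat.succ Nat.succ) (stateAfter r p (w (Sum.inl 0)) (w (Sum.inr 0)))
        hs fun k => hw _
      have h2 : Real.exp (-s * w (Sum.inl 0)) ≤ 1 := by
        rw [Real.exp_le_one_iff, neg_mul]
        exact neg_nonpos.2 (mul_nonneg hs.le (hw 0))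
      exact ⟨mul_nonneg (Real.exp_pos _).le h1.1, mul_le_one₀ h2 h1.1 h1.2⟩
    · simp

end Paths

/-! ### Independence of the first claim and the later ones -/

section Model

variable {Ω : Type*} [MeasurableSpace Ω] {P : Measure Ω} {r s lam e₁ e₂ : ℝ} {f : ℝ → ℝ}
  {T σ : ℕ → Ω → ℝ}

/-- Law of a claim size with density `f`. -/
def sizeLaw (f : ℝ → ℝ) : Measure ℝ :=
  (volume.restrict (Ioi (0 : ℝ))).withDensity fun z => ENNReal.ofReal (f z)

instance (f : ℝ → ℝ) : NullSingletonClass (sizeLaw f) := by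
  unfold sizeLaw
  infer_instance

theorem ae_sizeLaw_pos (f : ℝ → ℝ) : ∀ᵐ z ∂sizeLaw f, 0 < z :=
  (withDensity_absolutelyContinuous _ _).ae_le (ae_restrict_mem measurableSet_Ioi)

theorem integral_sizeLaw (hf : Measurable f) (hf0 : ∀ z, 0 ≤ f z) (g : ℝ → ℝ) :
    ∫ z, g z ∂sizeLaw f = ∫ z in Ioi (0 : ℝ), g z * f z := by
  rw [sizeLaw, integral_withDensity_eq_integral_toReal_smul hf.ennreal_ofReal (by simp)]
  refine integral_congr_ae (Eventually.of_forall fun z => ?_)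
  simp only [ENNReal.toReal_ofReal (hf0 z), smul_eq_mul, mul_comm]

theorem integrableOn_of_isProbabilityMeasure [IsProbabilityMeasure (sizeLaw f)]
    (hf : Measurable f) (hf0 : ∀ z, 0 ≤ f z) : IntegrableOn f (Ioi 0) := by
  have h : ∫⁻ z in Ioi (0 : ℝ), ENNReal.ofReal (f z) = 1 := by
    have h1 := measure_univ (μ := sizeLaw f)
    rwa [sizeLaw, withDensity_apply _ MeasurableSet.univ, Measure.restrict_univ] at h1
  refine ⟨hf.aestronglyMeasurable, ?_⟩
  rw [hasFiniteIntegral_iff_ofReal (Eventually.of_forall hf0), h]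
  exact ENNReal.one_lt_top

theorem integral_density [IsProbabilityMeasure (sizeLaw f)]
    (hf : Measurable f) (hf0 : ∀ z, 0 ≤ f z) : ∫ z in Ioi (0 : ℝ), f z = 1 := by
  have h := integral_sizeLaw hf hf0 fun _ => 1
  simpa using h.symm

namespace IsClaimModel

/-- That `f` has total mass 1 is not a separate assumption; it follows because `sizeLaw f` is the
law of a random variable. -/
theorem isProbabilityMeasure_sizeLaw [IsProbabilityMeasure P] (h : IsClaimModel P lam f T σ) :
    IsProbabilityMeasure (sizeLaw f) := by
  rw [sizeLaw, ← h.law_σ 0]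
  exact Measure.isProbabilityMeasure_map (h.measurable_σ 0).aemeasurable

theorem measurable_elim (h : IsClaimModel P lam f T σ) (i : ℕ ⊕ ℕ) :
    Measurable (Sum.elim T σ i) := by
  cases i
  exacts [h.measurable_T _, h.measurable_σ _]

theorem succ (h : IsClaimModel P lam f T σ) :
    IsClaimModel P lam f (fun k => T (k + 1)) (fun k => σ (k + 1)) where
  measurable_T k := h.measurable_T _
  measurable_σ k := h.measurable_σ _
  law_T k := h.law_T _
  law_σ k := h.law_σ _
  indep := by
    have h1 := h.indep.precomp (g := Sum.map Nat.succ Nat.succ)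
      (Nat.succ_injective.sumMap Nat.succ_injective)
    have h2 : (fun i => Sum.elim T σ (Sum.map Nat.succ Nat.succ i))
        = Sum.elim (fun k => T (k + 1)) (fun k => σ (k + 1)) := by
      ext i
      cases i <;> rfl
    rwa [h2] at h1

/-- The two sides are measurable for the σ-algebras generated by disjoint blocks of the index set.
-/
theorem indepFun_first (h : IsClaimModel P lam f T σ) :
    IndepFun (fun ω => (T 0 ω, σ 0 ω))
      (fun ω i => Sum.elim (fun k => T (k + 1)) (fun k => σ (k + 1)) i ω) P := by
  set S : Set (ℕ ⊕ ℕ) := {Sum.inl 0, Sum.inr 0}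
  set S' : Set (ℕ ⊕ ℕ) := range (Sum.map Nat.succ Nat.succ)
  have hdisj : Disjoint S S' := by
    rw [Set.disjoint_left]
    rintro _ (rfl | rfl) ⟨i, hi⟩ <;> cases i <;> simp at hi
  have h1 := indep_iSup_of_disjoint (fun i => (h.measurable_elim i).comap_le) h.indep.iIndep hdisj
  have hle : ∀ (A : Set (ℕ ⊕ ℕ)) (i), i ∈ A → Measurable[⨆ j ∈ A,
      MeasurableSpace.comap (Sum.elim T σ j) inferInstance] (Sum.elim T σ i) := fun A i hi =>
    (comap_measurable _).mono
      (le_iSup₂ (f := fun j (_ : j ∈ A) => MeasurableSpace.comap (Sum.elim T σ j) inferInstance)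
        i hi) le_rfl
  rw [IndepFun_iff_Indep]
  refine indep_of_indep_of_le_left (indep_of_indep_of_le_right h1 ?_) ?_
  · refine Measurable.comap_le ((@measurable_pi_iff Ω _ _ (_) _ _).2 fun i => ?_)
    have h2 := hle S' (Sum.map Nat.succ Nat.succ i) (mem_range_self i)
    cases i <;> exact h2
  · exact Measurable.comap_le (Measurable.prodMk (hle S (Sum.inl 0) (by simp [S]))
      (hle S (Sum.inr 0) (by simp [S])))

theorem map_first [IsProbabilityMeasure P] (h : IsClaimModel P lam f T σ) :
    P.map (fun ω => (T 0 ω, σ 0 ω)) = (expMeasure lam).prod (sizeLaw f) := by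
  have h1 : IndepFun (T 0) (σ 0) P :=
    h.indep.indepFun (i := Sum.inl 0) (j := Sum.inr 0) (by simp)
  rw [(indepFun_iff_map_prod_eq_prod_map_map (h.measurable_T 0).aemeasurable
    (h.measurable_σ 0).aemeasurable).1 h1, h.law_T, h.law_σ, sizeLaw]

/-- The strong law for the waiting times truncated at 1: these are bounded with positive mean, so
their sums diverge and dominate the untruncated ones from below. -/
theorem ae_isRegularPath [IsProbabilityMeasure P] (h : IsClaimModel P lam f T σ) :
    ∀ᵐ ω ∂P, IsRegularPath T ω := by
  have hpos : ∀ k, ∀ᵐ ω ∂P, 0 < T k ω := fun k =>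
    ae_of_ae_map (h.measurable_T k).aemeasurable (h.law_T k ▸ ae_expMeasure_pos lam)
  have hmin : Measurable fun t : ℝ => min t 1 := by fun_prop
  have hint : Integrable (fun ω => min (T 0 ω) 1) P := by
    refine Integrable.of_bound (C := 1) (hmin.comp (h.measurable_T 0)).aestronglyMeasurable ?_
    filter_upwards [hpos 0] with ω hω
    rw [Real.norm_eq_abs, abs_of_nonneg (le_min hω.le zero_le_one)]
    exact min_le_right _ _
  have hmean : 0 < ∫ ω, min (T 0 ω) 1 ∂P := by
    rw [integral_pos_iff_support_of_nonneg_ae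
      ((hpos 0).mono fun ω hω => le_min hω.le zero_le_one) hint]
    have : Function.support (fun ω => min (T 0 ω) 1) =ᵐ[P] univ := by
      filter_upwards [hpos 0] with ω hω
      exact eq_true (lt_min hω one_pos).ne'
    rw [measure_congr this, measure_univ]
    exact one_pos
  have hlln := strong_law_ae_real (fun k ω => min (T k ω) 1) hint
    (fun i j hij => (h.indep.indepFun (i := Sum.inl i) (j := Sum.inl j) (by simpa using hij)).comp
      hmin hmin)
    (fun i => IdentDistrib.comp ⟨(h.measurable_T i).aemeasurable, (h.measurable_T 0).aemeasurable,
      by rw [h.law_T, h.law_T]⟩ hmin)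
  filter_upwards [ae_all_iff.2 hpos, hlln] with ω hω hlim
  refine ⟨hω, ?_⟩
  have h1 := hlim.pos_mul_atTop hmean tendsto_natCast_atTop_atTop
  refine tendsto_atTop_mono' atTop ?_ h1
  filter_upwards [eventually_gt_atTop 0] with n hn
  rw [div_mul_cancel₀ _ (by positivity)]
  exact Finset.sum_le_sum fun i _ => min_le_left _ _

end IsClaimModel

end Model

/-! ### The renewal equation of the ruin transform -/

open Classical in
/-- Mean of `lapseApprox` in terms of the law of the first claim. -/
def lapseMean (r s lam e₁ e₂ : ℝ) (m : Measure ℝ) : ℕ → ℝ × ℝ → ℝ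
  | 0, p => if p ∈ solvent e₁ e₂ then 0 else 1
  | n + 1, p => if p ∈ solvent e₁ e₂ then
      ∫ a, Real.exp (-s * a.1) * lapseMean r s lam e₁ e₂ m n (stateAfter r p a.1 a.2)
        ∂((expMeasure lam).prod m) else 1

theorem measurable_lapseMean (r s lam e₁ e₂ : ℝ) (m : Measure ℝ)
    [SFinite ((expMeasure lam).prod m)] (n : ℕ) : Measurable (lapseMean r s lam e₁ e₂ m n) := by
  induction n with
  | zero => exact Measurable.ite (measurableSet_solvent e₁ e₂) measurable_const measurable_const
  | succ n ih =>
    refine Measurable.ite (measurableSet_solvent e₁ e₂) ?_ measurable_const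
    have h : Measurable fun a : (ℝ × ℝ) × ℝ × ℝ => Real.exp (-s * a.2.1)
        * lapseMean r s lam e₁ e₂ m n (stateAfter r a.1 a.2.1 a.2.2) :=
      (by fun_prop : Measurable fun a : (ℝ × ℝ) × ℝ × ℝ => Real.exp (-s * a.2.1)).mul
        (ih.comp (measurable_stateAfter r))
    exact h.stronglyMeasurable.integral_prod_right'.measurable

/-- The Laplace transform of the time of lapse. -/
def lapseTransform {Ω : Type*} [MeasurableSpace Ω] (P : Measure Ω) (r s e₁ e₂ : ℝ)
    (T σ : ℕ → Ω → ℝ) (p : ℝ × ℝ) : ℝ :=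
  ∫ ω, expNeg s (lapseTime r e₁ e₂ T σ p ω) ∂P

namespace IsClaimModel

variable {Ω : Type*} [MeasurableSpace Ω] {P : Measure Ω}
  {r s lam e₁ e₂ : ℝ} {f : ℝ → ℝ} {T σ : ℕ → Ω → ℝ}

theorem measurable_family (h : IsClaimModel P lam f T σ) :
    Measurable fun ω i => Sum.elim T σ i ω :=
  measurable_pi_lambda _ h.measurable_elim

theorem measurable_lapseApprox_family (h : IsClaimModel P lam f T σ) (n : ℕ) (p : ℝ × ℝ) :
    Measurable fun ω => lapseApprox r s e₁ e₂ n (fun i => Sum.elim T σ i ω) p :=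
  (measurable_lapseApprox r s e₁ e₂ n).comp (h.measurable_family.prodMk measurable_const)

variable [IsProbabilityMeasure P]

theorem ae_lapseApprox_mem_Icc (h : IsClaimModel P lam f T σ) (hs : 0 < s) (n : ℕ) (p : ℝ × ℝ) :
    ∀ᵐ ω ∂P, lapseApprox r s e₁ e₂ n (fun i => Sum.elim T σ i ω) p ∈ Icc (0 : ℝ) 1 := by
  filter_upwards [h.ae_isRegularPath] with ω hω
  exact lapseApprox_mem_Icc n _ _ hs fun k => (hω.1 k).le

/-- Independence of the first claim from the rest turns the expectation into an iterated integral,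
and the rest is again a claim model with the same parameters, so the induction hypothesis applies to
it. -/
theorem integral_lapseApprox (hs : 0 < s) (n : ℕ) : ∀ (T σ : ℕ → Ω → ℝ) (p : ℝ × ℝ),
    IsClaimModel P lam f T σ →
    ∫ ω, lapseApprox r s e₁ e₂ n (fun i => Sum.elim T σ i ω) p ∂P
      = lapseMean r s lam e₁ e₂ (sizeLaw f) n p := by
  induction n with
  | zero =>
    intro T σ p _
    simp [lapseApprox, lapseMean]
  | succ n ih =>
    intro T σ p h
    by_cases hp : p ∈ solvent e₁ e₂
    · set X : Ω → ℝ × ℝ := fun ω => (T 0 ω, σ 0 ω)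
      set Y : Ω → ℕ ⊕ ℕ → ℝ :=
        fun ω i => Sum.elim (fun k => T (k + 1)) (fun k => σ (k + 1)) i ω
      have hX : Measurable X := (h.measurable_T 0).prodMk (h.measurable_σ 0)
      have hY : Measurable Y := h.succ.measurable_family
      set G : (ℝ × ℝ) × (ℕ ⊕ ℕ → ℝ) → ℝ := fun a => Real.exp (-s * a.1.1)
        * lapseApprox r s e₁ e₂ n a.2 (stateAfter r p a.1.1 a.1.2) with hGdef
      have hG : Measurable G := by
        have h1 : Measurable fun a : (ℝ × ℝ) × (ℕ ⊕ ℕ → ℝ) => stateAfter r p a.1.1 a.1.2 :=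
          (measurable_stateAfter r).comp (measurable_const.prodMk measurable_fst)
        exact (by fun_prop : Measurable fun a : (ℝ × ℝ) × (ℕ ⊕ ℕ → ℝ) =>
          Real.exp (-s * a.1.1)).mul
            ((measurable_lapseApprox r s e₁ e₂ n).comp (measurable_snd.prodMk h1))
      have hfam : ∀ ω, (fun i => Sum.elim T σ i ω) ∘ Sum.map Nat.succ Nat.succ = Y ω := by
        intro ω
        ext i
        cases i <;> rfl
      have happ : ∀ ω, lapseApprox r s e₁ e₂ (n + 1) (fun i => Sum.elim T σ i ω) p
          = G (X ω, Y ω) := by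
        intro ω
        rw [lapseApprox, if_pos hp, hfam]
        rfl
      have hint : Integrable (fun ω => G (X ω, Y ω)) P := by
        refine Integrable.of_bound (C := 1) (hG.comp (hX.prodMk hY)).aestronglyMeasurable ?_
        filter_upwards [h.ae_lapseApprox_mem_Icc (r := r) (e₁ := e₁) (e₂ := e₂) hs (n + 1) p]
          with ω hω
        rw [happ] at hω
        rw [Real.norm_eq_abs, abs_of_nonneg hω.1]
        exact hω.2
      have hlaw := (indepFun_iff_map_prod_eq_prod_map_map hX.aemeasurable hY.aemeasurable).1
        h.indepFun_first
      have := Measure.isProbabilityMeasure_map (μ := P) hX.aemeasurable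
      have := Measure.isProbabilityMeasure_map (μ := P) hY.aemeasurable
      rw [lapseMean, if_pos hp, ← h.map_first, integral_congr_ae (Eventually.of_forall happ),
        ← integral_map (hX.prodMk hY).aemeasurable hG.aestronglyMeasurable, hlaw, integral_prod]
      · refine integral_congr_ae (Eventually.of_forall fun a => ?_)
        simp only [hGdef]
        have h1 : Measurable fun w => lapseApprox r s e₁ e₂ n w (stateAfter r p a.1 a.2) :=
          (measurable_lapseApprox r s e₁ e₂ n).comp (measurable_id.prodMk measurable_const)
        rw [integral_const_mul, integral_map hY.aemeasurable h1.aestronglyMeasurable,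
          ih _ _ _ h.succ]
      · rw [← hlaw]
        exact (integrable_map_measure hG.aestronglyMeasurable (hX.prodMk hY).aemeasurable).2 hint
    · simp [lapseApprox, lapseMean, hp]

theorem lapseMean_mem_Icc (h : IsClaimModel P lam f T σ) (hs : 0 < s) (n : ℕ) (p : ℝ × ℝ) :
    lapseMean r s lam e₁ e₂ (sizeLaw f) n p ∈ Icc (0 : ℝ) 1 := by
  rw [← integral_lapseApprox hs n T σ p h]
  have hb := h.ae_lapseApprox_mem_Icc (r := r) (e₁ := e₁) (e₂ := e₂) hs n p
  refine ⟨integral_nonneg_of_ae (hb.mono fun ω hω => hω.1), ?_⟩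
  have h1 := integral_mono_of_nonneg (hb.mono fun ω hω => hω.1) (integrable_const (1 : ℝ))
    (hb.mono fun ω hω => hω.2)
  simpa using h1

/-- Dominated convergence needs measurability of the explicit approximations only, so the lapse time
itself never has to be shown measurable. -/
theorem tendsto_lapseMean (h : IsClaimModel P lam f T σ) (hr : 0 < r) (hs : 0 < s) (he₁ : 0 < e₁)
    (he₂ : 0 < e₂) (p : ℝ × ℝ) :
    Tendsto (fun n => lapseMean r s lam e₁ e₂ (sizeLaw f) n p) atTop
      (𝓝 (lapseTransform P r s e₁ e₂ T σ p)) := by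
  simp only [← integral_lapseApprox hs _ T σ p h]
  refine tendsto_integral_of_dominated_convergence (fun _ => 1)
    (fun n => (h.measurable_lapseApprox_family n p).aestronglyMeasurable) (integrable_const _)
    (fun n => ?_) ?_
  · filter_upwards [h.ae_lapseApprox_mem_Icc (r := r) (e₁ := e₁) (e₂ := e₂) hs n p] with ω hω
    rw [Real.norm_eq_abs, abs_of_nonneg hω.1]
    exact hω.2
  · filter_upwards [h.ae_isRegularPath] with ω hω
    rw [tendsto_iff_norm_sub_tendsto_zero]
    have h1 : Tendsto (fun n => Real.exp (-s * ∑ i ∈ Finset.range n, T i ω)) atTop (𝓝 0) :=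
      Real.tendsto_exp_atBot.comp (hω.2.const_mul_atTop_of_neg (neg_lt_zero.2 hs))
    refine squeeze_zero (fun _ => norm_nonneg _) (fun n => ?_) h1
    rw [norm_sub_rev]
    exact abs_expNeg_lapseTime_sub_le hr hs he₁ he₂ n T σ p hω

/-- The Laplace transform of the time of lapse has the properties on which the analysis rests. -/
theorem isRuinTransform (h : IsClaimModel P lam f T σ) (hr : 0 < r) (hlam : 0 < lam) (hs : 0 < s)
    (he₂ : 0 < e₂) (he : e₂ < e₁) :
    IsRuinTransform r s lam e₁ e₂ (sizeLaw f) (lapseTransform P r s e₁ e₂ T σ) := by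
  have he₁ := he₂.trans he
  have := h.isProbabilityMeasure_sizeLaw
  have := isProbabilityMeasure_expMeasure hlam
  have hlim := h.tendsto_lapseMean hr hs he₁ he₂
  have hb : ∀ n p, lapseMean r s lam e₁ e₂ (sizeLaw f) n p ∈ Icc (0 : ℝ) 1 :=
    h.lapseMean_mem_Icc hs
  refine ⟨measurable_of_tendsto_metrizable (fun n => measurable_lapseMean r s lam e₁ e₂ _ n)
    (tendsto_pi_nhds.2 hlim), fun p => ge_of_tendsto' (hlim p) fun n => (hb n p).1,
    fun p => le_of_tendsto' (hlim p) fun n => (hb n p).2, fun p hp => ?_, fun p hp₁ hp₂ => ?_,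
    fun x y hxy => ?_, fun x y hxy => ?_⟩
  · have hp' : p ∉ solvent e₁ e₂ := fun h1 => hp.elim (not_lt.2 h1.1) (not_lt.2 h1.2)
    refine tendsto_nhds_unique (hlim p) (tendsto_const_nhds.congr fun n => ?_)
    cases n <;> simp [lapseMean, hp']
  · have hp : p ∈ solvent e₁ e₂ := ⟨hp₁, hp₂⟩
    -- The renewal equation is the limit of the recursion from n to n + 1.
    refine tendsto_nhds_unique ((tendsto_add_atTop_iff_nat 1).2 (hlim p)) ?_
    simp only [lapseMean, if_pos hp]
    refine tendsto_integral_of_dominated_convergence (fun a => 1) (fun n => ?_)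
      (integrable_const _) (fun n => ?_) (Eventually.of_forall fun a => (hlim _).const_mul _)
    · exact ((by fun_prop : Measurable fun a : ℝ × ℝ => Real.exp (-s * a.1)).mul
        ((measurable_lapseMean r s lam e₁ e₂ _ n).comp ((measurable_stateAfter r).comp
          (measurable_const.prodMk measurable_id)))).aestronglyMeasurable
    · filter_upwards [ae_claimLaw_fst_pos lam (sizeLaw f)] with a ha
      have h1 := hb n (stateAfter r p a.1 a.2)
      rw [Real.norm_eq_abs, abs_of_nonneg (mul_nonneg (Real.exp_pos _).le h1.1)]
      refine mul_le_one₀ ?_ h1.1 h1.2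
      rw [Real.exp_le_one_iff, neg_mul]
      exact neg_nonpos.2 (mul_nonneg hs.le (le_of_lt ha))
  · simp only [lapseTransform, lapseTime_of_add_le hr he.le hxy,
      lapseTime_of_add_le hr he.le (le_refl (y + (e₁ - e₂)))]
  · simp only [lapseTransform, lapseTime_of_le he.le hxy, lapseTime_of_le he.le (le_refl x)]

end IsClaimModel

/-! ### The boundary value problem -/

section

variable {r lam s c₁ c₂ δ₁ δ₂ : ℝ} {f : ℝ → ℝ} {g : ℝ × ℝ → ℝ}

/-- The first-order part of the equation is 1/r times the derivative along the claim-free curve. A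
one-sided derivative suffices, and only forward times are sure to stay in `D`. -/
theorem SatisfiesIDEAt.of_hasDerivWithinAt (hr : 0 < r) {D : Set (ℝ × ℝ)} {u : ℝ × ℝ}
    (hg : DifferentiableWithinAt ℝ g D u) (hD : MapsTo (claimFree r c₁ c₂ u) (Ici 0) D)
    (hd : HasDerivWithinAt (fun t => g (claimFree r c₁ c₂ u t)) ((lam + s) * g u
      - lam * ∫ z in Ioi (0 : ℝ), g (u.1 - δ₁ * z, u.2 - δ₂ * z) * f z) (Ici 0) 0) :
    SatisfiesIDEAt r lam c₁ c₂ δ₁ δ₂ f s D g u := by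
  obtain ⟨g', hg'⟩ := hg
  refine ⟨g', hg', ?_⟩
  have h0 := claimFree_zero r c₁ c₂ u
  have h1 := (h0.symm ▸ hg' : HasFDerivWithinAt g g' D (claimFree r c₁ c₂ u 0)).comp_hasDerivWithinAt
    (0 : ℝ) (hasDerivAt_claimFree r c₁ c₂ u 0).hasDerivWithinAt hD
  rw [h0] at h1
  have h2 := (uniqueDiffOn_Ici (0 : ℝ) 0 self_mem_Ici).eq_deriv _ h1 hd
  have h3 : ((r * (u.1 + c₁ / r), r * (u.2 + c₂ / r)) : ℝ × ℝ)
      = (r * (u.1 + c₁ / r)) • ((1 : ℝ), (0 : ℝ)) + (r * (u.2 + c₂ / r)) • ((0 : ℝ), (1 : ℝ)) := by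
    ext <;> simp
  rw [h3, map_add, map_smul, map_smul, smul_eq_mul, smul_eq_mul] at h2
  have h4 : (u.1 + c₁ / r) * g' (1, 0) + (u.2 + c₂ / r) * g' (0, 1)
      = ((lam + s) * g u
        - lam * ∫ z in Ioi (0 : ℝ), g (u.1 - δ₁ * z, u.2 - δ₂ * z) * f z) / r := by
    rw [eq_div_iff hr.ne', ← h2]
    ring
  rw [h4]
  ring

/-- The reserves of both lines in terms of their surpluses. -/
def toSurplus (r c₁ c₂ δ₁ δ₂ : ℝ) (u : ℝ × ℝ) : ℝ × ℝ :=
  (u.1 / δ₁ + c₁ / (r * δ₁), u.2 / δ₂ + c₂ / (r * δ₂))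

theorem toSurplus_claimFree (hr : 0 < r) (hδ₁ : 0 < δ₁) (hδ₂ : 0 < δ₂) (u : ℝ × ℝ) (t : ℝ) :
    toSurplus r c₁ c₂ δ₁ δ₂ (claimFree r c₁ c₂ u t)
      = (Real.exp (r * t) * (toSurplus r c₁ c₂ δ₁ δ₂ u).1,
        Real.exp (r * t) * (toSurplus r c₁ c₂ δ₁ δ₂ u).2) := by
  simp only [toSurplus, claimFree]
  ext <;> (simp only; field_simp; ring)

theorem toSurplus_sub (hδ₁ : 0 < δ₁) (hδ₂ : 0 < δ₂) (u : ℝ × ℝ) (z : ℝ) :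
    toSurplus r c₁ c₂ δ₁ δ₂ (u.1 - δ₁ * z, u.2 - δ₂ * z)
      = ((toSurplus r c₁ c₂ δ₁ δ₂ u).1 - z, (toSurplus r c₁ c₂ δ₁ δ₂ u).2 - z) := by
  simp only [toSurplus]
  ext <;> (simp only; field_simp; ring)

theorem toSurplus_mem_solvent_iff (hδ₁ : 0 < δ₁) (hδ₂ : 0 < δ₂) (u : ℝ × ℝ) :
    toSurplus r c₁ c₂ δ₁ δ₂ u ∈ solvent (c₁ / (r * δ₁)) (c₂ / (r * δ₂)) ↔ u ∈ quadrant := by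
  simp [toSurplus, solvent, quadrant, div_nonneg_iff, hδ₁.le, hδ₁.not_ge, hδ₂.le,
    hδ₂.not_ge]

end

section

variable {Ω : Type*} [MeasurableSpace Ω] {P : Measure Ω} {r lam s c₁ c₂ δ₁ δ₂ : ℝ} {f : ℝ → ℝ}
  {T σ : ℕ → Ω → ℝ}

theorem laplaceMin_eq (hr : 0 < r) (hδ₁ : 0 < δ₁) (hδ₂ : 0 < δ₂) (u : ℝ × ℝ) :
    laplaceMin P r c₁ c₂ δ₁ δ₂ T σ s u
      = lapseTransform P r s (c₁ / (r * δ₁)) (c₂ / (r * δ₂)) T σ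
        (toSurplus r c₁ c₂ δ₁ δ₂ u) := by
  simp only [laplaceMin, ruinTimeMin_eq hr hδ₁ hδ₂]
  rfl

/-- These points lie exactly on x - y = e₁ - e₂, so the two ruin times agree path by path. -/
theorem laplaceMin_boundary (hr : 0 < r) (hδ₁ : 0 < δ₁) (hδ₂ : 0 < δ₂)
    (he : c₂ / (r * δ₂) ≤ c₁ / (r * δ₁)) (x : ℝ) :
    laplaceMin P r c₁ c₂ δ₁ δ₂ T σ s (x, δ₂ / δ₁ * x)
      = laplaceRuin P r c₂ δ₂ T σ s (δ₂ / δ₁ * x) := by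
  have h : x / δ₁ = δ₂ / δ₁ * x / δ₂ := by field_simp
  simp only [laplaceMin, laplaceRuin, ruinTimeMin_eq hr hδ₁ hδ₂, ruinTime,
    reserve_neg_iff hr hδ₂, h]
  simp only [lapseTime_of_add_le hr he (le_of_eq (by ring) : δ₂ / δ₁ * x / δ₂ + c₂ / (r * δ₂)
    + (c₁ / (r * δ₁) - c₂ / (r * δ₂)) ≤ δ₂ / δ₁ * x / δ₂ + c₁ / (r * δ₁))]

variable [IsProbabilityMeasure P]

/-- This holds on the whole quadrant: differentiability across the line x - y = e₁ - e₂ makes it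
two-sided there, not merely within the region. -/
theorem IsClaimModel.laplaceMin_satisfiesIDEAt (h : IsClaimModel P lam f T σ) (hr : 0 < r)
    (hlam : 0 < lam) (hs : 0 < s) (hc₁ : 0 < c₁) (hc₂ : 0 < c₂) (hδ₁ : 0 < δ₁) (hδ₂ : 0 < δ₂)
    (he : c₂ / (r * δ₂) < c₁ / (r * δ₁)) (hf : Measurable f) (hf0 : ∀ z, 0 ≤ f z) {u : ℝ × ℝ}
    (hu : u ∈ quadrant) :
    SatisfiesIDEAt r lam c₁ c₂ δ₁ δ₂ f s quadrant (laplaceMin P r c₁ c₂ δ₁ δ₂ T σ s) u := by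
  have he₂ : 0 < c₂ / (r * δ₂) := by positivity
  have hΦ := h.isRuinTransform hr hlam hs he₂ he
  have := h.isProbabilityMeasure_sizeLaw
  have hm : ∀ᵐ z ∂sizeLaw f, 0 ≤ z := (ae_sizeLaw_pos f).mono fun z hz => hz.le
  have hu' := (toSurplus_mem_solvent_iff (r := r) (c₁ := c₁) (c₂ := c₂) hδ₁ hδ₂ u).2 hu
  have heq : laplaceMin P r c₁ c₂ δ₁ δ₂ T σ s
      = lapseTransform P r s (c₁ / (r * δ₁)) (c₂ / (r * δ₂)) T σ ∘ toSurplus r c₁ c₂ δ₁ δ₂ :=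
    funext (laplaceMin_eq hr hδ₁ hδ₂)
  rw [heq]
  have hmaps : MapsTo (claimFree r c₁ c₂ u) (Ici 0) quadrant :=
    fun t ht => claimFree_mem_quadrant hr hc₁ hc₂ hu ht
  refine SatisfiesIDEAt.of_hasDerivWithinAt hr ?_ hmaps ?_
  · refine (hΦ.differentiableWithinAt hr hlam hs he he₂ hm hu').comp u ?_
      fun v hv => (toSurplus_mem_solvent_iff hδ₁ hδ₂ v).2 hv
    unfold toSurplus
    fun_prop
  · have h1 := (hΦ.hasDerivAt_alongFlow hr hlam hs he he₂ hm hu').hasDerivWithinAt (s := Ici 0)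
    have h2 : ∀ t ∈ Ici (0 : ℝ), (lapseTransform P r s (c₁ / (r * δ₁)) (c₂ / (r * δ₂)) T σ ∘
        toSurplus r c₁ c₂ δ₁ δ₂) (claimFree r c₁ c₂ u t) =
          IsRuinTransform.alongFlow r s lam (sizeLaw f)
          (lapseTransform P r s (c₁ / (r * δ₁)) (c₂ / (r * δ₂)) T σ)
          (toSurplus r c₁ c₂ δ₁ δ₂ u) t := by
      intro t ht
      have h3 := (toSurplus_mem_solvent_iff (r := r) (c₁ := c₁) (c₂ := c₂) hδ₁ hδ₂ _).2 (hmaps ht)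
      rw [toSurplus_claimFree hr hδ₁ hδ₂] at h3
      rw [hΦ.alongFlow_eq hlam hs h3, Function.comp_apply, toSurplus_claimFree hr hδ₁ hδ₂]
    refine (h1.congr h2 (h2 0 self_mem_Ici)).congr_deriv ?_
    simp only [afterClaim, integral_sizeLaw hf hf0, Function.comp_apply, toSurplus_sub hδ₁ hδ₂]

theorem IsClaimModel.isBoundedSolution_laplaceMin (h : IsClaimModel P lam f T σ) (hr : 0 < r)
    (hlam : 0 < lam) (hs : 0 < s) (hc₁ : 0 < c₁) (hc₂ : 0 < c₂) (hδ₁ : 0 < δ₁) (hδ₂ : 0 < δ₂)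
    (he : c₂ / (r * δ₂) < c₁ / (r * δ₁)) (hf : Measurable f) (hf0 : ∀ z, 0 ≤ f z) :
    IsBoundedSolution r lam c₁ c₂ δ₁ δ₂ f s (laplaceRuin P r c₂ δ₂ T σ s)
      (laplaceMin P r c₁ c₂ δ₁ δ₂ T σ s) := by
  have hΦ := h.isRuinTransform hr hlam hs (by positivity) he
  refine ⟨⟨1, fun u _ => ?_⟩, fun u _ hu => ?_, fun u hu => ?_,
    fun x _ => laplaceMin_boundary hr hδ₁ hδ₂ he.le x⟩
  · rw [laplaceMin_eq hr hδ₁ hδ₂]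
    exact hΦ.abs_le_one _
  · rw [laplaceMin_eq hr hδ₁ hδ₂]
    refine hΦ.ruined _ ((min_lt_iff.1 hu).imp ?_ ?_) <;> intro h1 <;> simp only [toSurplus]
    · linarith [div_neg_of_neg_of_pos h1 hδ₁]
    · linarith [div_neg_of_neg_of_pos h1 hδ₂]
  · obtain ⟨g', hg', heq⟩ :=
      h.laplaceMin_satisfiesIDEAt hr hlam hs hc₁ hc₂ hδ₁ hδ₂ he hf hf0 hu.1
    exact ⟨g', hg'.mono inter_subset_left, heq⟩

end

end InterestRisk

end

theorem theorem2p1 {Ω : Type*} [MeasurableSpace Ω] (P : Measure Ω) [IsProbabilityMeasure P]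
    (r lam c₁ c₂ δ₁ δ₂ : ℝ) (f : ℝ → ℝ) (T σ : ℕ → Ω → ℝ)
    (hr : 0 < r) (hlam : 0 < lam) (hc₁ : 0 < c₁) (hc₂ : 0 < c₂)
    (hδ₁ : 0 < δ₁) (hδ₂ : 0 < δ₂) (hδ : δ₁ + δ₂ = 1)
    (hcδ : c₁ / δ₁ > c₂ / δ₂)
    (hf : Measurable f) (hf0 : ∀ z, 0 ≤ f z)
    (hmodel : InterestRisk.IsClaimModel P lam f T σ)
    (s : ℝ) (hs : 0 < s) :
    -- the equation for `Ψ_min`, with two-sided partial derivatives when `0 < u₁`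
    (∀ u ∈ InterestRisk.quadrant ∩ InterestRisk.region δ₁ δ₂,
      InterestRisk.SatisfiesIDEAt r lam c₁ c₂ δ₁ δ₂ f s InterestRisk.quadrant
        (InterestRisk.laplaceMin P r c₁ c₂ δ₁ δ₂ T σ s) u) ∧
    -- `Ψ_min` is a bounded solution of the boundary value problem
    InterestRisk.IsBoundedSolution r lam c₁ c₂ δ₁ δ₂ f s
      (InterestRisk.laplaceRuin P r c₂ δ₂ T σ s)
      (InterestRisk.laplaceMin P r c₁ c₂ δ₁ δ₂ T σ s) ∧
    -- and it is the only one
    (∀ g : ℝ × ℝ → ℝ,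
      InterestRisk.IsBoundedSolution r lam c₁ c₂ δ₁ δ₂ f s
        (InterestRisk.laplaceRuin P r c₂ δ₂ T σ s) g →
      ∀ u ∈ InterestRisk.region δ₁ δ₂,
        g u = InterestRisk.laplaceMin P r c₁ c₂ δ₁ δ₂ T σ s u) := by
  have he : c₂ / (r * δ₂) < c₁ / (r * δ₁) := by
    rw [mul_comm r, mul_comm r, ← div_div, ← div_div]
    exact div_lt_div_of_pos_right hcδ hr
  have hsol := hmodel.isBoundedSolution_laplaceMin (s := s) hr hlam hs hc₁ hc₂ hδ₁ hδ₂ he hf hf0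
  refine ⟨fun u hu => hmodel.laplaceMin_satisfiesIDEAt hr hlam hs hc₁ hc₂ hδ₁ hδ₂ he hf hf0 hu.1,
    hsol, fun g hg u hu => ?_⟩
  have := hmodel.isProbabilityMeasure_sizeLaw
  exact hg.eqOn_region hsol hr hlam hs hc₁ hc₂ hδ₁ hδ₂ hcδ hf0
    (InterestRisk.integrableOn_of_isProbabilityMeasure hf hf0)
    (InterestRisk.integral_density hf hf0) hu
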